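/- Let $k$ be a field, not necessarily algebraically closed, of characteristic different from $2$ and $3$, with separable closure $k^{\mathrm{sep}}$ and algebraic closure $\bar k$. Let $\mathcal{I}_4$ be the threefold in $\mathbb{P}^5$ defined by $$\sum_{j=0}^5 x_j=0,\qquad \Big(\sum_{j=0}^5 x_j^2\Big)^2-4\sum_{j=0}^5x_j^4=0,$$ regarded as a quartic hypersurface in the hyperplane $\sum_j x_j=0$, and let $\mathcal{E}_4\subset\mathcal{I}_4$ be the union of its sections by the ten hyperplanes in the orbit of $x_0+x_1+x_2=0$ under permutation of the coordinates. Let $\mathcal{I}\subset\mathbb{P}^4$ be an Igusa quartic over $k$: a quartic hypersurface $F=0$, with $F$ a quartic form over $k$, that a linear isomorphism over $k^{\mathrm{sep}}$ from $\mathbb{P}^4$ to the hyperplane $\sum_j x_j=0$ identifies with $\mathcal{I}_4$; let $\mathcal{E}\subset\mathcal{I}$ be the locus that is mapped to $\mathcal{E}_4$. Write $\mathrm{P}(a,b)=\sum_i \partial_iF(a)\,b_i$; write $T_a\mathcal{I}$ for the tangent space $\mathrm{P}(a,\cdot)=0$ of $\mathcal{I}$ at $a$, and $\mathcal{K}_a=T_a\mathcal{I}\cap\mathcal{I}$.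 A trope of the quartic surface $\mathcal{K}_a\subset T_a\mathcal{I}$ is a plane in $T_a\mathcal{I}$ whose scheme-theoretic intersection with $\mathcal{K}_a$ is a nonsingular conic counted with multiplicity two. Let $a,b\in\mathcal{I}(k)$ be distinct points outside $\mathcal{E}$ with $\mathrm{P}(a,b)=\mathrm{P}(b,a)=0$. Then $T_a\mathcal{I}\cap T_b\mathcal{I}$ is a plane, and it is a trope of both $\mathcal{K}_a$ and $\mathcal{K}_b$. Moreover, the scheme-theoretic intersection $\mathcal{K}_a\cap\mathcal{K}_b$ is a nonsingular conic in this plane, defined over $k$ and counted with multiplicity two, which passes through $a$, through $b$, and through five further points (defined over $\bar k$) that are nodes (ordinary double points) of both $\mathcal{K}_a$ and $\mathcal{K}_b$. -/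

import Mathlib

open scoped LinearAlgebra.Projectivization

noncomputable section

namespace IgusaQuartic

open MvPolynomial

/-! Coordinate vectors of `ℙ⁴` over `k` are functions `Fin 5 → k`, linear subspaces of `ℙ⁴` are
submodules of `Fin 5 → k` (a plane is a submodule of rank 3), and closed subschemes of `ℙ⁴` are
given by homogeneous ideals of `k[x₀, …, x₄]`, the scheme-theoretic intersection being the sum
of ideals. -/

/-! ### Polarity, tangent spaces, linear sections -/

section Forms

variable {K : Type*} [Field K]

/-- The polar pairing `P_F(a, b) = ∑ i, (∂ᵢF)(a) bᵢ`, as a linear form in `b`. -/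
def polar (F : MvPolynomial (Fin 5) K) (a : Fin 5 → K) : (Fin 5 → K) →ₗ[K] K :=
  ∑ i, eval a (pderiv i F) • LinearMap.proj i

/-- The tangent space at the point `a` to the hypersurface `F = 0`, as a linear subspace. -/
def tangentSpace (F : MvPolynomial (Fin 5) K) (a : ℙ K (Fin 5 → K)) : Submodule K (Fin 5 → K) :=
  LinearMap.ker (polar F a.rep)

/-- The second derivative `∑ i j, (∂ᵢ∂ⱼF)(p) vᵢ wⱼ`. -/
def hessian (F : MvPolynomial (Fin 5) K) (p v w : Fin 5 → K) : K :=
  ∑ i, ∑ j, eval p (pderiv i (pderiv j F)) * v i * w j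

/-- The homogeneous ideal of a linear subspace `W`: it is generated by the linear forms that
vanish on `W`. -/
def linearIdeal (W : Submodule K (Fin 5 → K)) : Ideal (MvPolynomial (Fin 5) K) :=
  Ideal.span {l | ∃ c : Fin 5 → K, (∀ w ∈ W, ∑ i, c i * w i = 0) ∧ l = ∑ i, C (c i) * X i}

/-- The ideal of the section by the linear subspace `T` of the hypersurface `F = 0`. -/
def sectionIdeal (T : Submodule K (Fin 5 → K)) (F : MvPolynomial (Fin 5) K) :
    Ideal (MvPolynomial (Fin 5) K) :=
  linearIdeal T ⊔ Ideal.span {F}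

/-- The surface `K_a = T_a I ∩ I`, where `I` is the hypersurface `F = 0`. -/
def kummer (F : MvPolynomial (Fin 5) K) (a : ℙ K (Fin 5 → K)) : Ideal (MvPolynomial (Fin 5) K) :=
  sectionIdeal (tangentSpace F a) F

/-- `W` is a plane and the quadratic form `q` defines a nonsingular conic in it (in characteristic
different from 2): the bilinear form of `q` is nondegenerate on `W`. -/
structure IsConic (W : Submodule K (Fin 5 → K)) (q : MvPolynomial (Fin 5) K) : Prop where
  finrank_eq : Module.finrank K W = 3
  isHomogeneous : q.IsHomogeneous 2
  nonsingular : ∀ w ∈ W, (∀ v ∈ W, polar q w v = 0) → w = 0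

/-- The closed subscheme with ideal `J` is the nonsingular conic `q = 0` in the plane `W`, counted
with multiplicity two in that plane. -/
def IsDoubleConic (J : Ideal (MvPolynomial (Fin 5) K)) (W : Submodule K (Fin 5 → K))
    (q : MvPolynomial (Fin 5) K) : Prop :=
  IsConic W q ∧ J = linearIdeal W ⊔ Ideal.span {q ^ 2}

/-- `W` is a trope of the surface `T ∩ {F = 0}`: a plane in `T` which intersects the surface in a
conic with multiplicity two. -/
def IsTrope (T : Submodule K (Fin 5 → K)) (F : MvPolynomial (Fin 5) K)
    (W : Submodule K (Fin 5 → K)) : Prop :=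
  W ≤ T ∧ ∃ q, IsDoubleConic (linearIdeal W ⊔ sectionIdeal T F) W q

/-- The points of the conic `q = 0` in the plane `W`. -/
def conicPoints (W : Submodule K (Fin 5 → K)) (q : MvPolynomial (Fin 5) K) :
    Set (ℙ K (Fin 5 → K)) :=
  {p | p.rep ∈ W ∧ eval p.rep q = 0}

/-- `p` is a node (ordinary double point) of the surface `T ∩ {F = 0}`, where `T` has projective
dimension 3: it is a singular point of the surface, and the quadratic form that defines the tangent
cone there, which is given by the second derivative on `T / ⟨p⟩`, is nondegenerate. -/
structure IsNode (T : Submodule K (Fin 5 → K)) (F : MvPolynomial (Fin 5) K)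
    (p : ℙ K (Fin 5 → K)) : Prop where
  finrank_eq : Module.finrank K T = 4
  mem : p.rep ∈ T
  eval_eq : eval p.rep F = 0
  singular : ∀ v ∈ T, polar F p.rep v = 0
  nondegenerate : ∀ v ∈ T, (∀ w ∈ T, hessian F p.rep v w = 0) → v ∈ Submodule.span K {p.rep}

end Forms

/-! ### Base change -/

section BaseChange

variable {k : Type*} [Field k] (L : Type*) [Field L] [Algebra k L]

/-- The inclusion `k⁵ → L⁵` for a field extension `L` of `k`. -/
def coordMap : (Fin 5 → k) →ₛₗ[algebraMap k L] (Fin 5 → L) where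
  toFun x i := algebraMap k L (x i)
  map_add' x y := by ext i; simp
  map_smul' c x := by ext i; simp

theorem coordMap_injective : Function.Injective (coordMap (k := k) L) := fun x y h => by
  ext i
  exact (algebraMap k L).injective (congrFun h i)

/-- A `k`-point of `ℙ⁴` viewed as an `L`-point. -/
def pointMap : ℙ k (Fin 5 → k) → ℙ L (Fin 5 → L) :=
  Projectivization.map (coordMap L) (coordMap_injective L)

end BaseChange

/-! ### Igusa quartics -/

section Igusa

/-- The quartic form `(∑ xⱼ²)² - 4 ∑ xⱼ⁴` in six variables. -/
def igusaForm (L : Type*) [Field L] : MvPolynomial (Fin 6) L :=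
  (∑ j, X j ^ 2) ^ 2 - 4 * ∑ j, X j ^ 4

/-- The hyperplane `∑ xⱼ = 0` in `L⁶`; the threefold `I₄` is the locus of `igusaForm L` in it. -/
def sumZero (L : Type*) [Field L] : Submodule L (Fin 6 → L) :=
  LinearMap.ker (∑ j, LinearMap.proj j : (Fin 6 → L) →ₗ[L] L)

variable {k : Type*} [Field k]

/-- The linear isomorphism `φ` from `L⁵` to the hyperplane `∑ xⱼ = 0` in `L⁶` induces an isomorphism
over `L` from the hypersurface `F = 0` in `ℙ⁴` to `I₄`: substituting `φ` into the form that
defines `I₄` gives `F`, up to a nonzero constant. -/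
def IsIsoToIgusa (L : Type*) [Field L] [Algebra k L] (F : MvPolynomial (Fin 5) k)
    (φ : (Fin 5 → L) ≃ₗ[L] sumZero L) : Prop :=
  ∃ c : L, c ≠ 0 ∧ map (algebraMap k L) F =
    C c * bind₁ (fun j => ∑ i, C ((φ (Pi.single i 1) : Fin 6 → L) j) * X i) (igusaForm L)

/-- The set of the `k`-points of `ℙ⁴` that `φ` maps to a point on one of the ten hyperplanes in the
`S₆`-orbit of `x₀ + x₁ + x₂ = 0`. The `k`-points of the exceptional locus are those that lie
also on `F = 0`. -/
def exceptional (L : Type*) [Field L] [Algebra k L] (φ : (Fin 5 → L) ≃ₗ[L] sumZero L) :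
    Set (ℙ k (Fin 5 → k)) :=
  {a | ∃ σ : Equiv.Perm (Fin 6),
    let x : Fin 6 → L := φ (coordMap L a.rep)
    x (σ 0) + x (σ 1) + x (σ 2) = 0}

end Igusa

end IgusaQuartic

end

open scoped LinearAlgebra.Projectivization

noncomputable section

namespace IgusaQuartic

/-! The Igusa quartic is dual to the Segre cubic $\sum\gamma_i=\sum\gamma_i^3=0$, and the
configuration is read off from a line on that cubic. Work over $\bar k$ in six coordinates with sum
zero.

The Gauss map `gauss` sends a point $x$ of the quartic to the cubic, and squaring coordinates brings
it back: $\mathrm{gauss}(x)_i^2=Dx_i+E$, with $D\ne0$ off the exceptional locus (`gauss_sq`). Let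
$x,y$ represent $a,b$ and put $\alpha=\mathrm{gauss}(x)$, $\beta=\mathrm{gauss}(y)$. Then
$P(x,y)=P(y,x)=0$ turns into $\sum\alpha_i\beta_i^2=\sum\alpha_i^2\beta_i=0$, so $\alpha$ and
$\beta$ span a line on the cubic (`IsGeneralPoint.isSegreLine`).

The plane $T_x\cap T_y$ is the annihilator of $1,\alpha,\beta$. The normalised products
$\alpha^2,\alpha\beta,\beta^2$ lie in it by the cubic relations, and they are independent, hence a
basis (`exists_eq_squares`). In the coordinates $X,Y,Z$ of this basis the squares of points $\gamma$
of the line form the conic $Y^2=4XZ$. At such a square the polar form of the quartic is a multiple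
of $\gamma$ (`three_mul_igusaPolar_mixed_self`), so it vanishes on the plane. The quartic is
therefore singular along the conic inside the plane and restricts to $\kappa(Y^2-4XZ)^2$
(`igusaValue_squares`). A first order deformation of the relation between $x$ and $\alpha^2$ shows
$\kappa\ne0$ (`igusaHessian_squares_ne_zero`).

The multiple of $\gamma$ is, up to a constant, $\prod_{j\ge1}(\gamma_0+\gamma_j)$. Its five zeros on
the line give singular points of the quartic on the conic. These zeros are simple, which makes the
points ordinary double points of both tangent sections (`eq_smul_node`).

Finally, `conicValue` writes the conic through second derivatives at $x$ and $y$, so that it is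
defined over $k$, and the identity between its square and the quartic descends to an equality of
ideals over $k$ (`sup_span_eq`). -/

theorem sextic_of_sum_eq_zero {R : Type*} [CommRing R] (a b c d e f : R) (h : a + b + c + d + e + f = 0) :
    ∃ e₂ e₃ e₄ e₅ e₆ : R,
      (∀ t, (t - a) * (t - b) * (t - c) * (t - d) * (t - e) * (t - f) =
        t ^ 6 + e₂ * t ^ 4 - e₃ * t ^ 3 + e₄ * t ^ 2 - e₅ * t + e₆) ∧
      a ^ 2 + b ^ 2 + c ^ 2 + d ^ 2 + e ^ 2 + f ^ 2 = -2 * e₂ ∧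
      a ^ 3 + b ^ 3 + c ^ 3 + d ^ 3 + e ^ 3 + f ^ 3 = 3 * e₃ ∧
      a ^ 4 + b ^ 4 + c ^ 4 + d ^ 4 + e ^ 4 + f ^ 4 = 2 * e₂ ^ 2 - 4 * e₄ ∧
      (a + b) * (a + c) * (a + d) * (a + e) * (a + f) = e₅ + a ^ 2 * e₃ ∧
      (a + b + c) * (a + b + d) * (a + b + e) * (a + b + f) * (a + c + d) * (a + c + e) *
        (a + c + f) * (a + d + e) * (a + d + f) * (a + e + f) =
        -e₅ ^ 2 + 4 * e₄ * e₆ - e₃ ^ 2 * e₄ + e₂ * e₃ * e₅ - e₂ ^ 2 * e₆ := by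
  obtain rfl : f = -(a + b + c + d + e) := by linear_combination h
  set s := -(a + b + c + d + e) with hs
  -- The witnesses are the elementary symmetric functions. The product of the sums with $a$ comes
  -- from comparing the sextic at $a$ and at $-a$. When $4e_4=e_2^2$, the expression for the ten
  -- triple sums is $-(e_5-e_2e_3/2)^2$.
  refine ⟨a*b+a*c+a*d+a*e+a*s+b*c+b*d+b*e+b*s+c*d+c*e+c*s+d*e+d*s+e*s,
    a*b*(c+d+e+s)+a*c*(d+e+s)+a*d*(e+s)+a*e*s+b*c*(d+e+s)+b*d*(e+s)+b*e*s+c*d*(e+s)+c*e*s+d*e*s,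
    a*b*c*(d+e+s)+a*b*d*(e+s)+a*b*e*s+a*c*d*(e+s)+a*c*e*s+a*d*e*s+b*c*d*(e+s)+b*c*e*s+b*d*e*s
      +c*d*e*s,
    b*c*d*e*s+a*c*d*e*s+a*b*d*e*s+a*b*c*e*s+a*b*c*d*s+a*b*c*d*e, a*b*c*d*e*s,
    fun t => ?_, ?_, ?_, ?_, ?_, ?_⟩ <;> rw [hs]
  all_goals ring

/-! ### The form of the Igusa quartic in six coordinates and its derivatives -/

section SixCoordinates

variable {R : Type*} [CommRing R]

/-- The value of the quartic form `(∑ xⱼ²)² - 4 ∑ xⱼ⁴`. -/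
def igusaValue (x : Fin 6 → R) : R :=
  (∑ i, x i ^ 2) ^ 2 - 4 * ∑ i, x i ^ 4

/-- The derivative of `igusaValue` at `x` in the direction `v`. -/
def igusaPolar (x v : Fin 6 → R) : R :=
  4 * (∑ i, x i ^ 2) * (∑ i, x i * v i) - 16 * ∑ i, x i ^ 3 * v i

/-- The second derivative of `igusaValue` at `x` in the directions `v` and `w`. -/
def igusaHessian (x v w : Fin 6 → R) : R :=
  8 * (∑ i, x i * v i) * (∑ i, x i * w i) + 4 * (∑ i, x i ^ 2) * (∑ i, v i * w i)
    - 48 * ∑ i, x i ^ 2 * v i * w i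

/-- The polarity with respect to `igusaValue`, up to a scalar, in coordinates with sum zero. -/
def gauss (x : Fin 6 → R) : Fin 6 → R := fun i =>
  12 * x i ^ 3 - 3 * (∑ j, x j ^ 2) * x i - 2 * ∑ j, x j ^ 3

/-- The polarised square `6 αβ - ∑ αβ`, which has coordinate sum zero. -/
def mixed (α β : Fin 6 → R) : Fin 6 → R := fun i =>
  6 * (α i * β i) - ∑ j, α j * β j

theorem sum_gauss (x : Fin 6 → R) (hx : ∑ i, x i = 0) : ∑ i, gauss x i = 0 := by
  simp only [gauss, Fin.sum_univ_six] at *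
  linear_combination (-3 * (x 0 ^ 2 + x 1 ^ 2 + x 2 ^ 2 + x 3 ^ 2 + x 4 ^ 2 + x 5 ^ 2)) * hx

/-- The last term of `gauss` is the same in all coordinates, so it is invisible to $v$ with sum
zero; it only normalises the sum of `gauss x`. -/
theorem three_mul_igusaPolar (x v : Fin 6 → R) (hv : ∑ i, v i = 0) :
    3 * igusaPolar x v = -4 * ∑ i, gauss x i * v i := by
  simp only [gauss, igusaPolar, Fin.sum_univ_six] at *
  linear_combination (-8 * (x 0 ^ 3 + x 1 ^ 3 + x 2 ^ 3 + x 3 ^ 3 + x 4 ^ 3 + x 5 ^ 3)) * hv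

theorem igusaPolar_self (x : Fin 6 → R) : igusaPolar x x = 4 * igusaValue x := by
  simp only [igusaPolar, igusaValue, Fin.sum_univ_six]; ring

theorem igusaHessian_self (x v : Fin 6 → R) : igusaHessian x x v = 3 * igusaPolar x v := by
  simp only [igusaPolar, igusaHessian, Fin.sum_univ_six]; ring

theorem igusaHessian_comm (x v w : Fin 6 → R) : igusaHessian x v w = igusaHessian x w v := by
  simp only [igusaHessian, Fin.sum_univ_six]; ring

theorem sum_mixed (α β : Fin 6 → R) : ∑ i, mixed α β i = 0 := by
  simp only [mixed, Fin.sum_univ_six]; ring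

/-- The square of the polarity is affine linear on the quartic. The leading coefficient vanishes
only on the exceptional locus. -/
theorem gauss_sq (x : Fin 6 → R) (hx : ∑ i, x i = 0) :
    ∃ D E r : R, (∀ i, gauss x i ^ 2 = D * x i + E - 9 * igusaValue x * x i ^ 2) ∧
      D ^ 2 = igusaValue x * r - 20736 *
        ((x 0 + x 1 + x 2) * (x 0 + x 1 + x 3) * (x 0 + x 1 + x 4) * (x 0 + x 1 + x 5) *
          (x 0 + x 2 + x 3) * (x 0 + x 2 + x 4) * (x 0 + x 2 + x 5) * (x 0 + x 3 + x 4) *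
          (x 0 + x 3 + x 5) * (x 0 + x 4 + x 5)) := by
  rw [Fin.sum_univ_six] at hx
  obtain ⟨e₂, e₃, e₄, e₅, e₆, hroot, h2, h3, h4, -, h10⟩ :=
    sextic_of_sum_eq_zero _ _ _ _ _ _ hx
  rw [h10]
  have hval : igusaValue x = 16 * e₄ - 4 * e₂ ^ 2 := by
    simp only [igusaValue, Fin.sum_univ_six, h2, h4]; ring
  -- Here $\mathrm{gauss}(x)_i=12(t^3+e_2t/2-e_3/2)$ at $t=x_i$. Its square agrees with $144$ times
  -- the sextic in degrees above two, up to a multiple of $4e_4-e_2^2$, that is, of `igusaValue x`;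
  -- what remains is linear in $t$.
  refine ⟨72 * (2 * e₅ - e₂ * e₃), 36 * e₃ ^ 2 - 144 * e₆, 1296 * (4 * e₆ - e₃ ^ 2), fun i => ?_,
    by rw [hval]; ring⟩
  have hi : x i ^ 6 + e₂ * x i ^ 4 - e₃ * x i ^ 3 + e₄ * x i ^ 2 - e₅ * x i + e₆ = 0 := by
    rw [← hroot]; fin_cases i <;> simp
  rw [hval]
  simp only [gauss, Fin.sum_univ_six, h2, h3]
  linear_combination 144 * hi

/-- The polarity maps the squares of a point of the Segre cubic back to that point. -/
theorem three_mul_igusaPolar_mixed_self (γ v : Fin 6 → R) (h1 : ∑ i, γ i = 0)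
    (h3 : ∑ i, γ i ^ 3 = 0) (hv : ∑ i, v i = 0) :
    3 * igusaPolar (mixed γ γ) v = -10368 * ((γ 0 + γ 1) * (γ 0 + γ 2) * (γ 0 + γ 3) *
      (γ 0 + γ 4) * (γ 0 + γ 5)) * ∑ i, γ i * v i := by
  rw [Fin.sum_univ_six] at h1 h3
  obtain ⟨e₂, e₃, e₄, e₅, e₆, hroot, hp2, hp3, hp4, h5, -⟩ :=
    sextic_of_sum_eq_zero _ _ _ _ _ _ h1
  rw [h5]
  rw [h3] at hp3
  obtain ⟨q, hq⟩ : ∃ q, q = ∑ i, γ i * γ i := ⟨_, rfl⟩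
  have hq2 : q = -2 * e₂ := by rw [hq, ← hp2, Fin.sum_univ_six]; ring
  have hP : ∑ i, mixed γ γ i ^ 2 = 36 * (2 * e₂ ^ 2 - 4 * e₄) - 6 * q ^ 2 := by
    simp only [mixed, ← hq]
    simp only [Fin.sum_univ_six] at hq ⊢
    rw [← hp4]
    linear_combination 12 * q * hq
  -- Each coordinate of the gradient at `mixed γ γ` is a cubic polynomial in $\gamma_i^2$. The
  -- sextic satisfied by $\gamma_i$, with $3e_3=0$, lowers it to a linear one in $\gamma_i$; its
  -- constant term $\kappa$ is killed by $\sum v_i=0$.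
  obtain ⟨κ, hκ⟩ : ∃ κ, ∀ i, 3 * (4 * (∑ i, mixed γ γ i ^ 2) * mixed γ γ i
      - 16 * mixed γ γ i ^ 3) = -10368 * (e₅ + γ 0 ^ 2 * e₃) * γ i + κ := by
    refine ⟨3 * (16 * q ^ 3 - 4 * (36 * (2 * e₂ ^ 2 - 4 * e₄) - 6 * q ^ 2) * q + 3456 * e₆),
      fun i => ?_⟩
    have hi : γ i ^ 6 + e₂ * γ i ^ 4 - e₃ * γ i ^ 3 + e₄ * γ i ^ 2 - e₅ * γ i + e₆ = 0 := by
      rw [← hroot]; fin_cases i <;> simp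
    rw [hP]
    simp only [mixed, ← hq]
    rw [hq2]
    linear_combination (-10368) * hi + (-3456 * γ 0 ^ 2 * γ i + 3456 * γ i ^ 3) * hp3
  have hsum : 3 * igusaPolar (mixed γ γ) v = ∑ i, (3 * (4 * (∑ i, mixed γ γ i ^ 2) * mixed γ γ i
      - 16 * mixed γ γ i ^ 3)) * v i := by
    rw [igusaPolar]
    generalize ∑ i, mixed γ γ i ^ 2 = P
    simp only [Fin.sum_univ_six]
    ring
  simp only [hκ] at hsum
  rw [hsum]
  simp only [Fin.sum_univ_six] at hv ⊢
  linear_combination κ * hv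

end SixCoordinates

/-! ### Lines on the Segre cubic -/

/-- `α` and `β` span a line on the Segre cubic `∑ xᵢ = ∑ xᵢ³ = 0`, and are not on the planes
`xᵢ + xⱼ = xₖ + xₗ = xₘ + xₙ = 0`. The condition on signs says that the line contains none of the
nodes of the cubic. -/
structure IsSegreLine {K : Type*} [Field K] (α β : Fin 6 → K) : Prop where
  sum_left : ∑ i, α i = 0
  sum_right : ∑ i, β i = 0
  cube_left : ∑ i, α i ^ 3 = 0
  sq_left : ∑ i, α i ^ 2 * β i = 0
  sq_right : ∑ i, α i * β i ^ 2 = 0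
  cube_right : ∑ i, β i ^ 3 = 0
  pair_left : ∀ i j, i ≠ j → α i + α j ≠ 0
  pair_right : ∀ i j, i ≠ j → β i + β j ≠ 0
  sign : ∀ ε : Fin 6 → K, (∀ i, ε i ^ 2 = 1) → ∑ i, ε i = 0 → ∑ i, ε i * α i ^ 2 ≠ 0
  indep : ∀ p q : K, (∀ i, p * α i + q * β i = 0) → p = 0 ∧ q = 0

/-- The symmetric group is 3-transitive; arguments about distinct indices can thus be carried out at
fixed coordinates. -/
theorem exists_perm_fin_six (i j k : Fin 6) (hij : i ≠ j) (hik : i ≠ k) (hjk : j ≠ k) :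
    ∃ σ : Equiv.Perm (Fin 6), σ 0 = i ∧ σ 1 = j ∧ σ 2 = k := by
  have hf : Function.Injective ![i, j, k] := by
    intro a b
    fin_cases a <;> fin_cases b <;> simp [hij, hik, hjk, hij.symm, hik.symm, hjk.symm]
  have hg : Function.Injective ![(0 : Fin 6), 1, 2] := by decide
  obtain ⟨σ, hσ⟩ := (Equiv.Perm.isMultiplyPretransitive (Fin 6) 3).exists_smul_eq
    ⟨_, hg⟩ ⟨_, hf⟩
  refine ⟨σ, ?_, ?_, ?_⟩
  · simpa using congrArg (fun f : Fin 3 ↪ Fin 6 => f 0) hσ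
  · simpa using congrArg (fun f : Fin 3 ↪ Fin 6 => f 1) hσ
  · simpa using congrArg (fun f : Fin 3 ↪ Fin 6 => f 2) hσ

namespace IsSegreLine

variable {K : Type*} [Field K] {α β : Fin 6 → K}

theorem perm (h : IsSegreLine α β) (σ : Equiv.Perm (Fin 6)) : IsSegreLine (α ∘ σ) (β ∘ σ) where
  sum_left := by simpa [Equiv.sum_comp σ] using h.sum_left
  sum_right := by simpa [Equiv.sum_comp σ] using h.sum_right
  cube_left := (Equiv.sum_comp σ fun i => α i ^ 3).trans h.cube_left
  sq_left := (Equiv.sum_comp σ fun i => α i ^ 2 * β i).trans h.sq_left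
  sq_right := (Equiv.sum_comp σ fun i => α i * β i ^ 2).trans h.sq_right
  cube_right := (Equiv.sum_comp σ fun i => β i ^ 3).trans h.cube_right
  pair_left i j hij := h.pair_left _ _ (σ.injective.ne hij)
  pair_right i j hij := h.pair_right _ _ (σ.injective.ne hij)
  sign ε hε hs := by
    have := h.sign (ε ∘ σ.symm) (fun i => hε _)
      ((Equiv.sum_comp σ.symm ε).trans hs)
    rwa [← Equiv.sum_comp σ, show (∑ i, (ε ∘ σ.symm) (σ i) * α (σ i) ^ 2) =
      ∑ i, ε i * (α ∘ σ) i ^ 2 by simp] at this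
  indep p q hpq := h.indep p q fun i => by simpa using hpq (σ.symm i)

theorem sum_comb (h : IsSegreLine α β) (p q : K) : ∑ i, (p * α i + q * β i) = 0 := by
  rw [Finset.sum_add_distrib, ← Finset.mul_sum, ← Finset.mul_sum, h.sum_left, h.sum_right]
  ring

theorem cube_comb (h : IsSegreLine α β) (p q : K) : ∑ i, (p * α i + q * β i) ^ 3 = 0 := by
  have h1 := h.cube_left
  have h2 := h.sq_left
  have h3 := h.sq_right
  have h4 := h.cube_right
  simp only [Fin.sum_univ_six] at *
  linear_combination p ^ 3 * h1 + 3 * p ^ 2 * q * h2 + 3 * p * q ^ 2 * h3 + q ^ 3 * h4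

theorem comb_mul_sq_left (h : IsSegreLine α β) (p q : K) :
    ∑ i, (p * α i + q * β i) * α i ^ 2 = 0 := by
  have h1 := h.cube_left
  have h2 := h.sq_left
  simp only [Fin.sum_univ_six] at *
  linear_combination p * h1 + q * h2

theorem comb_sq_mul_left (h : IsSegreLine α β) (p q : K) :
    ∑ i, (p * α i + q * β i) ^ 2 * α i = 0 := by
  have h1 := h.cube_left
  have h2 := h.sq_left
  have h3 := h.sq_right
  simp only [Fin.sum_univ_six] at *
  linear_combination p ^ 2 * h1 + 2 * p * q * h2 + q ^ 2 * h3

/-- No point of the line has all its coordinates equal up to sign. -/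
theorem eq_zero_of_sq_eq (h : IsSegreLine α β) (p q g : K)
    (hg : ∀ i, (p * α i + q * β i) ^ 2 = g ^ 2) : p = 0 ∧ q = 0 := by
  refine h.indep p q ?_
  by_cases h0 : g = 0
  · intro i
    simpa [h0] using hg i
  -- Otherwise the point is $g$ times a sign vector $\varepsilon$ with sum zero, a node of the
  -- cubic, and $\sum\varepsilon_i\alpha_i^2=0$ because the line lies on the cubic.
  · refine absurd ?_ (h.sign (fun i => (p * α i + q * β i) / g) (fun i => ?_) ?_)
    · simp only [div_mul_eq_mul_div, ← Finset.sum_div, h.comb_mul_sq_left, zero_div]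
    · rw [div_pow, hg, div_self (pow_ne_zero 2 h0)]
    · rw [← Finset.sum_div, h.sum_comb, zero_div]

/-- No point of the line has coordinates `(g, -g, -g, *, *, *)`. -/
theorem eq_zero_of_add_eq_zero_aux (h3 : (3 : K) ≠ 0) (h : IsSegreLine α β) (p q : K)
    (h01 : (p * α 0 + q * β 0) + (p * α 1 + q * β 1) = 0)
    (h02 : (p * α 0 + q * β 0) + (p * α 2 + q * β 2) = 0) : p = 0 ∧ q = 0 := by
  have hs := h.sum_comb p q
  have hc := h.cube_comb p q
  have hl := h.comb_sq_mul_left p q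
  have ha := h.sum_left
  obtain ⟨γ, hγ⟩ : ∃ γ : Fin 6 → K, ∀ i, γ i = p * α i + q * β i := ⟨_, fun _ => rfl⟩
  suffices ∀ i, γ i ^ 2 = γ 0 ^ 2 from h.eq_zero_of_sq_eq p q (γ 0) fun i => by rw [← hγ, this]
  simp only [← hγ, Fin.sum_univ_six] at *
  -- Used when the squared coordinates equal $\gamma_0^2$ except for a common value at $i$ and $j$.
  -- Then $\sum\gamma_m^2\alpha_m=0$ and $\sum\alpha_m=0$ force this value to be $\gamma_0^2$ as
  -- well.
  have key : ∀ i j, i ≠ j → γ i ^ 2 = γ j ^ 2 →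
      (∀ m, γ m ^ 2 = γ i ^ 2 ∨ γ m ^ 2 = γ 0 ^ 2) →
      (γ i ^ 2 - γ 0 ^ 2) * (α i + α j) = 0 → ∀ m, γ m ^ 2 = γ 0 ^ 2 := by
    intro i j hij _ hm hp m
    have := (mul_eq_zero.1 hp).resolve_right (h.pair_left i j hij)
    rcases hm m with hm | hm
    · rw [hm]; linear_combination this
    · exact hm
  have h1 : γ 1 = -γ 0 := by linear_combination h01
  have h2 : γ 2 = -γ 0 := by linear_combination h02
  have h5 : γ 0 = γ 3 + γ 4 + γ 5 := by rw [h1, h2] at hs; linear_combination -hs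
  -- The sum of cubes becomes $-3(\gamma_3+\gamma_4)(\gamma_3+\gamma_5)(\gamma_4+\gamma_5)$, so the
  -- last three coordinates are $g,h,-h$ in some order, where $g=\gamma_0$.
  have hprod : (γ 3 + γ 4) * ((γ 3 + γ 5) * (γ 4 + γ 5)) = 0 := by
    have : 3 * ((γ 3 + γ 4) * ((γ 3 + γ 5) * (γ 4 + γ 5))) = 0 := by
      rw [h1, h2, h5] at hc
      linear_combination -hc
    exact (mul_eq_zero.1 this).resolve_left h3
  rw [h1, h2] at hl
  rcases mul_eq_zero.1 hprod with h34 | hprod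
  · have e5 : γ 5 = γ 0 := by linear_combination -h5 - h34
    have e4 : γ 4 = -γ 3 := by linear_combination h34
    rw [e5, e4] at hl
    refine key 3 4 (by decide) (by rw [e4]; ring) ?_ (by linear_combination hl - γ 0 ^ 2 * ha)
    intro m; fin_cases m <;> simp [h1, h2, e4, e5]
  · rcases mul_eq_zero.1 hprod with h35 | h45
    · have e4 : γ 4 = γ 0 := by linear_combination -h5 - h35
      have e5 : γ 5 = -γ 3 := by linear_combination h35
      rw [e5, e4] at hl
      refine key 3 5 (by decide) (by rw [e5]; ring) ?_ (by linear_combination hl - γ 0 ^ 2 * ha)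
      intro m; fin_cases m <;> simp [h1, h2, e4, e5]
    · have e3 : γ 3 = γ 0 := by linear_combination -h5 - h45
      have e5 : γ 5 = -γ 4 := by linear_combination h45
      rw [e5, e3] at hl
      refine key 4 5 (by decide) (by rw [e5]; ring) ?_ (by linear_combination hl - γ 0 ^ 2 * ha)
      intro m; fin_cases m <;> simp [h1, h2, e3, e5]

theorem eq_zero_of_add_eq_zero (h3 : (3 : K) ≠ 0) (h : IsSegreLine α β) (p q : K)
    {i j k : Fin 6} (hij : i ≠ j) (hik : i ≠ k) (hjk : j ≠ k)
    (h01 : (p * α i + q * β i) + (p * α j + q * β j) = 0)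
    (h02 : (p * α i + q * β i) + (p * α k + q * β k) = 0) : p = 0 ∧ q = 0 := by
  obtain ⟨σ, rfl, rfl, rfl⟩ := exists_perm_fin_six i j k hij hik hjk
  exact (h.perm σ).eq_zero_of_add_eq_zero_aux h3 p q h01 h02

/-- A nonzero point of the line has at most two vanishing coordinates, by `eq_zero_of_add_eq_zero`;
two such points cannot cover all six. -/
theorem eq_zero_of_mul_eq_zero (h3 : (3 : K) ≠ 0) (h : IsSegreLine α β) (p q r s : K)
    (hn : ∀ i, (p * α i + q * β i) * (r * α i + s * β i) = 0) :
    (p = 0 ∧ q = 0) ∨ (r = 0 ∧ s = 0) := by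
  classical
  have key : ∀ p q : K, 3 ≤ (Finset.univ.filter fun i => p * α i + q * β i = 0).card →
      p = 0 ∧ q = 0 := by
    intro p q hc
    obtain ⟨i, j, k, hi, hj, hk, hij, hik, hjk⟩ := Finset.two_lt_card_iff.1 hc
    simp only [Finset.mem_filter, Finset.mem_univ, true_and] at hi hj hk
    exact h.eq_zero_of_add_eq_zero h3 p q hij hik hjk (by rw [hi, hj, add_zero])
      (by rw [hi, hk, add_zero])
  by_contra hcon
  rw [not_or] at hcon
  have h1 := not_le.1 fun hc => hcon.1 (key p q hc)
  have h2 := not_le.1 fun hc => hcon.2 (key r s hc)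
  have hu : (Finset.univ : Finset (Fin 6)) ⊆ (Finset.univ.filter fun i => p * α i + q * β i = 0) ∪
      Finset.univ.filter fun i => r * α i + s * β i = 0 := by
    intro i _
    simpa using mul_eq_zero.1 (hn i)
  have := (Finset.card_le_card hu).trans (Finset.card_union_le _ _)
  rw [Finset.card_univ, Fintype.card_fin] at this
  omega

/-- If $\gamma_i\delta_i=n\ne0$, then $\sum\delta_i=0$ makes the fifth elementary symmetric function
of $\gamma$ vanish. On the cubic this function is $\prod_{j\ge1}(\gamma_0+\gamma_j)$, so some
$\gamma_0+\gamma_j$ is zero, and with it $\delta_0+\delta_j$. If $\gamma,\delta$ are independent,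
this holds on the whole line, against `pair_left`; if they are proportional, all $\gamma_i^2$
coincide, which `eq_zero_of_sq_eq` excludes. -/
theorem eq_zero_of_mul_eq (h3 : (3 : K) ≠ 0) (h : IsSegreLine α β) (p q r s n : K) (h0 : n ≠ 0)
    (hn : ∀ i, (p * α i + q * β i) * (r * α i + s * β i) = n) : False := by
  obtain ⟨γ, hγ⟩ : ∃ γ : Fin 6 → K, ∀ i, γ i = p * α i + q * β i := ⟨_, fun _ => rfl⟩
  obtain ⟨δ, hδ⟩ : ∃ δ : Fin 6 → K, ∀ i, δ i = r * α i + s * β i := ⟨_, fun _ => rfl⟩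
  have hs := h.sum_comb p q
  have hs' := h.sum_comb r s
  have hc := h.cube_comb p q
  have hn' : ∀ i, γ i * δ i = n := fun i => by rw [hγ, hδ, hn]
  simp only [← hγ, ← hδ] at hs hs' hc
  have hγ0 : ∀ i, γ i ≠ 0 := fun i hi => h0 (by rw [← hn' i, hi, zero_mul])
  have hpq : ¬ (p = 0 ∧ q = 0) := fun hpq => hγ0 0 (by rw [hγ, hpq.1, hpq.2]; ring)
  have hrs : ¬ (r = 0 ∧ s = 0) := fun hrs => h0 (by rw [← hn' 0, hδ, hrs.1, hrs.2]; ring)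
  have hprod : (γ 0 + γ 1) * (γ 0 + γ 2) * (γ 0 + γ 3) * (γ 0 + γ 4) * (γ 0 + γ 5) = 0 := by
    simp only [Fin.sum_univ_six] at hs hs' hc
    have hP : n * (γ 1 * γ 2 * γ 3 * γ 4 * γ 5 + γ 0 * γ 2 * γ 3 * γ 4 * γ 5 + γ 0 * γ 1 * γ 3 * γ 4 * γ 5 +
        γ 0 * γ 1 * γ 2 * γ 4 * γ 5 + γ 0 * γ 1 * γ 2 * γ 3 * γ 5 + γ 0 * γ 1 * γ 2 * γ 3 * γ 4) = 0 := by
      linear_combination γ 0 * γ 1 * γ 2 * γ 3 * γ 4 * γ 5 * hs' - γ 1 * γ 2 * γ 3 * γ 4 * γ 5 * hn' 0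
        - γ 0 * γ 2 * γ 3 * γ 4 * γ 5 * hn' 1 - γ 0 * γ 1 * γ 3 * γ 4 * γ 5 * hn' 2
        - γ 0 * γ 1 * γ 2 * γ 4 * γ 5 * hn' 3 - γ 0 * γ 1 * γ 2 * γ 3 * γ 5 * hn' 4
        - γ 0 * γ 1 * γ 2 * γ 3 * γ 4 * hn' 5
    have hP' := (mul_eq_zero.1 hP).resolve_left h0
    have h5 : γ 5 = -(γ 0 + γ 1 + γ 2 + γ 3 + γ 4) := by linear_combination hs
    refine (mul_eq_zero.1 (?_ : 3 * ((γ 0 + γ 1) * (γ 0 + γ 2) * (γ 0 + γ 3) * (γ 0 + γ 4) *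
      (γ 0 + γ 5)) = 0)).resolve_left h3
    rw [h5] at hc hP' ⊢
    linear_combination 3 * hP' + γ 0 ^ 2 * hc
  obtain ⟨j, hj, hγj⟩ : ∃ j, 0 ≠ j ∧ γ 0 + γ j = 0 := by
    simp only [mul_eq_zero] at hprod
    rcases hprod with (((h | h) | h) | h) | h
    exacts [⟨1, by decide, h⟩, ⟨2, by decide, h⟩, ⟨3, by decide, h⟩, ⟨4, by decide, h⟩,
      ⟨5, by decide, h⟩]
  have hδj : δ 0 + δ j = 0 := by
    refine (mul_eq_zero.1 (?_ : γ 0 * (δ 0 + δ j) = 0)).resolve_left (hγ0 0)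
    linear_combination hn' 0 - hn' j + δ j * hγj
  by_cases hdet : p * s - q * r = 0
  · refine hpq (h.eq_zero_of_sq_eq p q (γ 0) fun i => ?_)
    rw [← hγ]
    have h1 : ∀ i, p * n = r * γ i ^ 2 := fun i => by
      rw [← hn' i, hδ, hγ]; linear_combination (p * α i + q * β i) * β i * hdet
    have h2 : ∀ i, q * n = s * γ i ^ 2 := fun i => by
      rw [← hn' i, hδ, hγ]; linear_combination -(p * α i + q * β i) * α i * hdet
    by_cases hr : r = 0
    · exact mul_left_cancel₀ (fun hs => hrs ⟨hr, hs⟩) ((h2 i).symm.trans (h2 0))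
    · exact mul_left_cancel₀ hr ((h1 i).symm.trans (h1 0))
  · refine h.pair_left 0 j hj ((mul_eq_zero.1 (?_ : (p * s - q * r) * (α 0 + α j) = 0)).resolve_left
      hdet)
    rw [hγ, hγ] at hγj
    rw [hδ, hδ] at hδj
    linear_combination s * hγj - q * hδj

end IsSegreLine

/-! ### The plane spanned by the products of points of a Segre line. -/

section Plane

variable {R : Type*} [CommRing R]

/-- The combinations `X α² + Y αβ + Z β²`, normalised to have coordinate sum zero. -/
def squares (α β : Fin 6 → R) (X Y Z : R) : Fin 6 → R := fun i =>
  X * mixed α α i + Y * mixed α β i + Z * mixed β β i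

/-- The polar form of `3 * igusaValue`. -/
def igusaPolarization (u v w z : Fin 6 → R) : R :=
  (∑ i, u i * v i) * (∑ i, w i * z i) + (∑ i, u i * w i) * (∑ i, v i * z i)
    + (∑ i, u i * z i) * (∑ i, v i * w i) - 12 * ∑ i, u i * v i * w i * z i

theorem igusaPolarization_swap (u v w z : Fin 6 → R) :
    igusaPolarization u v w z = igusaPolarization u v z w := by
  simp only [igusaPolarization, Fin.sum_univ_six]; ring

theorem igusaPolarization_rotate (u v w z : Fin 6 → R) :
    igusaPolarization v w z u = igusaPolarization u v w z := by
  simp only [igusaPolarization, Fin.sum_univ_six]; ring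

theorem mixed_comb (α β : Fin 6 → R) (p q r s : R) :
    mixed (fun i => p * α i + q * β i) (fun i => r * α i + s * β i) =
      squares α β (p * r) (p * s + q * r) (q * s) := by
  ext i
  simp only [mixed, squares, Fin.sum_univ_six]
  ring

theorem sum_squares (α β : Fin 6 → R) (X Y Z : R) : ∑ i, squares α β X Y Z i = 0 := by
  simp only [squares, Finset.sum_add_distrib, ← Finset.mul_sum, sum_mixed, mul_zero, add_zero]

/-- A polarisation identity: a formula for the values of the quartic on a subspace determines its
second derivatives there. -/
theorem four_mul_igusaHessian (u v w : Fin 6 → R) :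
    4 * igusaHessian u v w = igusaValue (fun i => u i + v i + w i)
      + igusaValue (fun i => u i - v i - w i) - igusaValue (fun i => u i + v i - w i)
      - igusaValue (fun i => u i - v i + w i) - 2 * (igusaValue (fun i => v i + w i)
      - igusaValue (fun i => v i - w i)) := by
  have h2 (a b c : R) : ∑ i, (a * u i + b * v i + c * w i) ^ 2 = a ^ 2 * ∑ i, u i ^ 2
      + b ^ 2 * ∑ i, v i ^ 2 + c ^ 2 * ∑ i, w i ^ 2 + 2 * a * b * (∑ i, u i * v i)
      + 2 * a * c * (∑ i, u i * w i) + 2 * b * c * (∑ i, v i * w i) := by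
    simp only [Fin.sum_univ_six]; ring
  have h4 : ∑ i, u i ^ 2 * v i * w i * 48 = ∑ i, (u i + v i + w i) ^ 4
      + ∑ i, (u i - v i - w i) ^ 4 - ∑ i, (u i + v i - w i) ^ 4 - ∑ i, (u i - v i + w i) ^ 4
      - 2 * (∑ i, (v i + w i) ^ 4 - ∑ i, (v i - w i) ^ 4) := by
    simp only [← Finset.sum_add_distrib, ← Finset.sum_sub_distrib, Finset.mul_sum]
    exact Finset.sum_congr rfl fun i _ => by ring
  have e1 := h2 1 1 1
  have e2 := h2 1 (-1) (-1)
  have e3 := h2 1 1 (-1)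
  have e4 := h2 1 (-1) 1
  have e5 := h2 0 1 1
  have e6 := h2 0 1 (-1)
  simp only [one_mul, neg_mul, ← sub_eq_add_neg, zero_mul, zero_add] at e1 e2 e3 e4 e5 e6
  simp only [igusaHessian, igusaValue, e1, e2, e3, e4, e5, e6]
  rw [← Finset.sum_mul] at h4
  linear_combination -4 * h4

/-- The polar form along the conic parametrised by $t\mapsto u+2tv+t^2w$, sorted by powers of $t$.
If it vanishes for all $t$, each coefficient gives a relation between polarisations. -/
theorem three_mul_igusaPolar_comb (u v w z : Fin 6 → R) (t : R) :
    3 * igusaPolar (fun i => u i + 2 * t * v i + t ^ 2 * w i) z =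
      4 * (igusaPolarization u u u z + t * (6 * igusaPolarization u u v z)
        + t ^ 2 * (3 * igusaPolarization u u w z + 12 * igusaPolarization u v v z)
        + t ^ 3 * (12 * igusaPolarization u v w z + 8 * igusaPolarization v v v z)
        + t ^ 4 * (3 * igusaPolarization u w w z + 12 * igusaPolarization v v w z)
        + t ^ 5 * (6 * igusaPolarization v w w z) + t ^ 6 * igusaPolarization w w w z) := by
  have h1 : ∑ i, (u i + 2 * t * v i + t ^ 2 * w i) * z i = (∑ i, u i * z i)
      + 2 * t * (∑ i, v i * z i) + t ^ 2 * (∑ i, w i * z i) := by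
    simp only [Fin.sum_univ_six]; ring
  have h2 : ∑ i, (u i + 2 * t * v i + t ^ 2 * w i) ^ 2 = (∑ i, u i * u i)
      + 4 * t * (∑ i, u i * v i) + t ^ 2 * (4 * (∑ i, v i * v i) + 2 * ∑ i, u i * w i)
      + 4 * t ^ 3 * (∑ i, v i * w i) + t ^ 4 * (∑ i, w i * w i) := by
    simp only [Fin.sum_univ_six]; ring
  have h3 : ∑ i, (u i + 2 * t * v i + t ^ 2 * w i) ^ 3 * z i = (∑ i, u i * u i * u i * z i)
      + t * (6 * ∑ i, u i * u i * v i * z i) + t ^ 2 * (3 * (∑ i, u i * u i * w i * z i)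
      + 12 * ∑ i, u i * v i * v i * z i) + t ^ 3 * (12 * (∑ i, u i * v i * w i * z i)
      + 8 * ∑ i, v i * v i * v i * z i) + t ^ 4 * (3 * (∑ i, u i * w i * w i * z i)
      + 12 * ∑ i, v i * v i * w i * z i) + t ^ 5 * (6 * ∑ i, v i * w i * w i * z i)
      + t ^ 6 * ∑ i, w i * w i * w i * z i := by
    simp only [Finset.mul_sum, ← Finset.sum_add_distrib]
    exact Finset.sum_congr rfl fun i _ => by ring
  simp only [igusaPolar, igusaPolarization, h1, h2, h3]
  ring

theorem three_mul_igusaValue_comb (u v w : Fin 6 → R) (X Y Z : R) :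
    3 * igusaValue (fun i => X * u i + Y * v i + Z * w i) =
      X ^ 4 * igusaPolarization u u u u + 4 * X ^ 3 * Y * igusaPolarization u u u v
      + 4 * X ^ 3 * Z * igusaPolarization u u u w + 6 * X ^ 2 * Y ^ 2 * igusaPolarization u u v v
      + 12 * X ^ 2 * Y * Z * igusaPolarization u u v w
      + 6 * X ^ 2 * Z ^ 2 * igusaPolarization u u w w
      + 4 * X * Y ^ 3 * igusaPolarization u v v v
      + 12 * X * Y ^ 2 * Z * igusaPolarization u v v w
      + 12 * X * Y * Z ^ 2 * igusaPolarization u v w w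
      + 4 * X * Z ^ 3 * igusaPolarization u w w w + Y ^ 4 * igusaPolarization v v v v
      + 4 * Y ^ 3 * Z * igusaPolarization v v v w + 6 * Y ^ 2 * Z ^ 2 * igusaPolarization v v w w
      + 4 * Y * Z ^ 3 * igusaPolarization v w w w + Z ^ 4 * igusaPolarization w w w w := by
  have h2 : ∑ i, (X * u i + Y * v i + Z * w i) ^ 2 = X ^ 2 * (∑ i, u i * u i)
      + Y ^ 2 * (∑ i, v i * v i) + Z ^ 2 * (∑ i, w i * w i) + 2 * X * Y * (∑ i, u i * v i)
      + 2 * X * Z * (∑ i, u i * w i) + 2 * Y * Z * (∑ i, v i * w i) := by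
    simp only [Fin.sum_univ_six]; ring
  have h4 : ∑ i, (X * u i + Y * v i + Z * w i) ^ 4 =
      X ^ 4 * (∑ i, u i * u i * u i * u i) + 4 * X ^ 3 * Y * (∑ i, u i * u i * u i * v i)
      + 4 * X ^ 3 * Z * (∑ i, u i * u i * u i * w i)
      + 6 * X ^ 2 * Y ^ 2 * (∑ i, u i * u i * v i * v i)
      + 12 * X ^ 2 * Y * Z * (∑ i, u i * u i * v i * w i)
      + 6 * X ^ 2 * Z ^ 2 * (∑ i, u i * u i * w i * w i)
      + 4 * X * Y ^ 3 * (∑ i, u i * v i * v i * v i)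
      + 12 * X * Y ^ 2 * Z * (∑ i, u i * v i * v i * w i)
      + 12 * X * Y * Z ^ 2 * (∑ i, u i * v i * w i * w i)
      + 4 * X * Z ^ 3 * (∑ i, u i * w i * w i * w i) + Y ^ 4 * (∑ i, v i * v i * v i * v i)
      + 4 * Y ^ 3 * Z * (∑ i, v i * v i * v i * w i)
      + 6 * Y ^ 2 * Z ^ 2 * (∑ i, v i * v i * w i * w i)
      + 4 * Y * Z ^ 3 * (∑ i, v i * w i * w i * w i)
      + Z ^ 4 * (∑ i, w i * w i * w i * w i) := by
    simp only [Finset.mul_sum, ← Finset.sum_add_distrib]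
    exact Finset.sum_congr rfl fun i _ => by ring
  simp only [igusaValue, igusaPolarization, h2, h4]
  ring

end Plane

theorem coeff_eq_zero_of_forall_eval {K : Type*} [Field K] [Infinite K] (c : Fin 7 → K)
    (h : ∀ t, c 0 + t * c 1 + t ^ 2 * c 2 + t ^ 3 * c 3 + t ^ 4 * c 4 + t ^ 5 * c 5
      + t ^ 6 * c 6 = 0) : c = 0 := by
  have hp : (∑ i : Fin 7, Polynomial.C (c i) * Polynomial.X ^ (i : ℕ)) = 0 := by
    refine Polynomial.funext fun t => ?_
    rw [Polynomial.eval_zero, ← h t]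
    rw [Fin.sum_univ_seven]
    norm_num
    ring
  ext i
  have := congrArg (fun p => Polynomial.coeff p (i : ℕ)) hp
  simpa [Polynomial.finsetSum_coeff, Polynomial.coeff_C_mul, Polynomial.coeff_X_pow,
    Fin.val_inj] using this

/-- A binary quadratic form splits into linear factors, so every combination of
$\alpha^2,\alpha\beta,\beta^2$ is a product of two vectors of the span of $\alpha$ and $\beta$. -/
theorem exists_factorization {K : Type*} [Field K] [IsAlgClosed K] (h2 : (2 : K) ≠ 0)
    (X Y Z : K) : ∃ p q r s : K, X = p * r ∧ Y = p * s + q * r ∧ Z = q * s := by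
  by_cases hX : X = 0
  · exact ⟨0, 1, Y, Z, by simp [hX], by ring, by ring⟩
  · obtain ⟨d, hd⟩ := IsAlgClosed.exists_pow_nat_eq (Y ^ 2 - 4 * X * Z) (n := 2) (by norm_num)
    refine ⟨X, (Y + d) / 2, 1, (Y - d) / (2 * X), by ring, by field_simp; ring, ?_⟩
    field_simp
    linear_combination hd

namespace IsSegreLine

variable {K : Type*} [Field K] {α β : Fin 6 → K}

/-- After factorisation, a relation says that the coordinatewise product of two vectors in the span
is constant. `eq_zero_of_mul_eq` excludes a nonzero constant, and `eq_zero_of_mul_eq_zero` makes one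
factor zero otherwise. -/
theorem eq_zero_of_squares_eq_zero [IsAlgClosed K] (h2 : (2 : K) ≠ 0) (h3 : (3 : K) ≠ 0)
    (h : IsSegreLine α β) {X Y Z : K} (hXYZ : squares α β X Y Z = 0) :
    X = 0 ∧ Y = 0 ∧ Z = 0 := by
  obtain ⟨p, q, r, s, rfl, rfl, rfl⟩ := exists_factorization h2 X Y Z
  rw [← mixed_comb] at hXYZ
  have h6 : (6 : K) ≠ 0 := by
    rw [show (6 : K) = 2 * 3 by norm_num]; exact mul_ne_zero h2 h3
  have hn : ∀ i, (p * α i + q * β i) * (r * α i + s * β i) =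
      (∑ j, (p * α j + q * β j) * (r * α j + s * β j)) / 6 := by
    intro i
    have := congrFun hXYZ i
    simp only [mixed, Pi.zero_apply] at this
    rw [eq_div_iff h6]
    linear_combination this
  have h0 : (∑ j, (p * α j + q * β j) * (r * α j + s * β j)) / 6 = 0 := by
    by_contra h0
    exact h.eq_zero_of_mul_eq h3 p q r s _ h0 hn
  rcases h.eq_zero_of_mul_eq_zero h3 p q r s (fun i => (hn i).trans h0) with ⟨rfl, rfl⟩ | ⟨rfl, rfl⟩
    <;> simp

theorem sum_left_mul_squares (h : IsSegreLine α β) (X Y Z : K) :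
    ∑ i, α i * squares α β X Y Z i = 0 := by
  have h1 := h.sum_left
  have h2 := h.cube_left
  have h3 := h.sq_left
  have h4 := h.sq_right
  have : ∑ i, α i * squares α β X Y Z i = 6 * X * (∑ i, α i ^ 3) + 6 * Y * (∑ i, α i ^ 2 * β i)
      + 6 * Z * (∑ i, α i * β i ^ 2) - (X * (∑ i, α i * α i) + Y * (∑ i, α i * β i)
      + Z * ∑ i, β i * β i) * ∑ i, α i := by
    simp only [squares, mixed, Fin.sum_univ_six]
    ring
  rw [this, h1, h2, h3, h4]
  ring

theorem sum_right_mul_squares (h : IsSegreLine α β) (X Y Z : K) :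
    ∑ i, β i * squares α β X Y Z i = 0 := by
  have h1 := h.sum_right
  have h2 := h.cube_right
  have h3 := h.sq_left
  have h4 := h.sq_right
  have : ∑ i, β i * squares α β X Y Z i = 6 * X * (∑ i, α i ^ 2 * β i)
      + 6 * Y * (∑ i, α i * β i ^ 2)
      + 6 * Z * (∑ i, β i ^ 3) - (X * (∑ i, α i * α i) + Y * (∑ i, α i * β i)
      + Z * ∑ i, β i * β i) * ∑ i, β i := by
    simp only [squares, mixed, Fin.sum_univ_six]
    ring
  rw [this, h1, h2, h3, h4]
  ring

/-- The coordinate sum and the products with `α` and `β`, as a linear map. -/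
def pairing (α β : Fin 6 → K) : (Fin 6 → K) →ₗ[K] (Fin 3 → K) :=
  (Matrix.of ![fun _ => 1, α, β] : Matrix (Fin 3) (Fin 6) K).mulVecLin

theorem pairing_apply (v : Fin 6 → K) :
    pairing α β v = ![∑ i, v i, ∑ i, α i * v i, ∑ i, β i * v i] := by
  ext i
  fin_cases i <;> simp [pairing, Matrix.mulVec, dotProduct]

theorem range_pairing (h2 : (2 : K) ≠ 0) (h3 : (3 : K) ≠ 0) (h : IsSegreLine α β) :
    LinearMap.range (pairing α β) = ⊤ := by
  have hli : LinearIndependent K ![fun _ => (1 : K), α, β] := by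
    rw [Fintype.linearIndependent_iff]
    intro g hg
    simp only [Fin.sum_univ_three, Matrix.cons_val_zero, Matrix.cons_val_one,
      Matrix.cons_val] at hg
    have hg' : ∀ i, g 0 + (g 1 * α i + g 2 * β i) = 0 := fun i => by
      have := congrFun hg i
      simp only [Pi.add_apply, Pi.smul_apply, smul_eq_mul, mul_one, Pi.zero_apply] at this
      rw [← this]; ring
    -- Summation over the six coordinates leaves $6g_0=0$.
    have hs : ∑ i, (g 0 + (g 1 * α i + g 2 * β i)) = 0 := Finset.sum_eq_zero fun i _ => hg' i
    rw [Finset.sum_add_distrib, h.sum_comb] at hs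
    have h0 : g 0 = 0 := by
      simp only [Finset.sum_const, Finset.card_univ, Fintype.card_fin, nsmul_eq_mul] at hs
      have : (2 : K) * (3 * g 0) = 0 := by rw [← hs]; push_cast; ring
      exact (mul_eq_zero.1 ((mul_eq_zero.1 this).resolve_left h2)).resolve_left h3
    have h12 := h.indep (g 1) (g 2) fun i => by simpa [h0] using hg' i
    intro i
    fin_cases i
    exacts [h0, h12.1, h12.2]
  refine Submodule.eq_top_of_finrank_eq ?_
  have := LinearIndependent.rank_matrix (M := Matrix.of ![fun _ => (1 : K), α, β]) hli
  rw [Matrix.rank] at this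
  rw [pairing, this]
  simp

theorem exists_sum_mul_eq (h2 : (2 : K) ≠ 0) (h3 : (3 : K) ≠ 0) (h : IsSegreLine α β) (a b : K) :
    ∃ v : Fin 6 → K, ∑ i, v i = 0 ∧ ∑ i, α i * v i = a ∧ ∑ i, β i * v i = b := by
  obtain ⟨v, hv⟩ := LinearMap.range_eq_top.1 (h.range_pairing h2 h3) ![0, a, b]
  rw [pairing_apply] at hv
  exact ⟨v, by simpa using congrFun hv 0, by simpa using congrFun hv 1,
    by simpa using congrFun hv 2⟩

/-- A dimension count: the squares span a 3-dimensional subspace of the kernel of `pairing α β`,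
which has dimension $6-3$. -/
theorem exists_eq_squares [IsAlgClosed K] (h2 : (2 : K) ≠ 0) (h3 : (3 : K) ≠ 0)
    (h : IsSegreLine α β) (v : Fin 6 → K) (hv : ∑ i, v i = 0) (hα : ∑ i, α i * v i = 0)
    (hβ : ∑ i, β i * v i = 0) : ∃ X Y Z, v = squares α β X Y Z := by
  let S : (Fin 3 → K) →ₗ[K] (Fin 6 → K) :=
    { toFun := fun c => squares α β (c 0) (c 1) (c 2)
      map_add' := fun c d => by ext i; simp only [squares, Pi.add_apply]; ring
      map_smul' := fun c d => by
        ext i; simp only [squares, Pi.smul_apply, smul_eq_mul, RingHom.id_apply]; ring }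
  have hS : Function.Injective S := by
    rw [injective_iff_map_eq_zero]
    intro c hc
    obtain ⟨h0, h1, h2⟩ := h.eq_zero_of_squares_eq_zero h2 h3 hc
    ext i
    fin_cases i
    exacts [h0, h1, h2]
  have hle : LinearMap.range S ≤ LinearMap.ker (pairing α β) := by
    rintro _ ⟨c, rfl⟩
    rw [LinearMap.mem_ker, pairing_apply]
    ext i
    fin_cases i
    exacts [sum_squares _ _ _ _ _, h.sum_left_mul_squares _ _ _, h.sum_right_mul_squares _ _ _]
  have hfr := (pairing α β).finrank_range_add_finrank_ker
  rw [h.range_pairing h2 h3] at hfr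
  have heq : LinearMap.range S = LinearMap.ker (pairing α β) := by
    refine Submodule.eq_of_le_of_finrank_eq hle ?_
    rw [LinearMap.finrank_range_of_inj hS]
    simp at hfr ⊢
    omega
  have hmem : v ∈ LinearMap.ker (pairing α β) := by
    rw [LinearMap.mem_ker, pairing_apply, hv, hα, hβ]
    ext i
    fin_cases i <;> rfl
  rw [← heq] at hmem
  obtain ⟨c, rfl⟩ := hmem
  exact ⟨_, _, _, rfl⟩

/-- The gradient at the square of a point of the line is proportional to that point, modulo constant
vectors, and the line annihilates the plane. -/
theorem igusaPolar_mixed_self_squares (h3 : (3 : K) ≠ 0) (h : IsSegreLine α β) (p q X Y Z : K) :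
    igusaPolar (squares α β (p * p) (p * q + q * p) (q * q)) (squares α β X Y Z) = 0 := by
  rw [← mixed_comb]
  refine (mul_eq_zero.1 (?_ : 3 * _ = (0 : K))).resolve_left h3
  rw [three_mul_igusaPolar_mixed_self _ _ (h.sum_comb p q) (h.cube_comb p q) (sum_squares _ _ _ _ _)]
  simp only [add_mul, mul_assoc, Finset.sum_add_distrib, ← Finset.mul_sum, h.sum_left_mul_squares,
    h.sum_right_mul_squares, mul_zero, add_zero]

/-- A plane quartic singular along a nonsingular conic is a multiple of the square of its equation.
Here this is done by coefficients: vanishing of the polar form along the parametrised conic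
determines all polarisations in terms of one. -/
theorem igusaValue_squares [Infinite K] (h2 : (2 : K) ≠ 0) (h3 : (3 : K) ≠ 0)
    (h : IsSegreLine α β) :
    ∃ κ, ∀ X Y Z, igusaValue (squares α β X Y Z) = κ * (Y ^ 2 - 4 * X * Z) ^ 2 := by
  have h6 : (6 : K) ≠ 0 := by
    rw [show (6 : K) = 2 * 3 by norm_num]; exact mul_ne_zero h2 h3
  have h4 : (4 : K) ≠ 0 := by
    rw [show (4 : K) = 2 * 2 by norm_num]; exact mul_ne_zero h2 h2
  have h8 : (8 : K) ≠ 0 := by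
    rw [show (8 : K) = 2 * 4 by norm_num]; exact mul_ne_zero h2 h4
  set u := mixed α α
  set v := mixed α β
  set w := mixed β β
  have key : ∀ X Y Z, ∀ z, z = squares α β X Y Z → (igusaPolarization u u u z = 0 ∧
      igusaPolarization u u v z = 0 ∧
      3 * igusaPolarization u u w z + 12 * igusaPolarization u v v z = 0 ∧
      12 * igusaPolarization u v w z + 8 * igusaPolarization v v v z = 0 ∧
      3 * igusaPolarization u w w z + 12 * igusaPolarization v v w z = 0 ∧
      igusaPolarization v w w z = 0 ∧ igusaPolarization w w w z = 0) := by
    intro X Y Z z hz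
    have := coeff_eq_zero_of_forall_eval ![igusaPolarization u u u z,
      6 * igusaPolarization u u v z,
      3 * igusaPolarization u u w z + 12 * igusaPolarization u v v z,
      12 * igusaPolarization u v w z + 8 * igusaPolarization v v v z,
      3 * igusaPolarization u w w z + 12 * igusaPolarization v v w z,
      6 * igusaPolarization v w w z, igusaPolarization w w w z] fun t => by
        refine (mul_eq_zero.1 (?_ : (4 : K) * _ = 0)).resolve_left h4
        refine (three_mul_igusaPolar_comb u v w z t).symm.trans ?_
        have := h.igusaPolar_mixed_self_squares h3 1 t X Y Z
        rw [show squares α β (1 * 1) (1 * t + t * 1) (t * t) =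
          fun i => u i + 2 * t * v i + t ^ 2 * w i by ext i; simp only [squares, u, v, w]; ring,
          ← hz] at this
        rw [this, mul_zero]
    refine ⟨congrFun this 0, (mul_eq_zero.1 (congrFun this 1)).resolve_left h6, congrFun this 2,
      congrFun this 3, congrFun this 4, (mul_eq_zero.1 (congrFun this 5)).resolve_left h6,
      congrFun this 6⟩
  obtain ⟨u1, u2, u3, u4, u5, u6, u7⟩ := key 1 0 0 u (by ext i; simp [squares, u])
  obtain ⟨v1, v2, v3, v4, v5, v6, v7⟩ := key 0 1 0 v (by ext i; simp [squares, v])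
  obtain ⟨w1, w2, w3, w4, w5, w6, w7⟩ := key 0 0 1 w (by ext i; simp [squares, w])
  -- With $P$ the polarisation, the surviving relations are $P(u,v,v,w)=-P(u,u,w,w)/4$ and
  -- $P(v,v,v,v)=\tfrac38P(u,u,w,w)$, which complete the square.
  refine ⟨igusaPolarization u u w w / 8, fun X Y Z => ?_⟩
  have swap := fun a b c d : Fin 6 → K => igusaPolarization_swap a b c d
  have rot := fun a b c d : Fin 6 → K => igusaPolarization_rotate a b c d
  have huvvv : igusaPolarization u v v v = 0 := by
    rw [swap u u w v, w2, mul_zero, zero_add] at v3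
    exact (mul_eq_zero.1 v3).resolve_left (by
      rw [show (12 : K) = 2 * 6 by norm_num]; exact mul_ne_zero h2 h6)
  have huvww : igusaPolarization u v w w = 0 := by rw [← rot, u6]
  have huwww : igusaPolarization u w w w = 0 := by rw [← rot, u7]
  have hvvvw : igusaPolarization v v v w = 0 := by
    rw [huvww, mul_zero, zero_add] at w4
    exact (mul_eq_zero.1 w4).resolve_left h8
  have hvvww : igusaPolarization v v w w = 0 := by
    rw [huwww, mul_zero, zero_add] at w5
    exact (mul_eq_zero.1 w5).resolve_left (by
      rw [show (12 : K) = 2 * 6 by norm_num]; exact mul_ne_zero h2 h6)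
  rw [swap u v w v] at v4
  refine mul_left_cancel₀ h3 ((three_mul_igusaValue_comb u v w X Y Z).trans ?_)
  rw [u1, v1, w1, v2, w2, huvvv, huvww, huwww, hvvvw, hvvww, w6, w7]
  field_simp
  linear_combination (Y ^ 4) * v4 + (8 * X * Y ^ 2 * Z - Y ^ 4) * w3

end IsSegreLine

/-! ### First order deformations -/

section Deformations

section CommRing

variable {R : Type*} [CommRing R]

/-- The derivative of `gauss` at `x` in the direction `y`. -/
def gaussDeriv (x y : Fin 6 → R) : Fin 6 → R := fun i =>
  36 * x i ^ 2 * y i - 3 * (∑ j, x j ^ 2) * y i - 6 * (∑ j, x j * y j) * x i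
    - 6 * ∑ j, x j ^ 2 * y j

theorem sum_gaussDeriv (x y : Fin 6 → R) (hx : ∑ i, x i = 0) (hy : ∑ i, y i = 0) :
    ∑ i, gaussDeriv x y i = 0 := by
  have : ∑ i, gaussDeriv x y i = -3 * (∑ j, x j ^ 2) * (∑ i, y i)
      - 6 * (∑ j, x j * y j) * ∑ i, x i := by
    simp only [gaussDeriv, Fin.sum_univ_six]; ring
  rw [this, hx, hy]; ring

theorem three_mul_igusaHessian (x y v : Fin 6 → R) (hv : ∑ i, v i = 0) :
    3 * igusaHessian x y v = -4 * ∑ i, gaussDeriv x y i * v i := by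
  have : ∑ i, gaussDeriv x y i * v i = 36 * (∑ i, x i ^ 2 * y i * v i)
      - 3 * (∑ j, x j ^ 2) * (∑ i, y i * v i) - 6 * (∑ j, x j * y j) * (∑ i, x i * v i)
      - 6 * (∑ j, x j ^ 2 * y j) * ∑ i, v i := by
    simp only [gaussDeriv, Fin.sum_univ_six]; ring
  rw [this, hv, igusaHessian]; ring

theorem igusaPolar_add_mul (x y v : Fin 6 → R) (ε : R) :
    igusaPolar (fun i => x i + ε * y i) v = igusaPolar x v + ε * igusaHessian x y v
      + ε ^ 2 * igusaHessian y x v + ε ^ 3 * igusaPolar y v := by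
  have h1 : ∑ i, (x i + ε * y i) ^ 2 = (∑ i, x i ^ 2) + 2 * ε * (∑ i, x i * y i)
      + ε ^ 2 * ∑ i, y i ^ 2 := by
    simp only [Fin.sum_univ_six]; ring
  have h2 : ∑ i, (x i + ε * y i) * v i = (∑ i, x i * v i) + ε * ∑ i, y i * v i := by
    simp only [Fin.sum_univ_six]; ring
  have h3 : ∑ i, (x i + ε * y i) ^ 3 * v i = (∑ i, x i ^ 3 * v i)
      + 3 * ε * (∑ i, x i ^ 2 * y i * v i) + 3 * ε ^ 2 * (∑ i, y i ^ 2 * x i * v i)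
      + ε ^ 3 * ∑ i, y i ^ 3 * v i := by
    simp only [Fin.sum_univ_six]; ring
  have h4 : ∑ i, y i * x i = ∑ i, x i * y i := Finset.sum_congr rfl fun i _ => mul_comm _ _
  rw [igusaPolar, h1, h2, h3, igusaPolar, igusaPolar, igusaHessian, igusaHessian, h4]
  ring

theorem igusaValue_add_mul (x y : Fin 6 → R) (ε : R) :
    ∃ r, igusaValue (fun i => x i + ε * y i) =
      igusaValue x + ε * igusaPolar x y + ε ^ 2 * r := by
  refine ⟨4 * (∑ i, x i * y i) ^ 2 + 2 * (∑ i, x i ^ 2) * (∑ i, y i ^ 2)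
    - 24 * (∑ i, x i ^ 2 * y i ^ 2) + ε * igusaPolar y x + ε ^ 2 * igusaValue y, ?_⟩
  have h1 : ∑ i, (x i + ε * y i) ^ 2 = (∑ i, x i ^ 2) + 2 * ε * (∑ i, x i * y i)
      + ε ^ 2 * ∑ i, y i ^ 2 := by
    simp only [Fin.sum_univ_six]; ring
  have h2 : ∑ i, (x i + ε * y i) ^ 4 = (∑ i, x i ^ 4)
      + 4 * ε * (∑ i, x i ^ 3 * y i) + 6 * ε ^ 2 * (∑ i, x i ^ 2 * y i ^ 2)
      + 4 * ε ^ 3 * (∑ i, y i ^ 3 * x i) + ε ^ 4 * ∑ i, y i ^ 4 := by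
    simp only [Fin.sum_univ_six]; ring
  have h4 : ∑ i, y i * x i = ∑ i, x i * y i := Finset.sum_congr rfl fun i _ => mul_comm _ _
  rw [igusaValue, h1, h2, igusaValue, igusaValue, igusaPolar, igusaPolar, h4]
  ring

theorem gauss_add_mul (x y : Fin 6 → R) (ε : R) (i : Fin 6) :
    gauss (fun i => x i + ε * y i) i = gauss x i + ε * gaussDeriv x y i
      + ε ^ 2 * gaussDeriv y x i + ε ^ 3 * gauss y i := by
  simp only [gauss, gaussDeriv, Fin.sum_univ_six]
  ring

theorem map_igusaPolar {S : Type*} [CommRing S] (f : R →+* S) (x v : Fin 6 → R) :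
    igusaPolar (fun i => f (x i)) (fun i => f (v i)) = f (igusaPolar x v) := by
  simp [igusaPolar, map_sum, map_ofNat]

theorem map_igusaHessian {S : Type*} [CommRing S] (f : R →+* S) (x v w : Fin 6 → R) :
    igusaHessian (fun i => f (x i)) (fun i => f (v i)) (fun i => f (w i)) =
      f (igusaHessian x v w) := by
  simp [igusaHessian, map_sum, map_ofNat]

theorem map_igusaValue {S : Type*} [CommRing S] (f : R →+* S) (x : Fin 6 → R) :
    igusaValue (fun i => f (x i)) = f (igusaValue x) := by
  simp [igusaValue, map_sum, map_ofNat]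

theorem map_mixed {S : Type*} [CommRing S] (f : R →+* S) (x y : Fin 6 → R) :
    mixed (fun i => f (x i)) (fun i => f (y i)) = fun i => f (mixed x y i) := by
  ext i
  simp [mixed, map_sum, map_ofNat]

theorem map_gauss {S : Type*} [CommRing S] (f : R →+* S) (x : Fin 6 → R) (i : Fin 6) :
    gauss (fun i => f (x i)) i = f (gauss x i) := by
  simp [gauss, map_sum, map_ofNat]

theorem map_gaussDeriv {S : Type*} [CommRing S] (f : R →+* S) (x y : Fin 6 → R) (i : Fin 6) :
    gaussDeriv (fun i => f (x i)) (fun i => f (y i)) i = f (gaussDeriv x y i) := by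
  simp [gaussDeriv, map_sum, map_ofNat]

theorem mixed_add_mul (γ η : Fin 6 → R) (ε : R) (hε : ε ^ 2 = 0) :
    mixed (fun i => γ i + ε * η i) (fun i => γ i + ε * η i) =
      fun i => mixed γ γ i + ε * (2 * mixed γ η i) := by
  ext i
  simp only [mixed, Fin.sum_univ_six]
  linear_combination (6 * η i ^ 2 - (η 0 ^ 2 + η 1 ^ 2 + η 2 ^ 2 + η 3 ^ 2 + η 4 ^ 2
    + η 5 ^ 2)) * hε

theorem igusaHessian_smul_left (x v w : Fin 6 → R) (c : R) :
    igusaHessian x (fun i => c * v i) w = c * igusaHessian x v w := by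
  simp only [igusaHessian, Fin.sum_univ_six]; ring

theorem igusaHessian_smul_base (x v w : Fin 6 → R) (c : R) :
    igusaHessian (fun i => c * x i) v w = c ^ 2 * igusaHessian x v w := by
  simp only [igusaHessian, Fin.sum_univ_six]; ring

end CommRing

variable {K : Type*} [Field K]

theorem eq_zero_of_inl_add_eps_mul_eq_zero {a b : K}
    (h : TrivSqZeroExt.inlHom K K a + DualNumber.eps * TrivSqZeroExt.inlHom K K b = 0) :
    a = 0 ∧ b = 0 := by
  constructor
  · simpa using congrArg TrivSqZeroExt.fst h
  · simpa using congrArg TrivSqZeroExt.snd h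

theorem exists_algebraMap_add_eps_mul (z : DualNumber K) :
    ∃ a b : K, z = TrivSqZeroExt.inlHom K K a + DualNumber.eps * TrivSqZeroExt.inlHom K K b :=
  ⟨z.fst, z.snd, by ext <;> simp⟩

theorem eps_sq : (DualNumber.eps : DualNumber K) ^ 2 = 0 := by
  rw [pow_two, DualNumber.eps_mul_eps]

/-- This is the $\varepsilon$-coefficient of `gauss_sq` at the dual-number point $x+\varepsilon y$,
which lies on the quartic because $P(x,y)=0$. The $D$ here is the reduction modulo $\varepsilon$ of
the one there, so the formula for its square persists. -/
theorem two_mul_gauss_mul_gaussDeriv (x y : Fin 6 → K) (hx : ∑ i, x i = 0) (hy : ∑ i, y i = 0)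
    (hv : igusaValue x = 0) (hP : igusaPolar x y = 0) :
    ∃ D D' E : K, (∀ i, 2 * gauss x i * gaussDeriv x y i = D * y i + D' * x i + E) ∧
      D ^ 2 = -20736 *
        ((x 0 + x 1 + x 2) * (x 0 + x 1 + x 3) * (x 0 + x 1 + x 4) * (x 0 + x 1 + x 5) *
          (x 0 + x 2 + x 3) * (x 0 + x 2 + x 4) * (x 0 + x 2 + x 5) * (x 0 + x 3 + x 4) *
          (x 0 + x 3 + x 5) * (x 0 + x 4 + x 5)) := by
  let f := TrivSqZeroExt.inlHom K K
  let ε : DualNumber K := DualNumber.eps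
  have hε : ε ^ 2 = 0 := eps_sq
  have hs : ∑ i, (f (x i) + ε * f (y i)) = 0 := by
    rw [Finset.sum_add_distrib, ← Finset.mul_sum, ← map_sum, ← map_sum, hx, hy]; simp
  obtain ⟨D, E, r, h1, h2⟩ := gauss_sq _ hs
  obtain ⟨r', hr'⟩ := igusaValue_add_mul (fun i => f (x i)) (fun i => f (y i)) ε
  rw [map_igusaValue, map_igusaPolar, hv, hP, hε, map_zero, mul_zero, zero_mul, add_zero,
    add_zero] at hr'
  rw [hr', zero_mul, zero_sub] at h2
  obtain ⟨D₀, D₁, rfl⟩ := exists_algebraMap_add_eps_mul D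
  obtain ⟨E₀, E₁, rfl⟩ := exists_algebraMap_add_eps_mul E
  refine ⟨D₀, D₁, E₁, fun i => ?_, ?_⟩
  · have h := h1 i
    have h0 : f (gauss x i ^ 2 - D₀ * x i - E₀) + ε * f (2 * gauss x i * gaussDeriv x y i
      - (D₀ * y i + D₁ * x i + E₁)) = 0 := by
      rw [hr', gauss_add_mul, map_gauss, map_gauss, map_gaussDeriv, map_gaussDeriv] at h
      simp only [map_sub, map_add, map_mul, map_pow, map_ofNat]
      change (f (gauss x i) + ε * f (gaussDeriv x y i) + ε ^ 2 * f (gaussDeriv y x i)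
        + ε ^ 3 * f (gauss y i)) ^ 2 = (f D₀ + ε * f D₁) * (f (x i) + ε * f (y i))
        + (f E₀ + ε * f E₁) - 9 * 0 * (f (x i) + ε * f (y i)) ^ 2 at h
      rw [pow_succ ε 2, hε] at h
      linear_combination h + (f D₁ * f (y i) - f (gaussDeriv x y i) ^ 2) * hε
    exact sub_eq_zero.1 (eq_zero_of_inl_add_eps_mul_eq_zero h0).2
  · have h := congrArg (TrivSqZeroExt.fstHom K K K) h2
    have h' : TrivSqZeroExt.fst (20736 : DualNumber K) = 20736 :=
      map_ofNat (TrivSqZeroExt.fstHom K K K) 20736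
    simpa [f, ε, h'] using h

namespace IsSegreLine

variable {α β : Fin 6 → K}

/-- The second derivative at a point of the conic where the quintic form vanishes. -/
theorem igusaHessian_mixed (h2 : (2 : K) ≠ 0) (h3 : (3 : K) ≠ 0) (h : IsSegreLine α β)
    (γ η v : Fin 6 → K) (p q r s : K)
    (hγ : γ = fun i => p * α i + q * β i) (hη : η = fun i => r * α i + s * β i)
    (hv : ∑ i, v i = 0) (h01 : γ 0 + γ 1 = 0) :
    igusaHessian (mixed γ γ) (mixed γ η) v = -1728 * ((η 0 + η 1) * (γ 0 + γ 2) * (γ 0 + γ 3) *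
      (γ 0 + γ 4) * (γ 0 + γ 5)) * ∑ i, γ i * v i := by
  let f := TrivSqZeroExt.inlHom K K
  let ε : DualNumber K := DualNumber.eps
  have hε : ε ^ 2 = 0 := eps_sq
  have hs : ∑ i, (f (γ i) + ε * f (η i)) = 0 := by
    rw [Finset.sum_add_distrib, ← Finset.mul_sum, ← map_sum, ← map_sum, hγ, hη, h.sum_comb,
      h.sum_comb]
    simp
  have hc : ∑ i, (f (γ i) + ε * f (η i)) ^ 3 = 0 := by
    have a1 : ∑ i, γ i ^ 3 = 0 := by rw [hγ]; exact h.cube_comb p q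
    have a2 : ∑ i, γ i ^ 2 * η i = 0 := by
      have b1 := h.cube_left
      have b2 := h.sq_left
      have b3 := h.sq_right
      have b4 := h.cube_right
      rw [hγ, hη]
      simp only [Fin.sum_univ_six] at *
      linear_combination p ^ 2 * r * b1 + (2 * p * q * r + p ^ 2 * s) * b2
        + (q ^ 2 * r + 2 * p * q * s) * b3 + q ^ 2 * s * b4
    have : ∑ i, (f (γ i) + ε * f (η i)) ^ 3 = f (∑ i, γ i ^ 3) + 3 * ε * f (∑ i, γ i ^ 2 * η i) := by
      simp only [map_sum, map_pow, map_mul, Finset.mul_sum, ← Finset.sum_add_distrib]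
      refine Finset.sum_congr rfl fun i _ => ?_
      linear_combination (3 * f (γ i) * f (η i) ^ 2 + ε * f (η i) ^ 3) * hε
    rw [this, a1, a2]
    simp
  have hv' : ∑ i, f (v i) = 0 := by rw [← map_sum, hv, map_zero]
  -- The identity is applied at $\gamma+\varepsilon\eta$, a dual-number point of the cubic. Since
  -- $\gamma_0+\gamma_1=0$, only the derivative of this factor of the quintic contributes. The
  -- constant is $-10368/6$, with a factor 3 from the identity and 2 from squaring
  -- $\gamma+\varepsilon\eta$.
  have key := three_mul_igusaPolar_mixed_self _ _ hs hc hv'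
  rw [mixed_add_mul _ _ _ hε, map_mixed, map_mixed] at key
  have h2' : (fun i => 2 * f (mixed γ η i)) = fun i => f (2 * mixed γ η i) := by
    ext1 i; rw [map_mul, map_ofNat]
  have hP := igusaPolar_add_mul (fun i => f (mixed γ γ i)) (fun i => 2 * f (mixed γ η i))
    (fun i => f (v i)) ε
  rw [hP, pow_succ ε 2, hε, h2', map_igusaPolar, map_igusaHessian, igusaHessian_smul_left] at key
  have hsum : ∑ i, (f (γ i) + ε * f (η i)) * f (v i) = f (∑ i, γ i * v i)
      + ε * f (∑ i, η i * v i) := by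
    simp only [map_sum, map_mul, Finset.mul_sum, ← Finset.sum_add_distrib]
    exact Finset.sum_congr rfl fun i _ => by ring
  have h01' : f (γ 0) + ε * f (η 0) + (f (γ 1) + ε * f (η 1)) = ε * f (η 0 + η 1) := by
    have : f (γ 0) + f (γ 1) = 0 := by rw [← map_add, h01, map_zero]
    rw [map_add]
    linear_combination this
  obtain ⟨m, hm⟩ : ∃ m, (f (γ 0) + ε * f (η 0) + (f (γ 2) + ε * f (η 2))) *
      (f (γ 0) + ε * f (η 0) + (f (γ 3) + ε * f (η 3))) *
      (f (γ 0) + ε * f (η 0) + (f (γ 4) + ε * f (η 4))) *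
      (f (γ 0) + ε * f (η 0) + (f (γ 5) + ε * f (η 5))) =
      f ((γ 0 + γ 2) * (γ 0 + γ 3) * (γ 0 + γ 4) * (γ 0 + γ 5)) + ε * m := by
    have step : ∀ a b c d : DualNumber K, (a + ε * b) * (c + ε * d) =
        a * c + ε * (b * c + a * d + ε * (b * d)) := fun a b c d => by ring
    have e : ∀ i, f (γ 0) + ε * f (η 0) + (f (γ i) + ε * f (η i)) =
        f (γ 0 + γ i) + ε * f (η 0 + η i) := fun i => by simp only [map_add]; ring
    rw [e, e, e, e, step, step, step]
    exact ⟨_, by rw [map_mul, map_mul, map_mul]⟩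
  have h0 : f (3 * igusaPolar (mixed γ γ) v) + ε * f (6 * igusaHessian (mixed γ γ) (mixed γ η) v
      + 10368 * ((η 0 + η 1) * ((γ 0 + γ 2) * (γ 0 + γ 3) * (γ 0 + γ 4) * (γ 0 + γ 5)))
        * ∑ i, γ i * v i) = 0 := by
    simp only [h01', hsum] at key
    simp only [map_add, map_mul, map_ofNat] at key hm ⊢
    linear_combination key - 10368 * ε * (f (η 0) + f (η 1)) * (f (∑ i, γ i * v i)
      + ε * f (∑ i, η i * v i)) * hm - 10368 * (f (η 0) + f (η 1)) * (m * f (∑ i, γ i * v i)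
      + ((f (γ 0) + f (γ 2)) * (f (γ 0) + f (γ 3)) * (f (γ 0) + f (γ 4)) * (f (γ 0) + f (γ 5)))
        * f (∑ i, η i * v i) + ε * m * f (∑ i, η i * v i)) * hε
  have h6 : (6 : K) ≠ 0 := by
    rw [show (6 : K) = 2 * 3 by norm_num]; exact mul_ne_zero h2 h3
  refine mul_left_cancel₀ h6 ?_
  linear_combination (eq_zero_of_inl_add_eps_mul_eq_zero h0).2

end IsSegreLine

end Deformations

/-! ### From the Igusa quartic to the Segre cubic -/

/-- `x` is a point of the quartic outside the exceptional locus. -/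
structure IsGeneralPoint {K : Type*} [Field K] (x : Fin 6 → K) : Prop where
  sum_eq : ∑ i, x i = 0
  value_eq : igusaValue x = 0
  triple_ne : ∀ i j k, i ≠ j → i ≠ k → j ≠ k → x i + x j + x k ≠ 0

namespace IsGeneralPoint

variable {K : Type*} [Field K] {x y : Fin 6 → K}

theorem perm (h : IsGeneralPoint x) (σ : Equiv.Perm (Fin 6)) : IsGeneralPoint (x ∘ σ) where
  sum_eq := by simpa [Equiv.sum_comp σ] using h.sum_eq
  value_eq := by
    rw [← h.value_eq, igusaValue, igusaValue, ← Equiv.sum_comp σ fun i => x i ^ 2,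
      ← Equiv.sum_comp σ fun i => x i ^ 4]
    rfl
  triple_ne i j k hij hik hjk := h.triple_ne _ _ _ (σ.injective.ne hij) (σ.injective.ne hik)
    (σ.injective.ne hjk)

theorem triple_prod_ne (h2 : (2 : K) ≠ 0) (h3 : (3 : K) ≠ 0) (h : IsGeneralPoint x) :
    -20736 * ((x 0 + x 1 + x 2) * (x 0 + x 1 + x 3) * (x 0 + x 1 + x 4) * (x 0 + x 1 + x 5) *
      (x 0 + x 2 + x 3) * (x 0 + x 2 + x 4) * (x 0 + x 2 + x 5) * (x 0 + x 3 + x 4) *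
      (x 0 + x 3 + x 5) * (x 0 + x 4 + x 5)) ≠ 0 := by
  have h0 : (-20736 : K) ≠ 0 := by
    rw [show (-20736 : K) = -(2 ^ 8 * 3 ^ 4) by norm_num]
    exact neg_ne_zero.2 (mul_ne_zero (pow_ne_zero _ h2) (pow_ne_zero _ h3))
  refine mul_ne_zero h0 ?_
  simp only [ne_eq, mul_eq_zero, not_or]
  refine ⟨⟨⟨⟨⟨⟨⟨⟨⟨?_, ?_⟩, ?_⟩, ?_⟩, ?_⟩, ?_⟩, ?_⟩, ?_⟩, ?_⟩, ?_⟩ <;>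
    exact h.triple_ne _ _ _ (by decide) (by decide) (by decide)

theorem gauss_sq (h2 : (2 : K) ≠ 0) (h3 : (3 : K) ≠ 0) (h : IsGeneralPoint x) :
    ∃ D E : K, D ≠ 0 ∧ ∀ i, gauss x i ^ 2 = D * x i + E := by
  obtain ⟨D, E, r, h4, h5⟩ := IgusaQuartic.gauss_sq x h.sum_eq
  refine ⟨D, E, fun hD => h.triple_prod_ne h2 h3 ?_, fun i => ?_⟩
  · rw [hD, h.value_eq, zero_mul, zero_sub, ← neg_mul] at h5
    rw [← h5, zero_pow two_ne_zero]
  · rw [h4, h.value_eq]; ring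

/-- Squaring inverts the Gauss map projectively; the constant $E$ disappears in the normalisation to
sum zero. -/
theorem mixed_gauss (h2 : (2 : K) ≠ 0) (h3 : (3 : K) ≠ 0) (h : IsGeneralPoint x) :
    ∃ D : K, D ≠ 0 ∧ ∀ i, mixed (gauss x) (gauss x) i = D * x i := by
  obtain ⟨D, E, hD, hDE⟩ := h.gauss_sq h2 h3
  refine ⟨6 * D, mul_ne_zero ?_ hD, fun i => ?_⟩
  · rw [show (6 : K) = 2 * 3 by norm_num]; exact mul_ne_zero h2 h3
  · simp only [mixed, ← pow_two, hDE, Finset.sum_add_distrib, ← Finset.mul_sum, h.sum_eq]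
    simp
    ring

/-- Opposite values of `gauss` have equal squares, hence come from equal coordinates of $x$, hence
are equal and zero. If this happens at $0,1$, the cubic relation pairs the other four values into
opposite ones; then $x$ consists of three equal pairs, and a triple sum vanishes. -/
theorem gauss_add_ne_zero_aux (h2 : (2 : K) ≠ 0) (h3 : (3 : K) ≠ 0) (h : IsGeneralPoint x)
    (hcube : ∑ i, gauss x i ^ 3 = 0) : gauss x 0 + gauss x 1 ≠ 0 := by
  intro h01
  obtain ⟨D, E, hD, hDE⟩ := h.gauss_sq h2 h3
  have eq_of : ∀ i j, gauss x i + gauss x j = 0 → x i = x j := fun i j hij => by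
    refine mul_left_cancel₀ hD ?_
    linear_combination (gauss x i - gauss x j) * hij - hDE i + hDE j
  have zero_of : ∀ i j, gauss x i + gauss x j = 0 → gauss x i = 0 := fun i j hij => by
    have : gauss x i = gauss x j := by simp only [gauss, eq_of i j hij]
    refine (mul_eq_zero.1 (?_ : 2 * gauss x i = 0)).resolve_left h2
    linear_combination hij + this
  have hs := sum_gauss x h.sum_eq
  have hx := h.sum_eq
  simp only [Fin.sum_univ_six] at hs hcube hx
  have h0 := zero_of 0 1 h01
  have h1 : gauss x 1 = 0 := by linear_combination h01 - h0
  have hx01 := eq_of 0 1 h01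
  have key : ∀ i j k : Fin 6, gauss x 2 + gauss x i = 0 → gauss x j + gauss x k = 0 →
      x 0 + x 1 + (x 2 + x i) + (x j + x k) = 0 → 0 ≠ j → 2 ≠ j → False := by
    intro i j k h2i hjk hsum h0j h2j
    refine h.triple_ne 0 2 j (by decide) h0j h2j
      ((mul_eq_zero.1 (?_ : 2 * (x 0 + x 2 + x j) = 0)).resolve_left h2)
    linear_combination hsum + hx01 + eq_of 2 i h2i + eq_of j k hjk
  rw [h0, h1] at hs hcube
  have h5 : gauss x 5 = -(gauss x 2 + gauss x 3 + gauss x 4) := by linear_combination hs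
  have hprod : 3 * ((gauss x 2 + gauss x 3) * ((gauss x 2 + gauss x 4) *
      (gauss x 2 + gauss x 5))) = 0 := by
    rw [h5] at hcube ⊢
    linear_combination hcube
  rcases mul_eq_zero.1 ((mul_eq_zero.1 hprod).resolve_left h3) with h23 | h'
  · exact key 3 4 5 h23 (by linear_combination hs - h23) (by linear_combination hx) (by decide)
      (by decide)
  · rcases mul_eq_zero.1 h' with h24 | h25
    · exact key 4 3 5 h24 (by linear_combination hs - h24) (by linear_combination hx) (by decide)
        (by decide)
    · exact key 5 3 4 h25 (by linear_combination hs - h25) (by linear_combination hx) (by decide)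
        (by decide)

theorem sum_gauss_mul (h2 : (2 : K) ≠ 0) (hy : ∑ i, y i = 0) (hP : igusaPolar x y = 0) :
    ∑ i, gauss x i * y i = 0 := by
  have := three_mul_igusaPolar x y hy
  rw [hP, mul_zero] at this
  have h4 : (-4 : K) ≠ 0 := by
    rw [show (-4 : K) = -(2 * 2) by norm_num]; exact neg_ne_zero.2 (mul_ne_zero h2 h2)
  exact (mul_eq_zero.1 this.symm).resolve_left h4

/-- The squares of `gauss y` are affine in $y$, so polarity to $x$ becomes a cubic relation. -/
theorem sum_gauss_mul_sq (h2 : (2 : K) ≠ 0) (h3 : (3 : K) ≠ 0) (hx : IsGeneralPoint x)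
    (hy : IsGeneralPoint y) (hP : igusaPolar x y = 0) :
    ∑ i, gauss x i * gauss y i ^ 2 = 0 := by
  obtain ⟨D, E, -, hDE⟩ := hy.gauss_sq h2 h3
  have h1 := sum_gauss_mul h2 hy.sum_eq hP
  have h4 := sum_gauss x hx.sum_eq
  have : ∑ i, gauss x i * gauss y i ^ 2 = D * (∑ i, gauss x i * y i) + E * ∑ i, gauss x i := by
    simp only [hDE, Fin.sum_univ_six]; ring
  rw [this, h1, h4]; ring

/-- The case $y=x$ of the preceding relation, by Euler's formula: the Gauss image lies on the Segre
cubic. -/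
theorem cube_gauss (h2 : (2 : K) ≠ 0) (h3 : (3 : K) ≠ 0) (hx : IsGeneralPoint x) :
    ∑ i, gauss x i ^ 3 = 0 := by
  rw [← hx.sum_gauss_mul_sq h2 h3 hx (by rw [igusaPolar_self, hx.value_eq, mul_zero])]
  exact Finset.sum_congr rfl fun i _ => by ring

theorem gauss_comp (x : Fin 6 → K) (σ : Equiv.Perm (Fin 6)) (i : Fin 6) :
    gauss (x ∘ σ) i = gauss x (σ i) := by
  simp only [gauss, Function.comp_apply]
  rw [Equiv.sum_comp σ fun i => x i ^ 2, Equiv.sum_comp σ fun i => x i ^ 3]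

theorem gauss_add_ne_zero (h2 : (2 : K) ≠ 0) (h3 : (3 : K) ≠ 0) (h : IsGeneralPoint x)
    (i j : Fin 6) (hij : i ≠ j) : gauss x i + gauss x j ≠ 0 := by
  obtain ⟨k, hki, hkj⟩ : ∃ k : Fin 6, k ≠ i ∧ k ≠ j := by revert i j; decide
  obtain ⟨σ, rfl, rfl, -⟩ := exists_perm_fin_six i j k hij hki.symm hkj.symm
  rw [← gauss_comp, ← gauss_comp]
  exact (h.perm σ).gauss_add_ne_zero_aux h2 h3 ((h.perm σ).cube_gauss h2 h3)

/-- The sum is $D\sum\varepsilon_ix_i$. Outside characteristics 2 and 3, signs with sum zero have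
exactly three equal to $1$, so $\sum\varepsilon_ix_i$ is twice a triple sum of $x$. -/
theorem sign_ne_zero (h2 : (2 : K) ≠ 0) (h3 : (3 : K) ≠ 0) (h : IsGeneralPoint x)
    (ε : Fin 6 → K) (hε : ∀ i, ε i ^ 2 = 1) (hs : ∑ i, ε i = 0) :
    ∑ i, ε i * gauss x i ^ 2 ≠ 0 := by
  classical
  intro h0
  obtain ⟨D, E, hD, hDE⟩ := h.gauss_sq h2 h3
  have hx : ∑ i, ε i * x i = 0 := by
    refine (mul_eq_zero.1 (?_ : D * _ = 0)).resolve_left hD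
    have : ∑ i, ε i * gauss x i ^ 2 = D * (∑ i, ε i * x i) + E * ∑ i, ε i := by
      simp only [hDE, Fin.sum_univ_six]; ring
    rw [h0, hs] at this
    linear_combination -this
  have hε' : ∀ i, ε i = 2 * (if ε i = 1 then 1 else 0) - 1 := fun i => by
    split_ifs with h1
    · rw [h1]; norm_num
    · rw [(sq_eq_one_iff.1 (hε i)).resolve_left h1]; norm_num
  set S := Finset.univ.filter fun i => ε i = 1 with hS
  have hcard : 2 * ((S.card : K) - 3) = 0 := by
    rw [Finset.sum_congr rfl fun i _ => hε' i, Finset.sum_sub_distrib, ← Finset.mul_sum,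
      Finset.sum_boole] at hs
    simp only [Finset.sum_const, Finset.card_univ, Fintype.card_fin, nsmul_eq_mul, mul_one] at hs
    rw [hS, ← hs]; push_cast; ring
  have hc3 : S.card = 3 := by
    have hle : S.card ≤ 6 := (Finset.card_le_univ S).trans (by simp)
    have hcard' := (mul_eq_zero.1 hcard).resolve_left h2
    have hone : (1 : K) ≠ 0 := one_ne_zero
    generalize S.card = n at hle hcard'
    interval_cases n <;> norm_num at hcard' <;> first | exact absurd hcard' h2 | exact absurd hcard' h3 | rfl
  obtain ⟨i, j, k, hij, hik, hjk, hSe⟩ := Finset.card_eq_three.1 hc3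
  refine h.triple_ne i j k hij hik hjk ((mul_eq_zero.1 (?_ : 2 * (x i + x j + x k) = 0)).resolve_left
    h2)
  have hsum : ∑ i, ε i * x i = 2 * (∑ i ∈ S, x i) - ∑ i, x i := by
    rw [hS, Finset.sum_filter, Finset.mul_sum, ← Finset.sum_sub_distrib]
    refine Finset.sum_congr rfl fun i _ => ?_
    conv_lhs => rw [hε' i]
    split_ifs <;> ring
  rw [hx, h.sum_eq, hSe, Finset.sum_insert (by simp [hij, hik]), Finset.sum_pair hjk] at hsum
  linear_combination -hsum

theorem isSegreLine (h2 : (2 : K) ≠ 0) (h3 : (3 : K) ≠ 0) (hx : IsGeneralPoint x)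
    (hy : IsGeneralPoint y) (hxy : igusaPolar x y = 0) (hyx : igusaPolar y x = 0)
    (hne : ∀ c : K, y ≠ c • x) : IsSegreLine (gauss x) (gauss y) where
  sum_left := sum_gauss x hx.sum_eq
  sum_right := sum_gauss y hy.sum_eq
  cube_left := hx.cube_gauss h2 h3
  cube_right := hy.cube_gauss h2 h3
  sq_right := hx.sum_gauss_mul_sq h2 h3 hy hxy
  sq_left := by
    rw [← hy.sum_gauss_mul_sq h2 h3 hx hyx]
    exact Finset.sum_congr rfl fun i _ => mul_comm _ _
  pair_left := hx.gauss_add_ne_zero h2 h3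
  pair_right := hy.gauss_add_ne_zero h2 h3
  sign := hx.sign_ne_zero h2 h3
  indep p q h := by
    have hq : q = 0 := by
      by_contra hq
      obtain ⟨D, hD, hDx⟩ := hx.mixed_gauss h2 h3
      obtain ⟨D', hD', hDy⟩ := hy.mixed_gauss h2 h3
      -- Proportional Gauss images have proportional squares, so $x$ and $y$ would be proportional.
      have hβ : ∀ i, gauss y i = -p / q * gauss x i := fun i => by
        field_simp
        linear_combination h i
      refine hne ((p / q) ^ 2 * D / D') (funext fun i => ?_)
      rw [Pi.smul_apply, smul_eq_mul]
      refine mul_left_cancel₀ hD' ?_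
      rw [← hDy, show D' * ((p / q) ^ 2 * D / D' * x i) = (p / q) ^ 2 * (D * x i) by field_simp,
        ← hDx]
      simp only [mixed, hβ, Fin.sum_univ_six]
      ring
    refine ⟨?_, hq⟩
    refine (mul_eq_zero.1 (?_ : p * (gauss x 0 + gauss x 1) = 0)).resolve_right
      (hx.gauss_add_ne_zero h2 h3 0 1 (by decide))
    linear_combination h 0 + h 1 - hq * (gauss y 0 + gauss y 1)

/-- If the conic in the plane degenerates, the squares become dependent. -/
theorem igusaHessian_squares_ne_zero [IsAlgClosed K] (h2 : (2 : K) ≠ 0) (h3 : (3 : K) ≠ 0)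
    (hx : IsGeneralPoint x)
    (hy : IsGeneralPoint y) (hxy : igusaPolar x y = 0) (hyx : igusaPolar y x = 0)
    (hne : ∀ c : K, y ≠ c • x) :
    ∃ X Y Z, igusaHessian x y (squares (gauss x) (gauss y) X Y Z) ≠ 0 := by
  by_contra! hcon
  have h := hx.isSegreLine h2 h3 hy hxy hyx hne
  obtain ⟨D, D', E, hD, hDsq⟩ := two_mul_gauss_mul_gaussDeriv x y hx.sum_eq hy.sum_eq hx.value_eq hxy
  have hD0 : D ≠ 0 := fun h0 => hx.triple_prod_ne h2 h3 (by rw [← hDsq, h0]; ring)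
  have h4 : (-4 : K) ≠ 0 := by
    rw [show (-4 : K) = -(2 * 2) by norm_num]; exact neg_ne_zero.2 (mul_ne_zero h2 h2)
  -- By assumption `gaussDeriv x y` annihilates the plane, the common kernel of $1,\alpha,\beta$, so
  -- it lies in their span.
  obtain ⟨c, p, q, hη⟩ : ∃ c p q : K, ∀ i, gaussDeriv x y i =
      c + p * gauss x i + q * gauss y i := by
    let f : (Fin 6 → K) → Module.Dual K (Fin 6 → K) := fun a => ∑ i, a i • LinearMap.proj i
    have hf : ∀ a v, f a v = ∑ i, a i * v i := fun a v => by simp [f]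
    have hmem : f (gaussDeriv x y) ∈ Submodule.span K
        (Set.range ![f fun _ => 1, f (gauss x), f (gauss y)]) := by
      refine mem_span_of_iInf_ker_le_ker fun v hv => ?_
      simp only [Submodule.mem_iInf, LinearMap.mem_ker] at hv ⊢
      have hv0 := hv 0
      have hv1 := hv 1
      have hv2 := hv 2
      simp only [Matrix.cons_val_zero, Matrix.cons_val_one, Matrix.cons_val, hf, one_mul] at hv0 hv1 hv2
      obtain ⟨X, Y, Z, rfl⟩ := h.exists_eq_squares h2 h3 v hv0 hv1 hv2
      have := three_mul_igusaHessian x y _ hv0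
      rw [hcon, mul_zero] at this
      rw [hf]
      exact (mul_eq_zero.1 this.symm).resolve_left h4
    rw [Submodule.mem_span_range_iff_exists_fun] at hmem
    obtain ⟨c, hc⟩ := hmem
    refine ⟨c 0, c 1, c 2, fun i => ?_⟩
    have := congrArg (fun l => l (Pi.single i 1)) hc
    simp [Fin.sum_univ_three, hf, Pi.single_apply] at this
    exact this.symm
  have hc : c = 0 := by
    have hs := sum_gaussDeriv x y hx.sum_eq hy.sum_eq
    have h6 : (6 : K) ≠ 0 := by
      rw [show (6 : K) = 2 * 3 by norm_num]; exact mul_ne_zero h2 h3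
    have e1 := sum_gauss x hx.sum_eq
    have e2 := sum_gauss y hy.sum_eq
    simp only [hη, Fin.sum_univ_six] at hs e1 e2
    refine (mul_eq_zero.1 (?_ : 6 * c = 0)).resolve_left h6
    linear_combination hs - p * e1 - q * e2
  obtain ⟨Dx, hDx0, hDx⟩ := hx.mixed_gauss h2 h3
  obtain ⟨Dy, hDy0, hDy⟩ := hy.mixed_gauss h2 h3
  -- Substitution into $2\alpha\eta=Dy+D'x+E$, where $\eta$ is `gaussDeriv x y`, with $x$ and $y$
  -- replaced by multiples of the normalised $\alpha^2$ and $\beta^2$, gives a linear relation whose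
  -- coefficient at $\beta^2$ is nonzero.
  have hzero : squares (gauss x) (gauss y) (2 * p - 6 * D' / Dx) (2 * q) (-(6 * D / Dy)) = 0 := by
    have e1 := hx.sum_eq
    have e2 := hy.sum_eq
    have hmix : ∀ i, 2 * p * mixed (gauss x) (gauss x) i + 2 * q * mixed (gauss x) (gauss y) i
        = 6 * (D * y i + D' * x i) := fun i => by
      have hi : ∀ i, 2 * p * (gauss x i * gauss x i) + 2 * q * (gauss x i * gauss y i)
          = D * y i + D' * x i + E := fun i => by
        rw [← hD, hη, hc]; ring
      have hi2 : 2 * p * (∑ i, gauss x i * gauss x i) + 2 * q * (∑ i, gauss x i * gauss y i)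
          = 6 * E := by
        rw [Finset.mul_sum, Finset.mul_sum, ← Finset.sum_add_distrib,
          Finset.sum_congr rfl fun i _ => hi i]
        simp only [Fin.sum_univ_six] at e1 e2 ⊢
        linear_combination D * e2 + D' * e1
      simp only [mixed]
      linear_combination 6 * hi i - hi2
    ext i
    simp only [squares, Pi.zero_apply]
    rw [hDy]
    have := hmix i
    field_simp
    have hxi := hDx i
    linear_combination Dx * this - 6 * D' * hxi
  have := (h.eq_zero_of_squares_eq_zero h2 h3 hzero).2.2
  have h6 : (6 : K) ≠ 0 := by
    rw [show (6 : K) = 2 * 3 by norm_num]; exact mul_ne_zero h2 h3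
  exact neg_ne_zero.2 (div_ne_zero (mul_ne_zero h6 hD0) hDy0) this

end IsGeneralPoint

/-! ### Second derivatives on the plane and the five nodes. -/

theorem igusaHessian_squares {K : Type*} [Field K] (h2 : (2 : K) ≠ 0) {α β : Fin 6 → K} {κ : K}
    (hκ : ∀ X Y Z, igusaValue (squares α β X Y Z) = κ * (Y ^ 2 - 4 * X * Z) ^ 2)
    (X Y Z X' Y' Z' X'' Y'' Z'' : K) :
    igusaHessian (squares α β X Y Z) (squares α β X' Y' Z') (squares α β X'' Y'' Z'') =
      2 * κ * ((2 * Y * Y' - 4 * X * Z' - 4 * Z * X') * (2 * Y * Y'' - 4 * X * Z'' - 4 * Z * X'')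
        + (Y ^ 2 - 4 * X * Z) * (2 * Y' * Y'' - 4 * X' * Z'' - 4 * Z' * X'')) := by
  have h4 : (4 : K) ≠ 0 := by
    rw [show (4 : K) = 2 * 2 by norm_num]; exact mul_ne_zero h2 h2
  have hlin : ∀ a b c : K, igusaValue (fun i => a * squares α β X Y Z i
      + b * squares α β X' Y' Z' i + c * squares α β X'' Y'' Z'' i) =
      κ * ((a * Y + b * Y' + c * Y'') ^ 2
        - 4 * (a * X + b * X' + c * X'') * (a * Z + b * Z' + c * Z'')) ^ 2 := fun a b c => by
    rw [← hκ]
    congr 1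
    ext i
    simp only [squares]
    ring
  have e1 := hlin 1 1 1
  have e2 := hlin 1 (-1) (-1)
  have e3 := hlin 1 1 (-1)
  have e4 := hlin 1 (-1) 1
  have e5 := hlin 0 1 1
  have e6 := hlin 0 1 (-1)
  simp only [one_mul, neg_mul, ← sub_eq_add_neg, zero_mul, zero_add] at e1 e2 e3 e4 e5 e6
  refine mul_left_cancel₀ h4 ?_
  rw [four_mul_igusaHessian, e1, e2, e3, e4, e5, e6]
  ring

theorem igusaHessian_comp {R : Type*} [CommRing R] (x v w : Fin 6 → R)
    (σ : Equiv.Perm (Fin 6)) :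
    igusaHessian (x ∘ σ) (v ∘ σ) (w ∘ σ) = igusaHessian x v w := by
  rw [igusaHessian, igusaHessian, ← Equiv.sum_comp σ fun i => x i * v i,
    ← Equiv.sum_comp σ fun i => x i * w i, ← Equiv.sum_comp σ fun i => x i ^ 2,
    ← Equiv.sum_comp σ fun i => v i * w i, ← Equiv.sum_comp σ fun i => x i ^ 2 * v i * w i]
  rfl

theorem mixed_comp {R : Type*} [CommRing R] (x v : Fin 6 → R) (σ : Equiv.Perm (Fin 6)) :
    mixed (x ∘ σ) (v ∘ σ) = mixed x v ∘ σ := by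
  ext i
  simp only [mixed, Function.comp_apply, Equiv.sum_comp σ fun i => x i * v i]

theorem igusaHessian_add_mul {R : Type*} [CommRing R] (x u v w : Fin 6 → R) (a b : R) :
    igusaHessian x (fun i => a * u i + b * v i) w =
      a * igusaHessian x u w + b * igusaHessian x v w := by
  simp only [igusaHessian, Fin.sum_univ_six]; ring

/-- The points of the line with `xᵢ + xⱼ = 0`. -/
def nodeLine {K : Type*} [Field K] (α β : Fin 6 → K) (j : Fin 6) : Fin 6 → K := fun i =>
  (β 0 + β j) * α i + -(α 0 + α j) * β i

namespace IsSegreLine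

variable {K : Type*} [Field K] {α β : Fin 6 → K}

theorem nodeLine_add (α β : Fin 6 → K) (j : Fin 6) : nodeLine α β j 0 + nodeLine α β j j = 0 := by
  simp only [nodeLine]; ring

/-- `igusaHessian_mixed` with $\eta=\alpha$. The zero of the quintic is simple:
$\alpha_0+\alpha_1\ne0$, and no nonzero point of the line satisfies
$\gamma_0+\gamma_1=\gamma_0+\gamma_i=0$ for another $i$. -/
theorem exists_igusaHessian_node_aux (h2 : (2 : K) ≠ 0) (h3 : (3 : K) ≠ 0)
    (h : IsSegreLine α β) :
    ∃ c : K, c ≠ 0 ∧ ∀ v, ∑ i, v i = 0 →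
      igusaHessian (mixed (nodeLine α β 1) (nodeLine α β 1)) (mixed (nodeLine α β 1) α) v =
        c * ∑ i, nodeLine α β 1 i * v i := by
  refine ⟨_, ?_, fun v hv => h.igusaHessian_mixed h2 h3 (nodeLine α β 1) α v (β 0 + β 1)
    (-(α 0 + α 1)) 1 0 rfl (by ext i; ring) hv (nodeLine_add α β 1)⟩
  have h0 : (-1728 : K) ≠ 0 := by
    rw [show (-1728 : K) = -(2 ^ 6 * 3 ^ 3) by norm_num]
    exact neg_ne_zero.2 (mul_ne_zero (pow_ne_zero _ h2) (pow_ne_zero _ h3))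
  have key : ∀ i, 1 ≠ i → 0 ≠ i → nodeLine α β 1 0 + nodeLine α β 1 i ≠ 0 := fun i h1 h0 hi =>
    h.pair_right 0 1 (by decide)
      (h.eq_zero_of_add_eq_zero h3 _ _ (by decide) h0 h1 (nodeLine_add α β 1) hi).1
  exact mul_ne_zero h0 (mul_ne_zero (mul_ne_zero (mul_ne_zero (mul_ne_zero
    (h.pair_left 0 1 (by decide)) (key 2 (by decide) (by decide))) (key 3 (by decide) (by decide)))
    (key 4 (by decide) (by decide))) (key 5 (by decide) (by decide)))

theorem exists_igusaHessian_node (h2 : (2 : K) ≠ 0) (h3 : (3 : K) ≠ 0) (h : IsSegreLine α β)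
    (j : Fin 6) (hj : 0 ≠ j) :
    ∃ c : K, c ≠ 0 ∧ ∀ v, ∑ i, v i = 0 →
      igusaHessian (mixed (nodeLine α β j) (nodeLine α β j)) (mixed (nodeLine α β j) α) v =
        c * ∑ i, nodeLine α β j i * v i := by
  obtain ⟨k, hk0, hkj⟩ : ∃ k : Fin 6, k ≠ 0 ∧ k ≠ j := by revert j; decide
  obtain ⟨σ, h0, rfl, -⟩ := exists_perm_fin_six 0 j k hj hk0.symm hkj.symm
  obtain ⟨c, hc, hcv⟩ := (h.perm σ).exists_igusaHessian_node_aux h2 h3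
  have hn : nodeLine (α ∘ σ) (β ∘ σ) 1 = nodeLine α β (σ 1) ∘ σ := by
    ext i
    simp only [nodeLine, Function.comp_apply, h0]
  refine ⟨c, hc, fun v hv => ?_⟩
  have := hcv (v ∘ σ) (by simpa [Equiv.sum_comp σ] using hv)
  rw [hn, mixed_comp, mixed_comp, igusaHessian_comp] at this
  rw [this]
  congr 1
  exact Equiv.sum_comp σ fun i => nodeLine α β (σ 1) i * v i

theorem mixed_nodeLine (α β : Fin 6 → K) (j : Fin 6) :
    mixed (nodeLine α β j) (nodeLine α β j) = squares α β ((β 0 + β j) ^ 2)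
      (-2 * (β 0 + β j) * (α 0 + α j)) ((α 0 + α j) ^ 2) := by
  refine (mixed_comb α β _ _ _ _).trans ?_
  congr 1 <;> ring

/-- The quintic multiplier of $\gamma$ has the factor $\gamma_0+\gamma_j=0$, so the whole quartic is
singular at this point. -/
theorem igusaPolar_node (h3 : (3 : K) ≠ 0) (h : IsSegreLine α β) (j : Fin 6) (hj : 0 ≠ j)
    (v : Fin 6 → K) (hv : ∑ i, v i = 0) :
    igusaPolar (mixed (nodeLine α β j) (nodeLine α β j)) v = 0 := by
  refine (mul_eq_zero.1 (?_ : 3 * _ = (0 : K))).resolve_left h3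
  rw [three_mul_igusaPolar_mixed_self (nodeLine α β j) v (h.sum_comb _ _) (h.cube_comb _ _) hv]
  have h0 := nodeLine_add α β j
  have : (nodeLine α β j 0 + nodeLine α β j 1) * (nodeLine α β j 0 + nodeLine α β j 2) *
      (nodeLine α β j 0 + nodeLine α β j 3) * (nodeLine α β j 0 + nodeLine α β j 4) *
      (nodeLine α β j 0 + nodeLine α β j 5) = 0 := by
    fin_cases j
    · exact absurd rfl hj
    all_goals
      simp only [Fin.mk_one, Fin.reduceFinMk] at h0 ⊢
      rw [h0]
      ring
  rw [this]
  ring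

/-- The nodes are ordinary double points. -/
theorem eq_smul_node [IsAlgClosed K] (h2 : (2 : K) ≠ 0) (h3 : (3 : K) ≠ 0) (h : IsSegreLine α β)
    {κ : K} (hκ0 : κ ≠ 0)
    (hκ : ∀ X Y Z, igusaValue (squares α β X Y Z) = κ * (Y ^ 2 - 4 * X * Z) ^ 2)
    (j : Fin 6) (hj : 0 ≠ j) (u n : Fin 6 → K) (hu : ∑ i, u i = 0)
    (hun : (∑ i, α i * u i = 0 ∧ ∑ i, α i * n i = 0 ∧ ∑ i, β i * n i = 1) ∨
      (∑ i, β i * u i = 0 ∧ ∑ i, β i * n i = 0 ∧ ∑ i, α i * n i = 1)) (hn : ∑ i, n i = 0)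
    (hW : ∀ X Y Z, igusaHessian (mixed (nodeLine α β j) (nodeLine α β j)) u
      (squares α β X Y Z) = 0)
    (hun0 : igusaHessian (mixed (nodeLine α β j) (nodeLine α β j)) u n = 0) :
    ∃ c : K, u = fun i => c * mixed (nodeLine α β j) (nodeLine α β j) i := by
  obtain ⟨c, hc, hcv⟩ := h.exists_igusaHessian_node h2 h3 j hj
  have hpl := h.pair_left 0 j hj
  have hpr := h.pair_right 0 j hj
  have hsum : ∀ v : Fin 6 → K, ∑ i, nodeLine α β j i * v i =
      (β 0 + β j) * (∑ i, α i * v i) - (α 0 + α j) * ∑ i, β i * v i := fun v => by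
    simp only [nodeLine, Fin.sum_univ_six]; ring
  have hp' : mixed (nodeLine α β j) α = squares α β (β 0 + β j) (-(α 0 + α j)) 0 := by
    ext i
    simp only [mixed, nodeLine, squares, Fin.sum_univ_six]
    ring
  -- Pairing $u$ with the tangent vector `mixed γ α` of the conic, $\gamma$ being the `nodeLine`,
  -- gives $\sum\gamma_iu_i=0$. With one of $\alpha,\beta$ already annihilating $u$, this puts $u$
  -- in the plane.
  have hγu : ∑ i, nodeLine α β j i * u i = 0 := by
    refine (mul_eq_zero.1 (?_ : c * _ = 0)).resolve_left hc
    rw [← hcv u hu, hp', igusaHessian_comm, hW]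
  have hγn : ∑ i, nodeLine α β j i * n i ≠ 0 := by
    rw [hsum]
    rcases hun with ⟨-, h1, h2⟩ | ⟨-, h1, h2⟩ <;> rw [h1, h2]
    · exact fun h0 => hpl (by linear_combination -h0)
    · exact fun h0 => hpr (by linear_combination h0)
  have huα : ∑ i, α i * u i = 0 ∧ ∑ i, β i * u i = 0 := by
    rw [hsum] at hγu
    rcases hun with ⟨h0, -⟩ | ⟨h0, -⟩ <;> simp_all
  obtain ⟨X, Y, Z, rfl⟩ := h.exists_eq_squares h2 h3 u hu huα.1 huα.2
  -- At a point of the conic the second derivative of $\kappa Q^2$, where $Q=Y^2-4XZ$, has rank one,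
  -- with kernel the tangent line. Pairing with $\beta^2$ suffices, as it is not on that line.
  have htan : (β 0 + β j) * (α 0 + α j) * Y + (β 0 + β j) ^ 2 * Z + (α 0 + α j) ^ 2 * X = 0 := by
    have := hW 0 0 1
    rw [mixed_nodeLine, igusaHessian_squares h2 hκ] at this
    have h32 : (32 : K) ≠ 0 := by
      rw [show (32 : K) = 2 ^ 5 by norm_num]; exact pow_ne_zero _ h2
    refine (mul_eq_zero.1 (?_ : 32 * κ * (β 0 + β j) ^ 2 * _ = 0)).resolve_left
      (mul_ne_zero (mul_ne_zero h32 hκ0) (pow_ne_zero 2 hpr))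
    linear_combination this
  -- The tangent line is spanned by the node and `mixed γ α`; pairing with $n$, outside the plane,
  -- will remove the second component.
  obtain ⟨l, m, hlm⟩ : ∃ l m : K, squares α β X Y Z = fun i =>
      l * mixed (nodeLine α β j) (nodeLine α β j) i + m * mixed (nodeLine α β j) α i := by
    refine ⟨Z / (α 0 + α j) ^ 2,
      (X - Z / (α 0 + α j) ^ 2 * (β 0 + β j) ^ 2) / (β 0 + β j), ?_⟩
    rw [mixed_nodeLine, hp']
    have hY : Y = -(((β 0 + β j) ^ 2 * Z + (α 0 + α j) ^ 2 * X) / ((β 0 + β j) * (α 0 + α j))) := by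
      field_simp
      linear_combination htan
    ext i
    simp only [squares, hY]
    field_simp
    ring
  rw [hlm] at hun0 ⊢
  rw [igusaHessian_add_mul, igusaHessian_self, h.igusaPolar_node h3 j hj n hn, hcv n hn] at hun0
  have hm : m = 0 := by
    have : m * (c * ∑ i, nodeLine α β j i * n i) = 0 := by linear_combination hun0
    exact (mul_eq_zero.1 this).resolve_right (mul_ne_zero hc hγn)
  exact ⟨l, by simp [hm]⟩

/-- By independence of the squares, proportional nodes come from proportional points of the line;
such a point would satisfy $\gamma_0+\gamma_i=\gamma_0+\gamma_j=0$. -/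
theorem mixed_nodeLine_ne_smul [IsAlgClosed K] (h2 : (2 : K) ≠ 0) (h3 : (3 : K) ≠ 0)
    (h : IsSegreLine α β) (i j : Fin 6) (hi : 0 ≠ i) (hj : 0 ≠ j) (hij : i ≠ j) (c : K) :
    mixed (nodeLine α β j) (nodeLine α β j) ≠
      fun m => c * mixed (nodeLine α β i) (nodeLine α β i) m := by
  intro he
  rw [mixed_nodeLine, mixed_nodeLine] at he
  obtain ⟨h1, h4, h5⟩ := h.eq_zero_of_squares_eq_zero h2 h3
    (X := (β 0 + β j) ^ 2 - c * (β 0 + β i) ^ 2)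
    (Y := -2 * (β 0 + β j) * (α 0 + α j) - c * (-2 * (β 0 + β i) * (α 0 + α i)))
    (Z := (α 0 + α j) ^ 2 - c * (α 0 + α i) ^ 2) (by
      ext m
      have := congrFun he m
      simp only [squares, Pi.zero_apply] at this ⊢
      linear_combination this)
  have hsq : ((β 0 + β j) * (α 0 + α i) - (α 0 + α j) * (β 0 + β i)) ^ 2 = 0 := by
    linear_combination (α 0 + α i) ^ 2 * h1 + (β 0 + β i) ^ 2 * h5
      + (α 0 + α i) * (β 0 + β i) * h4
  have h0 := pow_eq_zero_iff (two_ne_zero) |>.1 hsq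
  exact h.pair_right 0 j hj (h.eq_zero_of_add_eq_zero h3 (β 0 + β j) (-(α 0 + α j)) hj hi hij.symm
    (by ring) (by linear_combination h0)).1

theorem mixed_nodeLine_ne_smul_left [IsAlgClosed K] (h2 : (2 : K) ≠ 0) (h3 : (3 : K) ≠ 0)
    (h : IsSegreLine α β) (j : Fin 6) (hj : 0 ≠ j) (c : K) :
    mixed (nodeLine α β j) (nodeLine α β j) ≠ fun m => c * mixed α α m := by
  intro he
  rw [mixed_nodeLine] at he
  obtain ⟨-, -, h5⟩ := h.eq_zero_of_squares_eq_zero h2 h3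
    (X := (β 0 + β j) ^ 2 - c) (Y := -2 * (β 0 + β j) * (α 0 + α j))
    (Z := (α 0 + α j) ^ 2) (by
      ext m
      have := congrFun he m
      simp only [squares, Pi.zero_apply] at this ⊢
      linear_combination this)
  exact pow_ne_zero 2 (h.pair_left 0 j hj) h5

theorem mixed_nodeLine_ne_smul_right [IsAlgClosed K] (h2 : (2 : K) ≠ 0) (h3 : (3 : K) ≠ 0)
    (h : IsSegreLine α β) (j : Fin 6) (hj : 0 ≠ j) (c : K) :
    mixed (nodeLine α β j) (nodeLine α β j) ≠ fun m => c * mixed β β m := by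
  intro he
  rw [mixed_nodeLine] at he
  obtain ⟨h5, -, -⟩ := h.eq_zero_of_squares_eq_zero h2 h3
    (X := (β 0 + β j) ^ 2) (Y := -2 * (β 0 + β j) * (α 0 + α j))
    (Z := (α 0 + α j) ^ 2 - c) (by
      ext m
      have := congrFun he m
      simp only [squares, Pi.zero_apply] at this ⊢
      linear_combination this)
  exact pow_ne_zero 2 (h.pair_right 0 j hj) h5

end IsSegreLine

/-- A multiple of the quadratic form of the double conic in the plane polar to `x` and `y`. -/
def conicValue {R : Type*} [CommRing R] (x y v : Fin 6 → R) : R :=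
  igusaHessian x y y * igusaHessian v x y - igusaHessian x y v * igusaHessian y x v

theorem conicValue_left {R : Type*} [CommRing R] {x y : Fin 6 → R} (hxy : igusaPolar x y = 0) :
    conicValue x y x = 0 := by
  rw [conicValue, igusaHessian_comm x y x, igusaHessian_self, hxy]
  ring

theorem conicValue_right {R : Type*} [CommRing R] {x y : Fin 6 → R} (hyx : igusaPolar y x = 0) :
    conicValue x y y = 0 := by
  rw [conicValue, igusaHessian_comm y x y, igusaHessian_self, hyx]
  ring

/-- `p` is an ordinary double point, outside the points `x` and `y`, of the sections of the quartic
by the hyperplanes polar to `x` and `y`. -/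
structure IsCommonNode {K : Type*} [Field K] (x y p : Fin 6 → K) : Prop where
  sum_eq : ∑ i, p i = 0
  ne_zero : p ≠ 0
  polar_left : igusaPolar x p = 0
  polar_right : igusaPolar y p = 0
  value_eq : igusaValue p = 0
  conic_eq : conicValue x y p = 0
  singular : ∀ v, ∑ i, v i = 0 → igusaPolar p v = 0
  nondegenerate_left : ∀ u, ∑ i, u i = 0 → igusaPolar x u = 0 →
    (∀ w, ∑ i, w i = 0 → igusaPolar x w = 0 → igusaHessian p u w = 0) → ∃ c : K, u = c • p
  nondegenerate_right : ∀ u, ∑ i, u i = 0 → igusaPolar y u = 0 →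
    (∀ w, ∑ i, w i = 0 → igusaPolar y w = 0 → igusaHessian p u w = 0) → ∃ c : K, u = c • p
  ne_left : ∀ c : K, p ≠ c • x
  ne_right : ∀ c : K, p ≠ c • y

/-! ### The plane polar to two general points, its conic and the common nodes. -/

namespace IsGeneralPoint

variable {K : Type*} [Field K] {x y : Fin 6 → K}

theorem igusaPolar_eq_zero_iff (h2 : (2 : K) ≠ 0) (h3 : (3 : K) ≠ 0) {v : Fin 6 → K}
    (hv : ∑ i, v i = 0) : igusaPolar x v = 0 ↔ ∑ i, gauss x i * v i = 0 := by
  refine ⟨sum_gauss_mul h2 hv, fun h => (mul_eq_zero.1 (?_ : 3 * _ = (0 : K))).resolve_left h3⟩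
  rw [three_mul_igusaPolar x v hv, h, mul_zero]

theorem exists_igusaPolar_eq (h2 : (2 : K) ≠ 0) (h3 : (3 : K) ≠ 0)
    (hx : IsGeneralPoint x) (hy : IsGeneralPoint y) (hxy : igusaPolar x y = 0)
    (hyx : igusaPolar y x = 0) (hne : ∀ c : K, y ≠ c • x) (a b : K) :
    ∃ v, ∑ i, v i = 0 ∧ igusaPolar x v = a ∧ igusaPolar y v = b := by
  have h4 : (4 : K) ≠ 0 := by
    rw [show (4 : K) = 2 * 2 by norm_num]; exact mul_ne_zero h2 h2
  obtain ⟨v, hv, h5, h6⟩ := (hx.isSegreLine h2 h3 hy hxy hyx hne).exists_sum_mul_eq h2 h3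
    (-(3 / 4) * a) (-(3 / 4) * b)
  refine ⟨v, hv, mul_left_cancel₀ h3 ?_, mul_left_cancel₀ h3 ?_⟩
  · rw [three_mul_igusaPolar x v hv, h5]; field_simp
  · rw [three_mul_igusaPolar y v hv, h6]; field_simp

/-- The points of the plane polar to `x` and `y`. -/
theorem mem_plane_iff [IsAlgClosed K] (h2 : (2 : K) ≠ 0) (h3 : (3 : K) ≠ 0)
    (hx : IsGeneralPoint x) (hy : IsGeneralPoint y) (hxy : igusaPolar x y = 0)
    (hyx : igusaPolar y x = 0) (hne : ∀ c : K, y ≠ c • x) (v : Fin 6 → K) :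
    (∑ i, v i = 0 ∧ igusaPolar x v = 0 ∧ igusaPolar y v = 0) ↔
      ∃ X Y Z, v = squares (gauss x) (gauss y) X Y Z := by
  have h := hx.isSegreLine h2 h3 hy hxy hyx hne
  constructor
  · rintro ⟨hv, h5, h6⟩
    exact h.exists_eq_squares h2 h3 v hv (sum_gauss_mul h2 hv h5) (sum_gauss_mul h2 hv h6)
  · rintro ⟨X, Y, Z, rfl⟩
    have hv := sum_squares (gauss x) (gauss y) X Y Z
    exact ⟨hv, (igusaPolar_eq_zero_iff h2 h3 hv).2 (h.sum_left_mul_squares X Y Z),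
      (igusaPolar_eq_zero_iff h2 h3 hv).2 (h.sum_right_mul_squares X Y Z)⟩

/-- If $\kappa=0$, all second derivatives within the plane vanish, in particular those at $x$ in the
direction $y$, against `igusaHessian_squares_ne_zero`. -/
theorem exists_igusaValue_squares [IsAlgClosed K] (h2 : (2 : K) ≠ 0) (h3 : (3 : K) ≠ 0)
    (hx : IsGeneralPoint x) (hy : IsGeneralPoint y) (hxy : igusaPolar x y = 0)
    (hyx : igusaPolar y x = 0) (hne : ∀ c : K, y ≠ c • x) :
    ∃ κ : K, κ ≠ 0 ∧ ∀ X Y Z, igusaValue (squares (gauss x) (gauss y) X Y Z) =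
      κ * (Y ^ 2 - 4 * X * Z) ^ 2 := by
  have h := hx.isSegreLine h2 h3 hy hxy hyx hne
  obtain ⟨κ, hκ⟩ := h.igusaValue_squares h2 h3
  refine ⟨κ, fun h0 => ?_, hκ⟩
  obtain ⟨X, Y, Z, hXYZ⟩ := hx.igusaHessian_squares_ne_zero h2 h3 hy hxy hyx hne
  obtain ⟨X₁, Y₁, Z₁, h1⟩ := (hx.mem_plane_iff h2 h3 hy hxy hyx hne x).1
    ⟨hx.sum_eq, by rw [igusaPolar_self, hx.value_eq, mul_zero], hyx⟩
  obtain ⟨X₂, Y₂, Z₂, h2'⟩ := (hx.mem_plane_iff h2 h3 hy hxy hyx hne y).1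
    ⟨hy.sum_eq, hxy, by rw [igusaPolar_self, hy.value_eq, mul_zero]⟩
  apply hXYZ
  have := igusaHessian_squares h2 hκ X₁ Y₁ Z₁ X₂ Y₂ Z₂ X Y Z
  rw [← h1, ← h2', h0] at this
  rw [this]; ring

/-- Let $Q=Y^2-4XZ$, with polar form $B$, and $b=B(x,y)$. The second derivative of $\kappa Q^2$ at
$u$ is $2\kappa(B(u,v)B(u,w)+Q(u)B(v,w))$. Since $Q(x)=Q(y)=0$, the products $B(v,x)B(v,y)$ cancel
in `conicValue` and a multiple of $Q(v)$ remains. -/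
theorem exists_conicValue_squares [IsAlgClosed K] (h2 : (2 : K) ≠ 0) (h3 : (3 : K) ≠ 0)
    (hx : IsGeneralPoint x) (hy : IsGeneralPoint y) (hxy : igusaPolar x y = 0)
    (hyx : igusaPolar y x = 0) (hne : ∀ c : K, y ≠ c • x) :
    ∃ κ b : K, κ ≠ 0 ∧ b ≠ 0 ∧ (∀ X Y Z, igusaValue (squares (gauss x) (gauss y) X Y Z) =
      κ * (Y ^ 2 - 4 * X * Z) ^ 2) ∧ igusaHessian x y y = 2 * κ * b ^ 2 ∧
      ∀ X Y Z, conicValue x y (squares (gauss x) (gauss y) X Y Z) =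
        4 * κ ^ 2 * b ^ 3 * (Y ^ 2 - 4 * X * Z) := by
  obtain ⟨κ, hκ0, hκ⟩ := hx.exists_igusaValue_squares h2 h3 hy hxy hyx hne
  obtain ⟨D, hD0, hD⟩ := hx.mixed_gauss h2 h3
  obtain ⟨D', hD0', hD'⟩ := hy.mixed_gauss h2 h3
  have h4 : (-4 : K) ≠ 0 := by
    rw [show (-4 : K) = -(2 * 2) by norm_num]; exact neg_ne_zero.2 (mul_ne_zero h2 h2)
  have ex : x = squares (gauss x) (gauss y) (1 / D) 0 0 := by
    ext i; simp only [squares, hD]; field_simp; ring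
  have ey : y = squares (gauss x) (gauss y) 0 0 (1 / D') := by
    ext i; simp only [squares, hD']; field_simp; ring
  have hH := fun X Y Z X' Y' Z' X'' Y'' Z'' => igusaHessian_squares (α := gauss x) (β := gauss y)
    h2 hκ X Y Z X' Y' Z' X'' Y'' Z''
  have hb : igusaHessian x y y = 2 * κ * (-4 / (D * D')) ^ 2 := by
    have := hH (1 / D) 0 0 0 0 (1 / D') 0 0 (1 / D')
    rw [← ex, ← ey] at this
    rw [this]; field_simp; ring
  refine ⟨κ, -4 / (D * D'), hκ0, div_ne_zero h4 (mul_ne_zero hD0 hD0'), hκ, hb, fun X Y Z => ?_⟩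
  have e1 := hH X Y Z (1 / D) 0 0 0 0 (1 / D')
  have e2 := hH (1 / D) 0 0 0 0 (1 / D') X Y Z
  have e3 := hH 0 0 (1 / D') (1 / D) 0 0 X Y Z
  rw [← ex, ← ey] at e1 e2 e3
  rw [conicValue, hb, e1, e2, e3]
  field_simp
  ring

theorem igusaHessian_ne_zero [IsAlgClosed K] (h2 : (2 : K) ≠ 0) (h3 : (3 : K) ≠ 0)
    (hx : IsGeneralPoint x) (hy : IsGeneralPoint y) (hxy : igusaPolar x y = 0)
    (hyx : igusaPolar y x = 0) (hne : ∀ c : K, y ≠ c • x) : igusaHessian x y y ≠ 0 := by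
  obtain ⟨κ, b, hκ0, hb0, hκ, hb, hq⟩ := hx.exists_conicValue_squares h2 h3 hy hxy hyx hne
  rw [hb]
  exact mul_ne_zero (mul_ne_zero h2 hκ0) (pow_ne_zero 2 hb0)

/-- The section of the quartic by the plane polar to `x` and `y` is a double conic. -/
theorem two_mul_cube_mul_igusaValue [IsAlgClosed K] (h2 : (2 : K) ≠ 0) (h3 : (3 : K) ≠ 0)
    (hx : IsGeneralPoint x) (hy : IsGeneralPoint y) (hxy : igusaPolar x y = 0)
    (hyx : igusaPolar y x = 0) (hne : ∀ c : K, y ≠ c • x) (v : Fin 6 → K) (hv : ∑ i, v i = 0)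
    (hxv : igusaPolar x v = 0) (hyv : igusaPolar y v = 0) :
    2 * igusaHessian x y y ^ 3 * igusaValue v = conicValue x y v ^ 2 := by
  obtain ⟨κ, b, hκ0, hb0, hκ, hb, hq⟩ := hx.exists_conicValue_squares h2 h3 hy hxy hyx hne
  obtain ⟨X, Y, Z, rfl⟩ := (hx.mem_plane_iff h2 h3 hy hxy hyx hne v).1 ⟨hv, hxv, hyv⟩
  rw [hb, hκ, hq]
  ring

/-- Additivity at $w$ says that $w$ is in the radical of the polar form of $Y^2-4XZ$, which is
trivial in characteristic different from 2. -/
theorem eq_zero_of_conicValue_add [IsAlgClosed K] (h2 : (2 : K) ≠ 0) (h3 : (3 : K) ≠ 0)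
    (hx : IsGeneralPoint x) (hy : IsGeneralPoint y) (hxy : igusaPolar x y = 0)
    (hyx : igusaPolar y x = 0) (hne : ∀ c : K, y ≠ c • x) (w : Fin 6 → K) (hw : ∑ i, w i = 0)
    (hxw : igusaPolar x w = 0) (hyw : igusaPolar y w = 0)
    (h : ∀ v, ∑ i, v i = 0 → igusaPolar x v = 0 → igusaPolar y v = 0 →
      conicValue x y (w + v) = conicValue x y w + conicValue x y v) : w = 0 := by
  obtain ⟨κ, b, hκ0, hb0, hκ, hb, hq⟩ := hx.exists_conicValue_squares h2 h3 hy hxy hyx hne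
  obtain ⟨X, Y, Z, rfl⟩ := (hx.mem_plane_iff h2 h3 hy hxy hyx hne w).1 ⟨hw, hxw, hyw⟩
  have key : ∀ X' Y' Z' : K, 2 * Y * Y' - 4 * X * Z' - 4 * Z * X' = 0 := fun X' Y' Z' => by
    have hm := (hx.mem_plane_iff h2 h3 hy hxy hyx hne _).2 ⟨X', Y', Z', rfl⟩
    have := h _ hm.1 hm.2.1 hm.2.2
    have hadd : squares (gauss x) (gauss y) X Y Z + squares (gauss x) (gauss y) X' Y' Z' =
        squares (gauss x) (gauss y) (X + X') (Y + Y') (Z + Z') := by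
      ext i; simp only [squares, Pi.add_apply]; ring
    rw [hadd, hq, hq, hq] at this
    have h4 : (4 : K) ≠ 0 := by
      rw [show (4 : K) = 2 * 2 by norm_num]; exact mul_ne_zero h2 h2
    refine (mul_eq_zero.1 (?_ : 4 * κ ^ 2 * b ^ 3 * _ = 0)).resolve_left
      (mul_ne_zero (mul_ne_zero h4 (pow_ne_zero 2 hκ0)) (pow_ne_zero 3 hb0))
    linear_combination this
  have hX : X = 0 := by
    refine (mul_eq_zero.1 (?_ : 2 * 2 * X = 0)).resolve_left (mul_ne_zero h2 h2)
    linear_combination -key 0 0 1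
  have hY : Y = 0 := by
    refine (mul_eq_zero.1 (?_ : 2 * Y = 0)).resolve_left h2
    linear_combination key 0 1 0
  have hZ : Z = 0 := by
    refine (mul_eq_zero.1 (?_ : 2 * 2 * Z = 0)).resolve_left (mul_ne_zero h2 h2)
    linear_combination -key 1 0 0
  ext i
  simp [squares, hX, hY, hZ]

theorem isCommonNode [IsAlgClosed K] (h2 : (2 : K) ≠ 0) (h3 : (3 : K) ≠ 0)
    (hx : IsGeneralPoint x) (hy : IsGeneralPoint y) (hxy : igusaPolar x y = 0)
    (hyx : igusaPolar y x = 0) (hne : ∀ c : K, y ≠ c • x) (j : Fin 6) (hj : 0 ≠ j) :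
    IsCommonNode x y (mixed (nodeLine (gauss x) (gauss y) j) (nodeLine (gauss x) (gauss y) j)) := by
  obtain ⟨κ, b, hκ0, hb0, hκ, hb, hq⟩ := hx.exists_conicValue_squares h2 h3 hy hxy hyx hne
  have h := hx.isSegreLine h2 h3 hy hxy hyx hne
  obtain ⟨D, hD0, hD⟩ := hx.mixed_gauss h2 h3
  obtain ⟨D', hD0', hD'⟩ := hy.mixed_gauss h2 h3
  have hmem := (hx.mem_plane_iff h2 h3 hy hxy hyx hne _).2
    ⟨_, _, _, IsSegreLine.mixed_nodeLine (gauss x) (gauss y) j⟩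
  -- The vectors $n$ and $n'$ complete the plane to the tangent spaces at $x$ and at $y$.
  obtain ⟨n, hn, hαn, hβn⟩ := h.exists_sum_mul_eq h2 h3 0 1
  obtain ⟨n', hn', hαn', hβn'⟩ := h.exists_sum_mul_eq h2 h3 1 0
  have hplane := fun X Y Z => (hx.mem_plane_iff h2 h3 hy hxy hyx hne _).2 ⟨X, Y, Z, rfl⟩
  have hleft : ∀ c : K, mixed (nodeLine (gauss x) (gauss y) j) (nodeLine (gauss x) (gauss y) j) ≠
      c • x := fun c hc => by
    refine h.mixed_nodeLine_ne_smul_left h2 h3 j hj (c / D) (hc.trans ?_)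
    ext i
    rw [hD, Pi.smul_apply, smul_eq_mul]
    field_simp
  refine ⟨hmem.1, fun h0 => hleft 0 (by rw [h0, zero_smul]), hmem.2.1, hmem.2.2, ?_, ?_,
    h.igusaPolar_node h3 j hj, fun u hu hxu huw => ?_, fun u hu hyu huw => ?_, hleft,
    fun c hc => ?_⟩
  · rw [IsSegreLine.mixed_nodeLine, hκ]; ring
  · rw [IsSegreLine.mixed_nodeLine, hq]; ring
  · exact h.eq_smul_node h2 h3 hκ0 hκ j hj u n hu
      (Or.inl ⟨sum_gauss_mul h2 hu hxu, hαn, hβn⟩) hn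
      (fun X Y Z => huw _ (hplane X Y Z).1 (hplane X Y Z).2.1)
      (huw n hn ((igusaPolar_eq_zero_iff h2 h3 hn).2 hαn))
  · exact h.eq_smul_node h2 h3 hκ0 hκ j hj u n' hu
      (Or.inr ⟨sum_gauss_mul h2 hu hyu, hβn', hαn'⟩) hn'
      (fun X Y Z => huw _ (hplane X Y Z).1 (hplane X Y Z).2.2)
      (huw n' hn' ((igusaPolar_eq_zero_iff h2 h3 hn').2 hβn'))
  · refine h.mixed_nodeLine_ne_smul_right h2 h3 j hj (c / D') (hc.trans ?_)
    ext i
    rw [hD', Pi.smul_apply, smul_eq_mul]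
    field_simp

theorem exists_isCommonNode [IsAlgClosed K] (h2 : (2 : K) ≠ 0) (h3 : (3 : K) ≠ 0)
    (hx : IsGeneralPoint x) (hy : IsGeneralPoint y) (hxy : igusaPolar x y = 0)
    (hyx : igusaPolar y x = 0) (hne : ∀ c : K, y ≠ c • x) :
    ∃ p : Fin 5 → Fin 6 → K, (∀ j, IsCommonNode x y (p j)) ∧
      ∀ i j, i ≠ j → ∀ c : K, p j ≠ c • p i := by
  refine ⟨fun j => mixed (nodeLine (gauss x) (gauss y) j.succ) (nodeLine (gauss x) (gauss y) j.succ),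
    fun j => hx.isCommonNode h2 h3 hy hxy hyx hne _ (Fin.succ_ne_zero j).symm,
    fun i j hij c => ?_⟩
  exact (hx.isSegreLine h2 h3 hy hxy hyx hne).mixed_nodeLine_ne_smul h2 h3 _ _
    (Fin.succ_ne_zero i).symm (Fin.succ_ne_zero j).symm (fun h => hij (Fin.succ_injective _ h)) c

end IsGeneralPoint

open MvPolynomial

/-! ### Linear ideals -/

section LinearIdeals

variable {K : Type*} [Field K]

/-- The linear form with given coefficients. -/
def linearForm (c : Fin 5 → K) : MvPolynomial (Fin 5) K := ∑ i, C (c i) * X i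

theorem linearForm_mem_linearIdeal {W : Submodule K (Fin 5 → K)} {c : Fin 5 → K}
    (hc : ∀ w ∈ W, ∑ i, c i * w i = 0) : linearForm c ∈ linearIdeal W :=
  Ideal.subset_span ⟨c, hc, rfl⟩

theorem linearIdeal_anti {W W' : Submodule K (Fin 5 → K)} (h : W ≤ W') :
    linearIdeal W' ≤ linearIdeal W :=
  Ideal.span_mono fun _ ⟨c, hc, hl⟩ => ⟨c, fun w hw => hc w (h hw), hl⟩

/-- A functional that vanishes on the intersection of two hyperplanes is a combination of their
equations. -/
theorem exists_eq_comb (f g : Module.Dual K (Fin 5 → K)) (l : Module.Dual K (Fin 5 → K))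
    (hl : ∀ w ∈ LinearMap.ker f ⊓ LinearMap.ker g, l w = 0) :
    ∃ p q : K, l = p • f + q • g := by
  have hmem : l ∈ Submodule.span K (Set.range ![f, g]) := by
    refine mem_span_of_iInf_ker_le_ker fun v hv => ?_
    simp only [Submodule.mem_iInf] at hv
    exact hl v ⟨hv 0, hv 1⟩
  rw [Submodule.mem_span_range_iff_exists_fun] at hmem
  obtain ⟨c, hc⟩ := hmem
  exact ⟨c 0, c 1, by simpa [Fin.sum_univ_two] using hc.symm⟩

theorem dual_apply (f : Module.Dual K (Fin 5 → K)) (w : Fin 5 → K) :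
    f w = ∑ i, f (Pi.single i 1) * w i := by
  conv_lhs => rw [← Finset.univ_sum_single w, map_sum]
  refine Finset.sum_congr rfl fun i _ => ?_
  rw [show Pi.single i (w i) = w i • (Pi.single i (1 : K) : Fin 5 → K) by
    rw [← Pi.single_smul, smul_eq_mul, mul_one], map_smul, smul_eq_mul, mul_comm]

theorem linearIdeal_inf_ker (f g : Module.Dual K (Fin 5 → K)) :
    linearIdeal (LinearMap.ker f ⊓ LinearMap.ker g) =
      linearIdeal (LinearMap.ker f) ⊔ linearIdeal (LinearMap.ker g) := by
  refine le_antisymm ?_ (sup_le (linearIdeal_anti inf_le_left) (linearIdeal_anti inf_le_right))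
  refine Ideal.span_le.2 ?_
  rintro _ ⟨c, hc, rfl⟩
  obtain ⟨p, q, hpq⟩ := exists_eq_comb f g (∑ i, c i • LinearMap.proj i) fun w hw => by
    simpa using hc w hw
  have hf : linearForm (fun i => f (Pi.single i 1)) ∈ linearIdeal (LinearMap.ker f) :=
    linearForm_mem_linearIdeal fun w hw => by rw [← dual_apply]; exact hw
  have hg : linearForm (fun i => g (Pi.single i 1)) ∈ linearIdeal (LinearMap.ker g) :=
    linearForm_mem_linearIdeal fun w hw => by rw [← dual_apply]; exact hw
  have hcoef : ∀ i, c i = p * f (Pi.single i 1) + q * g (Pi.single i 1) := fun i => by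
    simpa [Pi.single_apply] using congrArg (fun l => l (Pi.single i 1)) hpq
  have : ∑ i, C (c i) * X i = C p * linearForm (fun i => f (Pi.single i 1))
      + C q * linearForm (fun i => g (Pi.single i 1)) := by
    simp only [linearForm, Finset.mul_sum, ← Finset.sum_add_distrib, hcoef, map_add, map_mul]
    exact Finset.sum_congr rfl fun i _ => by ring
  rw [this]
  exact Ideal.add_mem _ (Ideal.mul_mem_left _ _ (Ideal.mem_sup_left hf))
    (Ideal.mul_mem_left _ _ (Ideal.mem_sup_right hg))

theorem finrank_ker_of_ne_zero {f : Module.Dual K (Fin 5 → K)} (hf : f ≠ 0) :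
    Module.finrank K (LinearMap.ker f) = 4 := by
  have := Module.Dual.finrank_ker_add_one_of_ne_zero hf
  rw [Module.finrank_fin_fun] at this
  omega

theorem finrank_inf_ker {f g : Module.Dual K (Fin 5 → K)} (hf : f ≠ 0)
    (hg : ∃ v, f v = 0 ∧ g v ≠ 0) :
    Module.finrank K ↥(LinearMap.ker f ⊓ LinearMap.ker g) = 3 := by
  obtain ⟨v, hv, hgv⟩ := hg
  have hg' : g.comp (LinearMap.ker f).subtype ≠ 0 := fun h =>
    hgv (congrArg (fun l => l ⟨v, hv⟩) h)
  have h1 := Module.Dual.finrank_ker_add_one_of_ne_zero hg'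
  rw [finrank_ker_of_ne_zero hf, LinearMap.ker_comp] at h1
  have h2 := (Submodule.comapSubtypeEquivOfLe (inf_le_left :
    LinearMap.ker f ⊓ LinearMap.ker g ≤ LinearMap.ker f)).finrank_eq
  rw [Submodule.comap_inf, Submodule.comap_subtype_self, top_inf_eq] at h2
  omega

/-- A form that vanishes, after an extension of the field, on a linear subspace is in its ideal. -/
theorem mem_linearIdeal_of_eval_eq_zero {L : Type*} [Field L] [Infinite L] [Algebra K L]
    (W : Submodule K (Fin 5 → K)) (P : MvPolynomial (Fin 5) K)
    (hP : ∀ v : Fin 5 → L, (∀ c : Fin 5 → K, (∀ w ∈ W, ∑ i, c i * w i = 0) →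
      ∑ i, algebraMap K L (c i) * v i = 0) → eval v (map (algebraMap K L) P) = 0) :
    P ∈ linearIdeal W := by
  obtain ⟨π, hπ⟩ := W.subtype.exists_leftInverse_of_injective W.ker_subtype
  obtain ⟨m, hm⟩ : ∃ m : Fin 5 → Fin 5 → K, ∀ j i, m j i = (π (Pi.single i 1) : Fin 5 → K) j :=
    ⟨_, fun _ _ => rfl⟩
  have hmv : ∀ v : Fin 5 → K, ∀ j, ∑ i, m j i * v i = (π v : Fin 5 → K) j := fun v j => by
    have := dual_apply ((LinearMap.proj j).comp (W.subtype.comp π)) v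
    simpa [hm] using this.symm
  have hX : ∀ j, X j - linearForm (m j) ∈ linearIdeal W := fun j => by
    have : X j - linearForm (m j) = linearForm fun i => (if i = j then 1 else 0) - m j i := by
      simp [linearForm, sub_mul, Finset.sum_sub_distrib]
    rw [this]
    refine linearForm_mem_linearIdeal fun w hw => ?_
    have h1 : (π w : Fin 5 → K) = w := congrArg Subtype.val (LinearMap.congr_fun hπ ⟨w, hw⟩)
    simp only [sub_mul, Finset.sum_sub_distrib, hmv, h1]
    simp
  -- Modulo the linear ideal each coordinate equals its composite with the projection $\pi$ onto
  -- $W$, so $P\equiv P\circ\pi$.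
  have hsub : P - bind₁ (fun j => linearForm (m j)) P ∈ linearIdeal W := by
    rw [← Ideal.Quotient.eq]
    have : (Ideal.Quotient.mkₐ K (linearIdeal W)) =
        (Ideal.Quotient.mkₐ K (linearIdeal W)).comp (bind₁ fun j => linearForm (m j)) := by
      refine algHom_ext fun j => ?_
      rw [AlgHom.comp_apply, bind₁_X_right]
      exact Ideal.Quotient.eq.2 (hX j)
    exact congrArg (fun g => g P) this
  -- $P\circ\pi$ vanishes at all points over the infinite field $L$, so it is the zero polynomial.
  have hzero : bind₁ (fun j => linearForm (m j)) P = 0 := by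
    apply map_injective (algebraMap K L) (algebraMap K L).injective
    rw [map_zero]
    refine MvPolynomial.funext fun v => ?_
    rw [map_zero, map_bind₁]
    refine Eq.trans ?_ (hP (fun j => ∑ i, algebraMap K L (m j i) * v i) fun c hc => ?_)
    · refine (eval₂Hom_bind₁ (RingHom.id L) v _ _).trans ?_
      congr 2
      ext j
      simp [linearForm]
    · have : ∀ i, ∑ j, c j * m j i = 0 := fun i => by
        simpa [hm] using hc (π (Pi.single i 1)) (Submodule.coe_mem _)
      simp only [Finset.mul_sum, ← mul_assoc, ← map_mul]
      rw [Finset.sum_comm]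
      simp only [← Finset.sum_mul, ← map_sum, this, map_zero, zero_mul, Finset.sum_const_zero]
  rw [hzero, sub_zero] at hsub
  exact hsub

end LinearIdeals

/-! ### Quadratic forms -/

section Quadrics

variable {K : Type*} [Field K]

theorem polar_apply (F : MvPolynomial (Fin 5) K) (a b : Fin 5 → K) :
    polar F a b = ∑ i, eval a (pderiv i F) * b i := by
  simp [polar]

/-- Checked on monomials $X_iX_j$, which avoids division by 2. It turns nonsingularity, stated with
`polar`, into a statement about values. -/
theorem eval_add_of_isHomogeneous_two {q : MvPolynomial (Fin 5) K} (hq : q.IsHomogeneous 2)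
    (w v : Fin 5 → K) : eval (w + v) q = eval w q + eval v q + polar q w v := by
  rw [polar_apply]
  have key : ∀ d ∈ q.support, eval (w + v) (monomial d (q.coeff d)) =
      eval w (monomial d (q.coeff d)) + eval v (monomial d (q.coeff d)) +
        ∑ i, eval w (pderiv i (monomial d (q.coeff d))) * v i := by
    intro d hd
    have hdeg : d.degree = 2 := by
      have := hq (mem_support_iff.1 hd)
      rw [Finsupp.degree_eq_weight_one]
      exact this
    obtain ⟨i, j, rfl⟩ : ∃ i j, d = Finsupp.single i 1 + Finsupp.single j 1 := by
      have hc : Multiset.card (Finsupp.toMultiset d) = 2 := by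
        rw [Finsupp.card_toMultiset, ← hdeg]; rfl
      obtain ⟨i, j, hij⟩ := Multiset.card_eq_two.1 hc
      refine ⟨i, j, ?_⟩
      rw [← Finsupp.toMultiset_toFinsupp d, hij, Multiset.insert_eq_cons, ← Multiset.singleton_add,
        Multiset.toFinsupp_add, Multiset.toFinsupp_singleton, Multiset.toFinsupp_singleton]
    have : (monomial (Finsupp.single i 1 + Finsupp.single j 1) (q.coeff
        (Finsupp.single i 1 + Finsupp.single j 1)) : MvPolynomial (Fin 5) K) =
        C (q.coeff (Finsupp.single i 1 + Finsupp.single j 1)) * (X i * X j) := by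
      rw [X, X, monomial_mul, C_mul_monomial]; simp
    rw [this]
    simp only [map_mul, eval_C, eval_X, Pi.add_apply, Derivation.leibniz, pderiv_C, pderiv_X,
      smul_eq_mul, map_add, mul_zero, add_zero, add_mul, Finset.sum_add_distrib, mul_add]
    simp [Pi.single_apply, Finset.sum_ite_eq]
    ring
  conv_lhs => rw [q.as_sum, map_sum, Finset.sum_congr rfl key]
  rw [Finset.sum_add_distrib, Finset.sum_add_distrib, Finset.sum_comm]
  conv_rhs => rw [q.as_sum]
  simp only [map_sum, Finset.sum_mul]

end Quadrics

/-! ### Igusa quartics in five coordinates -/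

section Model

variable {L : Type*} [Field L]

/-- The linear map `Ψ` onto the vectors with coordinate sum zero identifies the quartic form `G`
and its derivatives, up to the constant `c`, with the standard form. -/
structure IsIgusaModel (G : MvPolynomial (Fin 5) L) (Ψ : (Fin 5 → L) →ₗ[L] (Fin 6 → L))
    (c : L) : Prop where
  ne_zero : c ≠ 0
  eval_eq : ∀ v, eval v G = c * igusaValue (Ψ v)
  polar_eq : ∀ u v, polar G u v = c * igusaPolar (Ψ u) (Ψ v)
  hessian_eq : ∀ u v w, hessian G u v w = c * igusaHessian (Ψ u) (Ψ v) (Ψ w)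
  sum_eq : ∀ v, ∑ i, Ψ v i = 0
  injective : Function.Injective Ψ
  surjective : ∀ w : Fin 6 → L, ∑ i, w i = 0 → ∃ v, Ψ v = w

theorem bind₁_igusaForm (ℓ : Fin 6 → MvPolynomial (Fin 5) L) :
    bind₁ ℓ (igusaForm L) = (∑ j, ℓ j ^ 2) ^ 2 - 4 * ∑ j, ℓ j ^ 4 := by
  simp [igusaForm, map_sum, map_ofNat]

theorem pderiv_bind₁_igusaForm (M : Fin 6 → Fin 5 → L) (i : Fin 5) :
    pderiv i (bind₁ (fun j => linearForm (M j)) (igusaForm L)) =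
      4 * (∑ j, linearForm (M j) ^ 2) * (∑ j, linearForm (M j) * C (M j i))
        - 16 * ∑ j, linearForm (M j) ^ 3 * C (M j i) := by
  have hl : ∀ j, pderiv i (linearForm (M j)) = C (M j i) := fun j => by
    simp [linearForm, pderiv_X, Pi.single_apply]
  have h2 : ∀ j, pderiv i (linearForm (M j) ^ 2) = 2 * (linearForm (M j) * C (M j i)) := fun j => by
    rw [Derivation.leibniz_pow, hl]
    simp only [smul_eq_mul, nsmul_eq_mul]
    push_cast
    ring
  have h4 : ∀ j, pderiv i (linearForm (M j) ^ 4) = 4 * (linearForm (M j) ^ 3 * C (M j i)) :=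
    fun j => by
      rw [Derivation.leibniz_pow, hl]
      simp only [smul_eq_mul, nsmul_eq_mul]
      push_cast
      ring
  have hofNat : pderiv i (4 : MvPolynomial (Fin 5) L) = 0 := by
    rw [← map_ofNat (C : L →+* MvPolynomial (Fin 5) L)]
    exact pderiv_C
  rw [bind₁_igusaForm, map_sub, Derivation.leibniz, Derivation.leibniz_pow, map_sum, map_sum,
    Finset.sum_congr rfl fun j _ => h2 j, Finset.sum_congr rfl fun j _ => h4 j, hofNat,
    ← Finset.mul_sum, ← Finset.mul_sum]
  simp only [smul_eq_mul, nsmul_eq_mul]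
  push_cast
  ring

theorem pderiv_pderiv_bind₁_igusaForm (M : Fin 6 → Fin 5 → L) (i i' : Fin 5) :
    pderiv i' (pderiv i (bind₁ (fun j => linearForm (M j)) (igusaForm L))) =
      8 * (∑ j, linearForm (M j) * C (M j i')) * (∑ j, linearForm (M j) * C (M j i))
        + 4 * (∑ j, linearForm (M j) ^ 2) * (∑ j, C (M j i') * C (M j i))
        - 48 * ∑ j, linearForm (M j) ^ 2 * C (M j i') * C (M j i) := by
  have hl : ∀ j, pderiv i' (linearForm (M j)) = C (M j i') := fun j => by
    simp [linearForm, pderiv_X, Pi.single_apply]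
  have h2 : ∀ j, pderiv i' (linearForm (M j) ^ 2) = 2 * (linearForm (M j) * C (M j i')) :=
    fun j => by
      rw [Derivation.leibniz_pow, hl]
      simp only [smul_eq_mul, nsmul_eq_mul]
      push_cast
      ring
  have h1 : ∀ j, pderiv i' (linearForm (M j) * C (M j i)) = C (M j i') * C (M j i) :=
    fun j => by
      rw [Derivation.leibniz, hl, pderiv_C]
      simp only [smul_eq_mul]
      ring
  have h3 : ∀ j, pderiv i' (linearForm (M j) ^ 3 * C (M j i)) =
      3 * (linearForm (M j) ^ 2 * C (M j i') * C (M j i)) :=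
    fun j => by
      rw [Derivation.leibniz, Derivation.leibniz_pow, hl, pderiv_C]
      simp only [smul_eq_mul, nsmul_eq_mul]
      push_cast
      ring
  have hofNat : ∀ n : ℕ, pderiv i' ((OfNat.ofNat (n + 2) : MvPolynomial (Fin 5) L)) = 0 := fun n => by
    rw [← map_ofNat (C : L →+* MvPolynomial (Fin 5) L)]
    exact pderiv_C
  rw [pderiv_bind₁_igusaForm, map_sub, Derivation.leibniz, Derivation.leibniz, Derivation.leibniz,
    map_sum, map_sum, map_sum,
    Finset.sum_congr rfl fun j _ => h2 j, Finset.sum_congr rfl fun j _ => h1 j,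
    Finset.sum_congr rfl fun j _ => h3 j, hofNat 2, hofNat 14,
    ← Finset.mul_sum, ← Finset.mul_sum]
  simp only [smul_eq_mul]
  ring

theorem sum_sum_hessian (A B : Fin 5 → L) (V W : Fin 6 → Fin 5 → L) (x : Fin 6 → L) (s : L) :
    ∑ i, ∑ j, (8 * A i * B j + 4 * s * (∑ m, V m i * W m j) - 48 * ∑ m, x m * V m i * W m j) =
      8 * (∑ i, A i) * (∑ j, B j) + 4 * s * (∑ m, (∑ i, V m i) * ∑ j, W m j)
        - 48 * ∑ m, x m * (∑ i, V m i) * ∑ j, W m j := by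
  simp only [Fin.sum_univ_five, Fin.sum_univ_six]
  ring

theorem isIgusaModel_of_matrix (M : Fin 6 → Fin 5 → L) (c : L) (hc : c ≠ 0)
    (hsum : ∀ i, ∑ j, M j i = 0)
    (hinj : ∀ v : Fin 5 → L, (∀ j, ∑ i, M j i * v i = 0) → v = 0) :
    IsIgusaModel (C c * bind₁ (fun j => linearForm (M j)) (igusaForm L))
      (Matrix.of M).mulVecLin c := by
  have happ : ∀ v j, (Matrix.of M).mulVecLin v j = ∑ i, M j i * v i := fun v j => by
    simp [Matrix.mulVec, dotProduct]
  have heval : ∀ v j, eval v (linearForm (M j)) = (Matrix.of M).mulVecLin v j := fun v j => by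
    simp [linearForm, Matrix.mulVec, dotProduct]
  have hsum0 : ∀ v, ∑ j, (Matrix.of M).mulVecLin v j = 0 := fun v => by
    simp only [happ]
    rw [Finset.sum_comm]
    simp only [← Finset.sum_mul, hsum, zero_mul, Finset.sum_const_zero]
  have hinj' : Function.Injective (Matrix.of M).mulVecLin := by
    rw [injective_iff_map_eq_zero]
    intro v hv
    exact hinj v fun j => by rw [← happ, hv]; rfl
  refine ⟨hc, fun v => ?_, fun u v => ?_, fun u v w => ?_, hsum0, hinj', ?_⟩
  · rw [map_mul, eval_C, bind₁_igusaForm]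
    simp only [map_sub, map_mul, map_pow, map_sum, map_ofNat, heval, igusaValue]
  · have : ∀ i, eval u (pderiv i (C c * bind₁ (fun j => linearForm (M j)) (igusaForm L))) * v i =
        c * (4 * (∑ j, (Matrix.of M).mulVecLin u j ^ 2)
          * (∑ j, (Matrix.of M).mulVecLin u j * (M j i * v i))
          - 16 * ∑ j, (Matrix.of M).mulVecLin u j ^ 3 * (M j i * v i)) := fun i => by
      rw [pderiv_C_mul, pderiv_bind₁_igusaForm]
      simp only [map_sub, map_mul, map_pow, map_sum, map_ofNat, heval, eval_C]
      simp only [← mul_assoc, ← Finset.sum_mul]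
      ring
    rw [polar_apply, Finset.sum_congr rfl fun i _ => this i, ← Finset.mul_sum,
      Finset.sum_sub_distrib, ← Finset.mul_sum, ← Finset.mul_sum, Finset.sum_comm, igusaPolar,
      Finset.sum_comm (f := fun i j => (Matrix.of M).mulVecLin u j ^ 3 * (M j i * v i))]
    simp only [← Finset.mul_sum, ← happ]
  · have : ∀ i j, eval u (pderiv i (pderiv j
        (C c * bind₁ (fun j => linearForm (M j)) (igusaForm L)))) * v i * w j =
        c * (8 * (∑ m, (Matrix.of M).mulVecLin u m * (M m i * v i))
          * (∑ m, (Matrix.of M).mulVecLin u m * (M m j * w j))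
          + 4 * (∑ m, (Matrix.of M).mulVecLin u m ^ 2) * (∑ m, (M m i * v i) * (M m j * w j))
          - 48 * ∑ m, (Matrix.of M).mulVecLin u m ^ 2 * (M m i * v i) * (M m j * w j)) :=
      fun i j => by
      rw [pderiv_C_mul, pderiv_C_mul, pderiv_pderiv_bind₁_igusaForm]
      simp only [map_sub, map_add, map_mul, map_pow, map_sum, map_ofNat, heval, eval_C]
      simp only [Fin.sum_univ_six]
      ring
    rw [hessian, Finset.sum_congr rfl fun i _ => Finset.sum_congr rfl fun j _ => this i j]
    simp only [← Finset.mul_sum]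
    rw [sum_sum_hessian, Finset.sum_comm,
      Finset.sum_comm (f := fun j m => (Matrix.of M).mulVecLin u m * (M m j * w j))]
    simp only [← Finset.mul_sum, ← happ, igusaHessian]
  · intro w hw
    let s : Module.Dual L (Fin 6 → L) := ∑ i, LinearMap.proj i
    have hs : ∀ v, s v = ∑ i, v i := fun v => by simp [s]
    have hs0 : s ≠ 0 := fun h0 => by
      have := hs (Pi.single 0 1)
      rw [h0] at this
      simp at this
    have hle : LinearMap.range (Matrix.of M).mulVecLin ≤ LinearMap.ker s := by
      rintro _ ⟨v, rfl⟩
      rw [LinearMap.mem_ker, hs, hsum0]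
    -- Both spaces have dimension 5.
    have heq : LinearMap.range (Matrix.of M).mulVecLin = LinearMap.ker s := by
      refine Submodule.eq_of_le_of_finrank_eq hle ?_
      have := Module.Dual.finrank_ker_add_one_of_ne_zero hs0
      rw [LinearMap.finrank_range_of_inj hinj', Module.finrank_fin_fun]
      rw [Module.finrank_fin_fun] at this
      omega
    have hmem : w ∈ LinearMap.ker s := by rw [LinearMap.mem_ker, hs, hw]
    rwa [← heq] at hmem

end Model

/-- The conic of the section by the plane polar to `a` and `b`. -/
def conicForm {K : Type*} [Field K] (F : MvPolynomial (Fin 5) K) (a b : Fin 5 → K) :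
    MvPolynomial (Fin 5) K :=
  C (hessian F a b b) * (∑ i, ∑ j, pderiv i (pderiv j F) * C (a i) * C (b j))
    - linearForm (fun j => ∑ i, eval a (pderiv i (pderiv j F)) * b i) *
      linearForm (fun j => ∑ i, eval b (pderiv i (pderiv j F)) * a i)

/-! ### The form of the conic and its base change. -/

section Conic

variable {K : Type*} [Field K]

theorem eval_linearForm (c v : Fin 5 → K) : eval v (linearForm c) = ∑ i, c i * v i := by
  simp [linearForm]

theorem eval_conicForm (F : MvPolynomial (Fin 5) K) (a b v : Fin 5 → K) :
    eval v (conicForm F a b) = hessian F a b b * hessian F v a b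
      - hessian F a b v * hessian F b a v := by
  have h : ∀ a b : Fin 5 → K, ∑ j, (∑ i, eval a (pderiv i (pderiv j F)) * b i) * v j =
      hessian F a b v := fun a b => by
    rw [hessian, Finset.sum_comm]
    simp only [Finset.sum_mul]
  rw [conicForm, map_sub, map_mul, map_mul, eval_linearForm, eval_linearForm, h, h, eval_C]
  simp [hessian]

theorem isHomogeneous_linearForm (c : Fin 5 → K) : (linearForm c).IsHomogeneous 1 :=
  IsHomogeneous.sum _ _ _ fun i _ => isHomogeneous_C_mul_X (c i) i

theorem isHomogeneous_conicForm {F : MvPolynomial (Fin 5) K} (hF : F.IsHomogeneous 4)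
    (a b : Fin 5 → K) : (conicForm F a b).IsHomogeneous 2 := by
  refine IsHomogeneous.sub ?_ ((isHomogeneous_linearForm _).mul (isHomogeneous_linearForm _))
  refine IsHomogeneous.C_mul (IsHomogeneous.sum _ _ _ fun i _ => IsHomogeneous.sum _ _ _
    fun j _ => ?_) _
  have h := ((hF.pderiv (i := j)).pderiv (i := i)).mul (isHomogeneous_C (Fin 5) (a i))
  exact h.mul (isHomogeneous_C (Fin 5) (b j))

variable {L : Type*} [Field L] [Algebra K L]

theorem coordMap_apply (a : Fin 5 → K) (i : Fin 5) : coordMap L a i = algebraMap K L (a i) := rfl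

theorem eval_coordMap (P : MvPolynomial (Fin 5) K) (a : Fin 5 → K) :
    eval (coordMap L a) (map (algebraMap K L) P) = algebraMap K L (eval a P) :=
  (map_eval (algebraMap K L) a P).symm

theorem polar_coordMap (P : MvPolynomial (Fin 5) K) (a : Fin 5 → K) (v : Fin 5 → L) :
    polar (map (algebraMap K L) P) (coordMap L a) v =
      ∑ i, algebraMap K L (eval a (pderiv i P)) * v i := by
  simp only [polar_apply, pderiv_map, eval_coordMap]

theorem polar_coordMap_coordMap (P : MvPolynomial (Fin 5) K) (a b : Fin 5 → K) :
    polar (map (algebraMap K L) P) (coordMap L a) (coordMap L b) = algebraMap K L (polar P a b) := by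
  rw [polar_coordMap, polar_apply, map_sum]
  simp only [coordMap_apply, map_mul]

theorem hessian_coordMap (P : MvPolynomial (Fin 5) K) (a b c : Fin 5 → K) :
    hessian (map (algebraMap K L) P) (coordMap L a) (coordMap L b) (coordMap L c) =
      algebraMap K L (hessian P a b c) := by
  simp only [hessian, pderiv_map, eval_coordMap, coordMap_apply, map_sum, map_mul]

theorem map_linearForm (c : Fin 5 → K) :
    map (algebraMap K L) (linearForm c) = linearForm fun i => algebraMap K L (c i) := by
  simp [linearForm]

theorem map_conicForm (F : MvPolynomial (Fin 5) K) (a b : Fin 5 → K) :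
    map (algebraMap K L) (conicForm F a b) =
      conicForm (map (algebraMap K L) F) (coordMap L a) (coordMap L b) := by
  rw [conicForm, conicForm, hessian_coordMap, map_sub, map_mul, map_mul, map_linearForm,
    map_linearForm, map_C]
  simp only [pderiv_map, eval_coordMap, coordMap_apply, map_sum, map_mul, map_C]

end Conic

/-! ### Descent to the ground field -/

/-- Two vectors on a model of the Igusa quartic that represent distinct points outside the
exceptional locus, each in the tangent space of the other. -/
structure IsPolarPair {L : Type*} [Field L] (x y : Fin 6 → L) : Prop where
  left : IsGeneralPoint x
  right : IsGeneralPoint y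
  polar_left : igusaPolar x y = 0
  polar_right : igusaPolar y x = 0
  ne_smul : ∀ c : L, y ≠ c • x

section Descent

variable {K L : Type*} [Field K] [Field L] [Algebra K L]
  {F : MvPolynomial (Fin 5) K} {Ψ : (Fin 5 → L) →ₗ[L] (Fin 6 → L)} {c : L} {a b : Fin 5 → K}

theorem eval_conicForm_of_isIgusaModel {G : MvPolynomial (Fin 5) L} (hG : IsIgusaModel G Ψ c)
    (u v w : Fin 5 → L) :
    eval w (conicForm G u v) = c ^ 2 * conicValue (Ψ u) (Ψ v) (Ψ w) := by
  rw [eval_conicForm, hG.hessian_eq, hG.hessian_eq, hG.hessian_eq, hG.hessian_eq, conicValue]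
  ring

theorem polar_ne_zero (h2 : (2 : L) ≠ 0) (h3 : (3 : L) ≠ 0)
    (hG : IsIgusaModel (map (algebraMap K L) F) Ψ c)
    (h : IsPolarPair (Ψ (coordMap L a)) (Ψ (coordMap L b))) : polar F a ≠ 0 := by
  intro h0
  obtain ⟨w, hw, hw1, -⟩ := h.left.exists_igusaPolar_eq h2 h3 h.right h.polar_left h.polar_right
    h.ne_smul 1 0
  obtain ⟨v, rfl⟩ := hG.surjective w hw
  have hz : ∀ i, eval a (pderiv i F) = 0 := fun i => by
    have := congrArg (fun l => l (Pi.single i 1)) h0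
    simpa [polar_apply, Pi.single_apply] using this
  have := hG.polar_eq (coordMap L a) v
  rw [polar_coordMap, hw1, mul_one] at this
  simp only [hz, map_zero, zero_mul, Finset.sum_const_zero] at this
  exact hG.ne_zero this.symm

theorem exists_polar_eq_zero (h2 : (2 : L) ≠ 0) (h3 : (3 : L) ≠ 0)
    (hG : IsIgusaModel (map (algebraMap K L) F) Ψ c)
    (h : IsPolarPair (Ψ (coordMap L a)) (Ψ (coordMap L b))) :
    ∃ v, polar F a v = 0 ∧ polar F b v ≠ 0 := by
  by_contra! hcon
  -- The functional `polar F a` is used twice: vanishing on its kernel makes `polar F b` a multiple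
  -- of it.
  obtain ⟨p, q, hpq⟩ := exists_eq_comb (polar F a) (polar F a) (polar F b) fun w hw => hcon w hw.1
  obtain ⟨w, hw, hw0, hw1⟩ := h.left.exists_igusaPolar_eq h2 h3 h.right h.polar_left h.polar_right
    h.ne_smul 0 1
  obtain ⟨v, rfl⟩ := hG.surjective w hw
  have hz : ∀ i, eval b (pderiv i F) = (p + q) * eval a (pderiv i F) := fun i => by
    have := congrArg (fun l => l (Pi.single i 1)) hpq
    rw [add_mul]
    simpa [polar_apply, Pi.single_apply] using this
  have e1 := hG.polar_eq (coordMap L a) v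
  have e2 := hG.polar_eq (coordMap L b) v
  rw [polar_coordMap, hw0, mul_zero] at e1
  rw [polar_coordMap, hw1, mul_one] at e2
  simp only [hz, map_mul, mul_assoc, ← Finset.mul_sum, e1, mul_zero] at e2
  exact hG.ne_zero e2.symm

/-- The coefficients of the equations of a plane cut out the plane after base change. -/
theorem polar_eq_zero_of_forall (f : Module.Dual K (Fin 5 → K)) {v : Fin 5 → L}
    {W : Submodule K (Fin 5 → K)} (hW : W ≤ LinearMap.ker f)
    (hv : ∀ c : Fin 5 → K, (∀ w ∈ W, ∑ i, c i * w i = 0) → ∑ i, algebraMap K L (c i) * v i = 0) :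
    ∑ i, algebraMap K L (f (Pi.single i 1)) * v i = 0 :=
  hv _ fun w hw => by rw [← dual_apply]; exact hW hw

theorem polar_single (P : MvPolynomial (Fin 5) K) (a : Fin 5 → K) (i : Fin 5) :
    polar P a (Pi.single i 1) = eval a (pderiv i P) := by
  simp [polar_apply, Pi.single_apply]

/-- Membership over $K$ is tested on the points of the plane over $L$, where it is
`two_mul_cube_mul_igusaValue` times a power of $c$. -/
theorem sub_conicForm_sq_mem [IsAlgClosed L] (h2 : (2 : L) ≠ 0) (h3 : (3 : L) ≠ 0)
    (hG : IsIgusaModel (map (algebraMap K L) F) Ψ c)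
    (h : IsPolarPair (Ψ (coordMap L a)) (Ψ (coordMap L b))) :
    C (2 * hessian F a b b ^ 3) * F - conicForm F a b ^ 2 ∈
      linearIdeal (LinearMap.ker (polar F a) ⊓ LinearMap.ker (polar F b)) := by
  refine mem_linearIdeal_of_eval_eq_zero (L := L) _ _ fun v hv => ?_
  have e1 := polar_eq_zero_of_forall (polar F a) inf_le_left hv
  have e2 := polar_eq_zero_of_forall (polar F b) inf_le_right hv
  simp only [polar_single] at e1 e2
  rw [← polar_coordMap, hG.polar_eq] at e1 e2
  have key := h.left.two_mul_cube_mul_igusaValue h2 h3 h.right h.polar_left h.polar_right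
    h.ne_smul (Ψ v) (hG.sum_eq v) ((mul_eq_zero.1 e1).resolve_left hG.ne_zero)
    ((mul_eq_zero.1 e2).resolve_left hG.ne_zero)
  simp only [map_sub, map_mul, map_pow, map_conicForm, map_C, eval_C, ← hessian_coordMap,
    hG.hessian_eq, hG.eval_eq, eval_conicForm_of_isIgusaModel hG, map_ofNat]
  linear_combination c ^ 4 * key

theorem hessian_ne_zero [IsAlgClosed L] (h2 : (2 : L) ≠ 0) (h3 : (3 : L) ≠ 0)
    (hG : IsIgusaModel (map (algebraMap K L) F) Ψ c)
    (h : IsPolarPair (Ψ (coordMap L a)) (Ψ (coordMap L b))) : hessian F a b b ≠ 0 := by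
  intro h0
  have := hG.hessian_eq (coordMap L a) (coordMap L b) (coordMap L b)
  rw [hessian_coordMap, h0, map_zero] at this
  exact h.left.igusaHessian_ne_zero h2 h3 h.right h.polar_left h.polar_right h.ne_smul
    ((mul_eq_zero.1 this.symm).resolve_left hG.ne_zero)

theorem isConic_conicForm [IsAlgClosed L] (h2 : (2 : L) ≠ 0) (h3 : (3 : L) ≠ 0) (hF : F.IsHomogeneous 4)
    (hG : IsIgusaModel (map (algebraMap K L) F) Ψ c)
    (h : IsPolarPair (Ψ (coordMap L a)) (Ψ (coordMap L b))) :
    IsConic (LinearMap.ker (polar F a) ⊓ LinearMap.ker (polar F b)) (conicForm F a b) where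
  finrank_eq := finrank_inf_ker (polar_ne_zero h2 h3 hG h) (exists_polar_eq_zero h2 h3 hG h)
  isHomogeneous := isHomogeneous_conicForm hF a b
  nonsingular w hw hwv := by
    have hpolar : ∀ u : Fin 5 → K, polar F u w = 0 →
        igusaPolar (Ψ (coordMap L u)) (Ψ (coordMap L w)) = 0 := fun u hu => by
      have := hG.polar_eq (coordMap L u) (coordMap L w)
      rw [polar_coordMap_coordMap, hu, map_zero] at this
      exact (mul_eq_zero.1 this.symm).resolve_left hG.ne_zero
    have hzero : Ψ (coordMap L w) = 0 := by
      refine h.left.eq_zero_of_conicValue_add h2 h3 h.right h.polar_left h.polar_right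
        h.ne_smul _ (hG.sum_eq _) (hpolar a hw.1) (hpolar b hw.2) fun z hz hxz hyz => ?_
      obtain ⟨v, rfl⟩ := hG.surjective z hz
      -- The hypothesis concerns only $K$-points of the plane. Writing the polar of the conic at $w$
      -- as a combination of the two equations of the plane carries it over to $L$-points.
      obtain ⟨p, q, hpq⟩ := exists_eq_comb (polar F a) (polar F b) (polar (conicForm F a b) w) hwv
      have hcoef : ∀ i, eval w (pderiv i (conicForm F a b)) =
          p * eval a (pderiv i F) + q * eval b (pderiv i F) := fun i => by
        rw [← polar_single, ← polar_single, ← polar_single, hpq]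
        rfl
      have hv : polar (map (algebraMap K L) (conicForm F a b)) (coordMap L w) v = 0 := by
        have e1 := hG.polar_eq (coordMap L a) v
        have e2 := hG.polar_eq (coordMap L b) v
        rw [polar_coordMap, hxz, mul_zero] at e1
        rw [polar_coordMap, hyz, mul_zero] at e2
        rw [polar_coordMap]
        simp only [hcoef, map_add, map_mul, add_mul, mul_assoc, Finset.sum_add_distrib,
          ← Finset.mul_sum, e1, e2, mul_zero, add_zero]
      have hadd := eval_add_of_isHomogeneous_two
        ((isHomogeneous_conicForm hF a b).map (algebraMap K L)) (coordMap L w) v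
      rw [hv, add_zero, map_conicForm, eval_conicForm_of_isIgusaModel hG,
        eval_conicForm_of_isIgusaModel hG, eval_conicForm_of_isIgusaModel hG, map_add,
        ← mul_add] at hadd
      exact mul_left_cancel₀ (pow_ne_zero 2 hG.ne_zero) hadd
    have := hG.injective (hzero.trans (map_zero Ψ).symm)
    exact coordMap_injective L (this.trans (map_zero (coordMap L)).symm)

theorem sup_span_singleton_eq {I : Ideal (MvPolynomial (Fin 5) K)} {P Q : MvPolynomial (Fin 5) K}
    {s : K} (hs : s ≠ 0) (h : C s * P - Q ∈ I) : I ⊔ Ideal.span {P} = I ⊔ Ideal.span {Q} := by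
  have hP : P ∈ I ⊔ Ideal.span {P} := Ideal.mem_sup_right (Ideal.mem_span_singleton_self P)
  have hQ : Q ∈ I ⊔ Ideal.span {Q} := Ideal.mem_sup_right (Ideal.mem_span_singleton_self Q)
  refine le_antisymm (sup_le le_sup_left ?_) (sup_le le_sup_left ?_)
  · rw [Ideal.span_singleton_le_iff_mem]
    have := Ideal.mul_mem_left _ (C s⁻¹) (Ideal.add_mem _ (Ideal.mem_sup_left h) hQ)
    rwa [sub_add_cancel, ← mul_assoc, ← C_mul, inv_mul_cancel₀ hs, C_1, one_mul] at this
  · rw [Ideal.span_singleton_le_iff_mem]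
    have := Ideal.sub_mem _ (Ideal.mul_mem_left _ (C s) hP) (Ideal.mem_sup_left h)
    rwa [sub_sub_cancel] at this

theorem sup_span_eq [IsAlgClosed L] (h2 : (2 : L) ≠ 0) (h3 : (3 : L) ≠ 0)
    (hG : IsIgusaModel (map (algebraMap K L) F) Ψ c)
    (h : IsPolarPair (Ψ (coordMap L a)) (Ψ (coordMap L b))) :
    linearIdeal (LinearMap.ker (polar F a) ⊓ LinearMap.ker (polar F b)) ⊔ Ideal.span {F} =
      linearIdeal (LinearMap.ker (polar F a) ⊓ LinearMap.ker (polar F b)) ⊔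
        Ideal.span {conicForm F a b ^ 2} := by
  have hmem := sub_conicForm_sq_mem h2 h3 hG h
  have hc : (2 : K) * hessian F a b b ^ 3 ≠ 0 := by
    refine mul_ne_zero (fun h20 => h2 ?_) (pow_ne_zero 3 (hessian_ne_zero h2 h3 hG h))
    rw [← map_ofNat (algebraMap K L), h20, map_zero]
  exact sup_span_singleton_eq hc hmem

theorem linearIdeal_sup_sectionIdeal (F : MvPolynomial (Fin 5) K)
    {W T : Submodule K (Fin 5 → K)} (hWT : W ≤ T) :
    linearIdeal W ⊔ sectionIdeal T F = linearIdeal W ⊔ Ideal.span {F} := by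
  rw [sectionIdeal, ← sup_assoc, sup_eq_left.2 (linearIdeal_anti hWT)]

theorem sectionIdeal_sup_sectionIdeal (F : MvPolynomial (Fin 5) K)
    (f g : Module.Dual K (Fin 5 → K)) :
    sectionIdeal (LinearMap.ker f) F ⊔ sectionIdeal (LinearMap.ker g) F =
      linearIdeal (LinearMap.ker f ⊓ LinearMap.ker g) ⊔ Ideal.span {F} := by
  rw [sectionIdeal, sectionIdeal, linearIdeal_inf_ker, sup_sup_sup_comm, sup_idem]

end Descent

/-! ### Nodes in projective space -/

section Nodes

variable {L : Type*} [Field L] {G : MvPolynomial (Fin 5) L}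
  {Ψ : (Fin 5 → L) →ₗ[L] (Fin 6 → L)} {c : L}

theorem igusaPolar_smul_left (x v : Fin 6 → L) (t : L) :
    igusaPolar (t • x) v = t ^ 3 * igusaPolar x v := by
  simp only [igusaPolar, Fin.sum_univ_six, Pi.smul_apply, smul_eq_mul]; ring

theorem igusaPolar_smul_right (x v : Fin 6 → L) (t : L) :
    igusaPolar x (t • v) = t * igusaPolar x v := by
  simp only [igusaPolar, Fin.sum_univ_six, Pi.smul_apply, smul_eq_mul]; ring

theorem igusaValue_smul (x : Fin 6 → L) (t : L) :
    igusaValue (t • x) = t ^ 4 * igusaValue x := by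
  simp only [igusaValue, Fin.sum_univ_six, Pi.smul_apply, smul_eq_mul]; ring

theorem igusaHessian_smul (x v w : Fin 6 → L) (t : L) :
    igusaHessian (t • x) v w = t ^ 2 * igusaHessian x v w :=
  igusaHessian_smul_base x v w t

theorem conicValue_smul (x y v : Fin 6 → L) (t : L) :
    conicValue x y (t • v) = t ^ 2 * conicValue x y v := by
  simp only [conicValue, igusaHessian, Fin.sum_univ_six, Pi.smul_apply, smul_eq_mul]; ring

theorem mem_tangentSpace_mk_iff (hG : IsIgusaModel G Ψ c) (u : Fin 5 → L) (hu : u ≠ 0)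
    (v : Fin 5 → L) :
    v ∈ tangentSpace G (Projectivization.mk L u hu) ↔ igusaPolar (Ψ u) (Ψ v) = 0 := by
  obtain ⟨t, ht⟩ := Projectivization.exists_smul_eq_mk_rep L u hu
  rw [tangentSpace, LinearMap.mem_ker, ← ht, hG.polar_eq, Units.smul_def, map_smul,
    igusaPolar_smul_left, mul_eq_zero, mul_eq_zero]
  simp [hG.ne_zero]

theorem isNode_mk (hG : IsIgusaModel G Ψ c) (u p : Fin 5 → L) (hu : u ≠ 0) (hp : p ≠ 0)
    (hu' : ∃ v, igusaPolar (Ψ u) (Ψ v) ≠ 0) (hup : igusaPolar (Ψ u) (Ψ p) = 0)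
    (hv : igusaValue (Ψ p) = 0)
    (hs : ∀ v, ∑ i, v i = 0 → igusaPolar (Ψ p) v = 0)
    (hn : ∀ v, ∑ i, v i = 0 → igusaPolar (Ψ u) v = 0 →
      (∀ w, ∑ i, w i = 0 → igusaPolar (Ψ u) w = 0 → igusaHessian (Ψ p) v w = 0) →
      ∃ c : L, v = c • Ψ p) :
    IsNode (tangentSpace G (Projectivization.mk L u hu)) G (Projectivization.mk L p hp) := by
  obtain ⟨t, ht⟩ := Projectivization.exists_smul_eq_mk_rep L p hp
  have hrep : (Projectivization.mk L p hp).rep = (t : L) • p := ht.symm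
  refine ⟨finrank_ker_of_ne_zero fun h0 => ?_, ?_, ?_, fun v _ => ?_, fun v hvT hvw => ?_⟩
  · obtain ⟨v, hv⟩ := hu'
    rw [Ne, ← mem_tangentSpace_mk_iff hG u hu] at hv
    exact hv (by rw [tangentSpace, h0]; simp)
  · rw [mem_tangentSpace_mk_iff hG, hrep, map_smul, igusaPolar_smul_right, hup, mul_zero]
  · rw [hrep, hG.eval_eq, map_smul, igusaValue_smul, hv, mul_zero, mul_zero]
  · rw [hrep, hG.polar_eq, map_smul, igusaPolar_smul_left, hs _ (hG.sum_eq v), mul_zero, mul_zero]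
  · obtain ⟨d, hd⟩ := hn (Ψ v) (hG.sum_eq v) ((mem_tangentSpace_mk_iff hG u hu v).1 hvT)
      fun w hw huw => by
        obtain ⟨w, rfl⟩ := hG.surjective w hw
        have := hvw w ((mem_tangentSpace_mk_iff hG u hu w).2 huw)
        rw [hrep, hG.hessian_eq, map_smul, igusaHessian_smul, mul_eq_zero, mul_eq_zero] at this
        exact (this.resolve_left hG.ne_zero).resolve_left (pow_ne_zero 2 t.ne_zero)
    rw [← map_smul] at hd
    rw [hG.injective hd, hrep, Submodule.mem_span_singleton]
    exact ⟨d * (t : L)⁻¹, by rw [smul_smul, inv_mul_cancel_right₀ t.ne_zero]⟩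

theorem mk_ne_mk {u p : Fin 5 → L} (hu : u ≠ 0) (hp : p ≠ 0)
    (h : ∀ c : L, Ψ p ≠ c • Ψ u) : Projectivization.mk L p hp ≠ Projectivization.mk L u hu := by
  rw [Ne, Projectivization.mk_eq_mk_iff']
  rintro ⟨c, hc⟩
  exact h c (by rw [← hc, map_smul])

theorem exists_nodes [IsAlgClosed L] (h2 : (2 : L) ≠ 0) (h3 : (3 : L) ≠ 0)
    (hG : IsIgusaModel G Ψ c) (u v : Fin 5 → L) (hu : u ≠ 0) (hv : v ≠ 0)
    (h : IsPolarPair (Ψ u) (Ψ v)) :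
    ∃ S : Finset (ℙ L (Fin 5 → L)), S.card = 5 ∧ Projectivization.mk L u hu ∉ S ∧
      Projectivization.mk L v hv ∉ S ∧ ∀ p ∈ S,
        p ∈ conicPoints (tangentSpace G (Projectivization.mk L u hu) ⊓
          tangentSpace G (Projectivization.mk L v hv)) (conicForm G u v) ∧
        IsNode (tangentSpace G (Projectivization.mk L u hu)) G p ∧
        IsNode (tangentSpace G (Projectivization.mk L v hv)) G p := by
  obtain ⟨w, hw, hne⟩ := h.left.exists_isCommonNode h2 h3 h.right h.polar_left h.polar_right
    h.ne_smul
  choose p hp using fun j => hG.surjective (w j) (hw j).sum_eq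
  have hp0 : ∀ j, p j ≠ 0 := fun j h0 => (hw j).ne_zero (by rw [← hp, h0, map_zero])
  simp only [← hp] at hw hne
  have hinj : Function.Injective fun j => Projectivization.mk L (p j) (hp0 j) := by
    intro i j hij
    by_contra hc
    exact mk_ne_mk (hp0 i) (hp0 j) (hne i j hc) hij.symm
  have hpolar : ∀ s t : L, ∃ z, igusaPolar (Ψ u) (Ψ z) = s ∧ igusaPolar (Ψ v) (Ψ z) = t :=
    fun s t => by
      obtain ⟨z, hz, h4, h5⟩ := h.left.exists_igusaPolar_eq h2 h3 h.right h.polar_left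
        h.polar_right h.ne_smul s t
      obtain ⟨z, rfl⟩ := hG.surjective z hz
      exact ⟨z, h4, h5⟩
  obtain ⟨z, hz1, hz2⟩ := hpolar 1 1
  refine ⟨Finset.univ.map ⟨_, hinj⟩, by simp, ?_, ?_, ?_⟩
  · simp only [Finset.mem_map, Finset.mem_univ, true_and, Function.Embedding.coeFn_mk, not_exists]
    exact fun j => mk_ne_mk hu (hp0 j) (hw j).ne_left
  · simp only [Finset.mem_map, Finset.mem_univ, true_and, Function.Embedding.coeFn_mk, not_exists]
    exact fun j => mk_ne_mk hv (hp0 j) (hw j).ne_right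
  · simp only [Finset.mem_map, Finset.mem_univ, true_and, Function.Embedding.coeFn_mk]
    rintro _ ⟨j, rfl⟩
    have hj := hw j
    have n1 := isNode_mk hG u (p j) hu (hp0 j) ⟨z, by rw [hz1]; exact one_ne_zero⟩ hj.polar_left
      hj.value_eq hj.singular hj.nondegenerate_left
    have n2 := isNode_mk hG v (p j) hv (hp0 j) ⟨z, by rw [hz2]; exact one_ne_zero⟩ hj.polar_right
      hj.value_eq hj.singular hj.nondegenerate_right
    refine ⟨⟨⟨n1.mem, n2.mem⟩, ?_⟩, n1, n2⟩
    obtain ⟨t, ht⟩ := Projectivization.exists_smul_eq_mk_rep L (p j) (hp0 j)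
    rw [← ht, Units.smul_def, eval_conicForm_of_isIgusaModel hG, map_smul, conicValue_smul,
      hj.conic_eq, mul_zero, mul_zero]

end Nodes

/-! ### Igusa quartics over a field -/

section BaseExtension

variable {k E L : Type*} [Field k] [Field E] [Field L] [Algebra k E] [Algebra k L] [Algebra E L]
  [IsScalarTower k E L] {F : MvPolynomial (Fin 5) k}

/-- The matrix over `L` of a linear isomorphism to the hyperplane over the subfield `E`. -/
def extendedMatrix (L : Type*) [Field L] [Algebra E L] (φ : (Fin 5 → E) ≃ₗ[E] sumZero E) :
    Fin 6 → Fin 5 → L :=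
  fun j i => algebraMap E L ((φ (Pi.single i 1) : Fin 6 → E) j)

theorem mem_sumZero_iff {x : Fin 6 → E} : x ∈ sumZero E ↔ ∑ j, x j = 0 := by
  simp [sumZero]

theorem coe_apply_eq_sum (φ : (Fin 5 → E) ≃ₗ[E] sumZero E) (v : Fin 5 → E) (j : Fin 6) :
    (φ v : Fin 6 → E) j = ∑ i, (φ (Pi.single i 1) : Fin 6 → E) j * v i := by
  conv_lhs => rw [pi_eq_sum_univ' v]
  simp [mul_comm]

theorem sum_extendedMatrix (φ : (Fin 5 → E) ≃ₗ[E] sumZero E) (i : Fin 5) :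
    ∑ j, extendedMatrix L φ j i = 0 := by
  simp only [extendedMatrix]
  rw [← map_sum, mem_sumZero_iff.1 (φ (Pi.single i 1)).2, map_zero]

/-- A left inverse of the matrix over $E$ remains one over $L$. -/
theorem eq_zero_of_extendedMatrix (φ : (Fin 5 → E) ≃ₗ[E] sumZero E) (v : Fin 5 → L)
    (hv : ∀ j, ∑ i, extendedMatrix L φ j i * v i = 0) : v = 0 := by
  obtain ⟨g, hg⟩ := LinearMap.exists_leftInverse_of_injective
    ((sumZero E).subtype ∘ₗ φ.toLinearMap)
    (LinearMap.ker_eq_bot.2 ((sumZero E).subtype_injective.comp φ.injective))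
  have hg' : ∀ i m, ∑ j, g (Pi.single j 1) m * (φ (Pi.single i 1) : Fin 6 → E) j =
      (Pi.single i 1 : Fin 5 → E) m := fun i m => by
    have h1 : g (φ (Pi.single i 1)) = Pi.single i 1 := LinearMap.congr_fun hg (Pi.single i 1)
    refine Eq.trans ?_ (congrFun h1 m)
    conv_rhs => rw [pi_eq_sum_univ' (φ (Pi.single i 1) : Fin 6 → E)]
    simp [mul_comm]
  ext m
  calc v m = ∑ i, algebraMap E L ((Pi.single i 1 : Fin 5 → E) m) * v i := by
        simp [Pi.single_apply]
    _ = ∑ i, ∑ j, algebraMap E L (g (Pi.single j 1) m) * (extendedMatrix L φ j i * v i) := by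
        refine Finset.sum_congr rfl fun i _ => ?_
        rw [← hg', map_sum, Finset.sum_mul]
        simp only [map_mul, extendedMatrix, mul_assoc]
    _ = 0 := by
        rw [Finset.sum_comm]
        simp only [← Finset.mul_sum, hv, mul_zero, Finset.sum_const_zero]

theorem IsIsoToIgusa.exists_isIgusaModel {φ : (Fin 5 → E) ≃ₗ[E] sumZero E}
    (h : IsIsoToIgusa E F φ) :
    ∃ c : L, IsIgusaModel (map (algebraMap k L) F)
      (Matrix.of (extendedMatrix L φ)).mulVecLin c := by
  obtain ⟨c, hc, hF⟩ := h
  refine ⟨algebraMap E L c, ?_⟩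
  convert isIgusaModel_of_matrix (extendedMatrix L φ) (algebraMap E L c)
    ((map_ne_zero _).2 hc) (sum_extendedMatrix φ) (eq_zero_of_extendedMatrix φ) using 1
  rw [IsScalarTower.algebraMap_eq k E L, ← map_map, hF, map_mul, map_C, bind₁_igusaForm,
    bind₁_igusaForm]
  simp only [map_sub, map_mul, map_pow, map_sum, map_ofNat, linearForm, extendedMatrix, map_C,
    map_X]

theorem mulVecLin_coordMap (φ : (Fin 5 → E) ≃ₗ[E] sumZero E) (a : Fin 5 → k) (j : Fin 6) :
    (Matrix.of (extendedMatrix L φ)).mulVecLin (coordMap L a) j =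
      algebraMap E L ((φ (coordMap E a) : Fin 6 → E) j) := by
  rw [coe_apply_eq_sum, map_sum]
  simp only [Matrix.mulVecLin_apply, Matrix.mulVec, dotProduct, Matrix.of_apply, extendedMatrix,
    map_mul, coordMap_apply, ← IsScalarTower.algebraMap_apply k E L]

theorem isGeneralPoint {φ : (Fin 5 → E) ≃ₗ[E] sumZero E} {c : L}
    (hG : IsIgusaModel (map (algebraMap k L) F) (Matrix.of (extendedMatrix L φ)).mulVecLin c)
    {a : ℙ k (Fin 5 → k)} (ha : eval a.rep F = 0) (haE : a ∉ exceptional E φ) :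
    IsGeneralPoint ((Matrix.of (extendedMatrix L φ)).mulVecLin (coordMap L a.rep)) where
  sum_eq := hG.sum_eq _
  value_eq := by
    have := hG.eval_eq (coordMap L a.rep)
    rw [eval_coordMap, ha, map_zero] at this
    exact (mul_eq_zero.1 this.symm).resolve_left hG.ne_zero
  triple_ne i j l hij hil hjl h0 := by
    obtain ⟨σ, rfl, rfl, rfl⟩ := exists_perm_fin_six i j l hij hil hjl
    refine haE ⟨σ, ?_⟩
    rw [mulVecLin_coordMap, mulVecLin_coordMap, mulVecLin_coordMap, ← map_add, ← map_add,
      map_eq_zero] at h0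
    exact h0

/-- The factor is a ratio of coordinates of $k$-points, hence lies in $k$. -/
theorem eq_of_coordMap_eq_smul {a b : ℙ k (Fin 5 → k)} {d : L}
    (h : coordMap L b.rep = d • coordMap L a.rep) : a = b := by
  obtain ⟨i, hi⟩ := Function.ne_iff.1 a.rep_nonzero
  have hcoord : ∀ j, algebraMap k L (b.rep j) = d * algebraMap k L (a.rep j) := congrFun h
  have hi' : algebraMap k L (a.rep i) ≠ 0 := (map_ne_zero _).2 hi
  have hd : d = algebraMap k L (b.rep i / a.rep i) := by
    rw [map_div₀, hcoord, mul_div_cancel_right₀ _ hi']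
  have hsmul : (b.rep i / a.rep i) • a.rep = b.rep := by
    ext j
    apply (algebraMap k L).injective
    rw [hcoord, hd, Pi.smul_apply, smul_eq_mul, map_mul]
  rw [← a.mk_rep, ← b.mk_rep, eq_comm, Projectivization.mk_eq_mk_iff']
  exact ⟨_, hsmul⟩

theorem isPolarPair {φ : (Fin 5 → E) ≃ₗ[E] sumZero E} {c : L}
    (hG : IsIgusaModel (map (algebraMap k L) F) (Matrix.of (extendedMatrix L φ)).mulVecLin c)
    {a b : ℙ k (Fin 5 → k)} (hab : a ≠ b) (ha : eval a.rep F = 0) (hb : eval b.rep F = 0)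
    (haE : a ∉ exceptional E φ) (hbE : b ∉ exceptional E φ)
    (hPab : polar F a.rep b.rep = 0) (hPba : polar F b.rep a.rep = 0) :
    IsPolarPair ((Matrix.of (extendedMatrix L φ)).mulVecLin (coordMap L a.rep))
      ((Matrix.of (extendedMatrix L φ)).mulVecLin (coordMap L b.rep)) := by
  have hpolar : ∀ u v : Fin 5 → k, polar F u v = 0 →
      igusaPolar ((Matrix.of (extendedMatrix L φ)).mulVecLin (coordMap L u))
        ((Matrix.of (extendedMatrix L φ)).mulVecLin (coordMap L v)) = 0 := fun u v huv => by
    have := hG.polar_eq (coordMap L u) (coordMap L v)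
    rw [polar_coordMap_coordMap, huv, map_zero] at this
    exact (mul_eq_zero.1 this.symm).resolve_left hG.ne_zero
  refine ⟨isGeneralPoint hG ha haE, isGeneralPoint hG hb hbE, hpolar _ _ hPab, hpolar _ _ hPba,
    fun d hd => ?_⟩
  rw [← map_smul] at hd
  exact hab (eq_of_coordMap_eq_smul (hG.injective hd))

end BaseExtension

/-! ### Tropes and points of the conic over the ground field. -/

section PolarPair

variable {K L : Type*} [Field K] [Field L] [Algebra K L]
  {F : MvPolynomial (Fin 5) K} {Ψ : (Fin 5 → L) →ₗ[L] (Fin 6 → L)} {c : L}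

theorem polar_self_eq_zero {a : Fin 5 → K} (hG : IsIgusaModel (map (algebraMap K L) F) Ψ c)
    (ha : IsGeneralPoint (Ψ (coordMap L a))) : polar F a a = 0 := by
  apply (algebraMap K L).injective
  rw [← polar_coordMap_coordMap, hG.polar_eq, igusaPolar_self, ha.value_eq, mul_zero, mul_zero,
    map_zero]

theorem polar_eq_zero_of_igusaPolar {a b : Fin 5 → K}
    (hG : IsIgusaModel (map (algebraMap K L) F) Ψ c)
    (h : igusaPolar (Ψ (coordMap L a)) (Ψ (coordMap L b)) = 0) : polar F a b = 0 := by
  apply (algebraMap K L).injective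
  rw [← polar_coordMap_coordMap, hG.polar_eq, h, mul_zero, map_zero]

theorem eval_conicForm_eq_zero {a b v : Fin 5 → K}
    (hG : IsIgusaModel (map (algebraMap K L) F) Ψ c)
    (h : conicValue (Ψ (coordMap L a)) (Ψ (coordMap L b)) (Ψ (coordMap L v)) = 0) :
    eval v (conicForm F a b) = 0 := by
  apply (algebraMap K L).injective
  rw [← eval_coordMap, map_conicForm, eval_conicForm_of_isIgusaModel hG, h, mul_zero, map_zero]

theorem left_mem_conicPoints {a b : ℙ K (Fin 5 → K)}
    (hG : IsIgusaModel (map (algebraMap K L) F) Ψ c)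
    (h : IsPolarPair (Ψ (coordMap L a.rep)) (Ψ (coordMap L b.rep))) :
    a ∈ conicPoints (tangentSpace F a ⊓ tangentSpace F b) (conicForm F a.rep b.rep) :=
  ⟨⟨polar_self_eq_zero hG h.left, polar_eq_zero_of_igusaPolar hG h.polar_right⟩,
    eval_conicForm_eq_zero hG (conicValue_left h.polar_left)⟩

theorem right_mem_conicPoints {a b : ℙ K (Fin 5 → K)}
    (hG : IsIgusaModel (map (algebraMap K L) F) Ψ c)
    (h : IsPolarPair (Ψ (coordMap L a.rep)) (Ψ (coordMap L b.rep))) :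
    b ∈ conicPoints (tangentSpace F a ⊓ tangentSpace F b) (conicForm F a.rep b.rep) :=
  ⟨⟨polar_eq_zero_of_igusaPolar hG h.polar_left, polar_self_eq_zero hG h.right⟩,
    eval_conicForm_eq_zero hG (conicValue_right h.polar_right)⟩

theorem isTrope [IsAlgClosed L] (h2 : (2 : L) ≠ 0) (h3 : (3 : L) ≠ 0) (hF : F.IsHomogeneous 4)
    {a b : ℙ K (Fin 5 → K)} (hG : IsIgusaModel (map (algebraMap K L) F) Ψ c)
    (h : IsPolarPair (Ψ (coordMap L a.rep)) (Ψ (coordMap L b.rep)))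
    {T : Submodule K (Fin 5 → K)} (hT : tangentSpace F a ⊓ tangentSpace F b ≤ T) :
    IsTrope T F (tangentSpace F a ⊓ tangentSpace F b) :=
  ⟨hT, conicForm F a.rep b.rep, isConic_conicForm h2 h3 hF hG h,
    (linearIdeal_sup_sectionIdeal F hT).trans (sup_span_eq h2 h3 hG h)⟩

theorem pointMap_eq_mk (a : ℙ K (Fin 5 → K)) (ha : coordMap L a.rep ≠ 0) :
    pointMap L a = Projectivization.mk L (coordMap L a.rep) ha := by
  conv_lhs => rw [← a.mk_rep]
  rw [pointMap, Projectivization.map_mk]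

end PolarPair

end IgusaQuartic

end

theorem propositionP {k : Type*} [Field k] (h2 : (2 : k) ≠ 0) (h3 : (3 : k) ≠ 0)
    -- an Igusa quartic over `k`, with an isomorphism to the standard one over `kˢᵉᵖ`
    (F : MvPolynomial (Fin 5) k) (hF : F.IsHomogeneous 4)
    (φ : (Fin 5 → SeparableClosure k) ≃ₗ[SeparableClosure k]
      IgusaQuartic.sumZero (SeparableClosure k))
    (hφ : IgusaQuartic.IsIsoToIgusa (SeparableClosure k) F φ)
    -- distinct points of the quartic, outside the exceptional locus
    (a b : ℙ k (Fin 5 → k)) (hab : a ≠ b)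
    (ha : MvPolynomial.eval a.rep F = 0) (hb : MvPolynomial.eval b.rep F = 0)
    (haE : a ∉ IgusaQuartic.exceptional (SeparableClosure k) φ)
    (hbE : b ∉ IgusaQuartic.exceptional (SeparableClosure k) φ)
    (hPab : IgusaQuartic.polar F a.rep b.rep = 0)
    (hPba : IgusaQuartic.polar F b.rep a.rep = 0) :
    -- the intersection of the tangent spaces is a trope of both surfaces
    IgusaQuartic.IsTrope (IgusaQuartic.tangentSpace F a) F
      (IgusaQuartic.tangentSpace F a ⊓ IgusaQuartic.tangentSpace F b) ∧
    IgusaQuartic.IsTrope (IgusaQuartic.tangentSpace F b) F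
      (IgusaQuartic.tangentSpace F a ⊓ IgusaQuartic.tangentSpace F b) ∧
    -- the intersection of the surfaces is a double conic
    ∃ q : MvPolynomial (Fin 5) k,
      IgusaQuartic.IsDoubleConic (IgusaQuartic.kummer F a ⊔ IgusaQuartic.kummer F b)
        (IgusaQuartic.tangentSpace F a ⊓ IgusaQuartic.tangentSpace F b) q ∧
      a ∈ IgusaQuartic.conicPoints
        (IgusaQuartic.tangentSpace F a ⊓ IgusaQuartic.tangentSpace F b) q ∧
      b ∈ IgusaQuartic.conicPoints
        (IgusaQuartic.tangentSpace F a ⊓ IgusaQuartic.tangentSpace F b) q ∧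
      -- and it passes through five common nodes, other than `a` and `b`, over the algebraic closure
      ∃ S : Finset (ℙ (AlgebraicClosure k) (Fin 5 → AlgebraicClosure k)),
        let Fbar := MvPolynomial.map (algebraMap k (AlgebraicClosure k)) F
        let abar := IgusaQuartic.pointMap (AlgebraicClosure k) a
        let bbar := IgusaQuartic.pointMap (AlgebraicClosure k) b
        S.card = 5 ∧ abar ∉ S ∧ bbar ∉ S ∧
        ∀ p ∈ S,
          p ∈ IgusaQuartic.conicPoints
            (IgusaQuartic.tangentSpace Fbar abar ⊓ IgusaQuartic.tangentSpace Fbar bbar)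
            (MvPolynomial.map (algebraMap k (AlgebraicClosure k)) q) ∧
          IgusaQuartic.IsNode (IgusaQuartic.tangentSpace Fbar abar) Fbar p ∧
          IgusaQuartic.IsNode (IgusaQuartic.tangentSpace Fbar bbar) Fbar p := by
  have h2' : (2 : AlgebraicClosure k) ≠ 0 := by
    rw [← map_ofNat (algebraMap k (AlgebraicClosure k)) 2]
    exact (map_ne_zero _).2 h2
  have h3' : (3 : AlgebraicClosure k) ≠ 0 := by
    rw [← map_ofNat (algebraMap k (AlgebraicClosure k)) 3]
    exact (map_ne_zero _).2 h3
  -- The isomorphism over the separable closure is extended to the algebraic closure, where square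
  -- roots exist; only the resulting identities descend to $k$.
  obtain ⟨c, hG⟩ := hφ.exists_isIgusaModel (L := AlgebraicClosure k)
  have h := IgusaQuartic.isPolarPair hG hab ha hb haE hbE hPab hPba
  have hne : ∀ p : ℙ k (Fin 5 → k), IgusaQuartic.coordMap (AlgebraicClosure k) p.rep ≠ 0 :=
    fun p h0 => p.rep_nonzero
      (IgusaQuartic.coordMap_injective (AlgebraicClosure k) (h0.trans (map_zero _).symm))
  refine ⟨IgusaQuartic.isTrope h2' h3' hF hG h inf_le_left,
    IgusaQuartic.isTrope h2' h3' hF hG h inf_le_right,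
    IgusaQuartic.conicForm F a.rep b.rep,
    ⟨IgusaQuartic.isConic_conicForm h2' h3' hF hG h,
      (IgusaQuartic.sectionIdeal_sup_sectionIdeal F _ _).trans
        (IgusaQuartic.sup_span_eq h2' h3' hG h)⟩,
    IgusaQuartic.left_mem_conicPoints hG h, IgusaQuartic.right_mem_conicPoints hG h, ?_⟩
  rw [IgusaQuartic.pointMap_eq_mk a (hne a), IgusaQuartic.pointMap_eq_mk b (hne b),
    IgusaQuartic.map_conicForm]
  exact IgusaQuartic.exists_nodes h2' h3' hG _ _ (hne a) (hne b) h
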